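/- Let $A$ be a $\sigma$-unital (not necessarily unital) $C^*$-algebra, let $G$ be a second-countable compact (Hausdorff) group, and let $\alpha\colon G\to\mathrm{Aut}(A)$ be a (point-norm continuous) action with the Rokhlin property. Denote by $A^\alpha$ the fixed point algebra and by $A\rtimes_\alpha G$ the crossed product, that is, the enveloping $C^*$-algebra of $L^1(G,A,\alpha)$. 1. If $A$ has real rank zero, then so do $A^\alpha$ and $A\rtimes_\alpha G$. 2. If $A$ has stable rank one, then so do $A^\alpha$ and $A\rtimes_\alpha G$. Here a unital $C^*$-algebra has *real rank zero* if its invertible self-adjoint elements are dense in the set of its self-adjoint elements, and *stable rank one* if its invertible elements are dense; a non-unital $C^*$-algebra has real rank zero (stable rank one) if its minimal unitization does. The Rokhlin property is defined as follows. Let $A_\infty=\ell^\infty(\mathbb N,A)/c_0(\mathbb N,A)$ with quotient map $\eta$, let $\ell^\infty_\alpha(\mathbb N,A)$ be the set of those $a=(a_n)_n\in\ell^\infty(\mathbb N,A)$ for which $g\mapsto(\alpha_g(a_n))_n$ is norm-continuous, and put $A_{\infty,\alpha}=\eta(\ell^\infty_\alpha(\mathbb N,A))$. For an $\alpha$-invariant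 $C^*$-subalgebra $D\subseteq A$, let $A_\infty\cap D'$ be the relative commutant of (the constant sequences in) $D$, let $\mathrm{Ann}(D,A_\infty)=\{x\in A_\infty : xD=Dx=0\}$, let $F(D,A)=(A_\infty\cap D')/\mathrm{Ann}(D,A_\infty)$ with quotient map $\kappa$ and with the action $F(\alpha)$ induced by applying $\alpha_g$ to each term of a sequence, and let $F_\alpha(D,A)=\kappa(A_{\infty,\alpha}\cap D')$. Then $\alpha$ has the *Rokhlin property* if for every separable $\alpha$-invariant $C^*$-subalgebra $D\subseteq A$ there is a unital $*$-homomorphism $\varphi\colon C(G)\to F_\alpha(D,A)$ with $\varphi(\mathtt{Lt}_g f)=F(\alpha)_g(\varphi(f))$ for all $g\in G$, $f\in C(G)$, where $(\mathtt{Lt}_g f)(h)=f(g^{-1}h)$. -/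

import Mathlib

open MeasureTheory Filter Topology
open scoped ENNReal

noncomputable section

/-! ### `σ`-unital algebras, real rank zero, stable rank one -/

section Ranks

/-- `A` is `σ`-unital: it has a countable approximate unit, consisting of positive contractions. -/
def IsSigmaUnital (A : Type*) [NonUnitalCStarAlgebra A] : Prop :=
  ∃ e : ℕ → A, (∀ n, (∃ b, e n = star b * b) ∧ ‖e n‖ ≤ 1) ∧
    ∀ a : A, Tendsto (fun n => e n * a) atTop (𝓝 a) ∧ Tendsto (fun n => a * e n) atTop (𝓝 a)

/-- `e` is a (two-sided) multiplicative unit of the not necessarily unital ring `A`. -/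
def IsUnitElement {A : Type*} [Mul A] (e : A) : Prop := ∀ a : A, e * a = a ∧ a * e = a

/-- `b` is invertible with respect to the unit `e`. -/
def IsInvertibleFor {A : Type*} [Mul A] (e b : A) : Prop := ∃ c : A, b * c = e ∧ c * b = e

/-- Real rank zero. If `A` has a unit `e`, the invertible self-adjoint elements are dense in the
self-adjoint ones; if `A` has no unit, the same is required of the minimal unitization of `A`. -/
def RealRankZero (A : Type*) [NonUnitalCStarAlgebra A] : Prop :=
  (∃ e : A, IsUnitElement e ∧
      {a : A | IsSelfAdjoint a} ⊆ closure {b : A | IsSelfAdjoint b ∧ IsInvertibleFor e b}) ∨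
  ((¬ ∃ e : A, IsUnitElement e) ∧
      {a : Unitization ℂ A | IsSelfAdjoint a} ⊆
        closure {b : Unitization ℂ A | IsSelfAdjoint b ∧ IsUnit b})

/-- Stable rank one. If `A` has a unit `e`, the invertible elements are dense in `A`; if `A` has no
unit, the same is required of the minimal unitization of `A`. -/
def StableRankOne (A : Type*) [NonUnitalCStarAlgebra A] : Prop :=
  (∃ e : A, IsUnitElement e ∧ Dense {b : A | IsInvertibleFor e b}) ∨
  ((¬ ∃ e : A, IsUnitElement e) ∧ Dense {b : Unitization ℂ A | IsUnit b})

end Ranks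

/-! ### Quotients of `*`-algebras -/

section Quotients

/-- A self-adjoint two-sided ideal of a (not necessarily unital) complex `*`-algebra. -/
structure StarIdeal (R : Type*) [NonUnitalRing R] [StarRing R] [Module ℂ R] extends
    Submodule ℂ R where
  mul_left_mem' : ∀ (r : R) {x : R}, x ∈ carrier → r * x ∈ carrier
  mul_right_mem' : ∀ (r : R) {x : R}, x ∈ carrier → x * r ∈ carrier
  star_mem' : ∀ {x : R}, x ∈ carrier → star x ∈ carrier

namespace StarIdeal

variable {R : Type*} [NonUnitalRing R] [StarRing R] [Module ℂ R]

/-- The quotient of a `*`-algebra by a self-adjoint ideal. -/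
def Quot (I : StarIdeal R) : Type _ := R ⧸ I.toSubmodule

variable (I : StarIdeal R)

instance : AddCommGroup I.Quot := inferInstanceAs (AddCommGroup (R ⧸ I.toSubmodule))
instance : Module ℂ I.Quot := inferInstanceAs (Module ℂ (R ⧸ I.toSubmodule))

/-- The quotient map, as a linear map. -/
def mkₗ : R →ₗ[ℂ] I.Quot := I.toSubmodule.mkQ

theorem mkₗ_surjective : Function.Surjective I.mkₗ := Submodule.mkQ_surjective _

theorem mkₗ_eq_iff {x y : R} : I.mkₗ x = I.mkₗ y ↔ x - y ∈ I.toSubmodule :=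
  Submodule.Quotient.eq _

instance : Mul I.Quot where
  mul := Quotient.map₂ (· * ·) (by
    intro a b hab c d hcd
    have h1 : a - b ∈ I.toSubmodule := (Submodule.quotientRel_def _).1 hab
    have h2 : c - d ∈ I.toSubmodule := (Submodule.quotientRel_def _).1 hcd
    refine (Submodule.quotientRel_def _).2 ?_
    have : a * c - b * d = (a - b) * c + b * (c - d) := by noncomm_ring
    rw [this]
    exact add_mem (I.mul_right_mem' _ h1) (I.mul_left_mem' _ h2))

instance : Star I.Quot where
  star := Quotient.map star (by
    intro a b hab
    have h1 : a - b ∈ I.toSubmodule := (Submodule.quotientRel_def _).1 hab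
    refine (Submodule.quotientRel_def _).2 ?_
    rw [← star_sub]
    exact I.star_mem' h1)

theorem mkₗ_mul (x y : R) : I.mkₗ (x * y) = I.mkₗ x * I.mkₗ y := rfl

theorem mkₗ_star (x : R) : I.mkₗ (star x) = star (I.mkₗ x) := rfl

instance : NonUnitalRing I.Quot :=
  { (inferInstance : AddCommGroup I.Quot), (inferInstance : Mul I.Quot) with
    left_distrib := by
      intro a b c
      obtain ⟨a, rfl⟩ := I.mkₗ_surjective a
      obtain ⟨b, rfl⟩ := I.mkₗ_surjective b
      obtain ⟨c, rfl⟩ := I.mkₗ_surjective c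
      rw [← map_add, ← mkₗ_mul, mul_add, map_add, mkₗ_mul, mkₗ_mul]
    right_distrib := by
      intro a b c
      obtain ⟨a, rfl⟩ := I.mkₗ_surjective a
      obtain ⟨b, rfl⟩ := I.mkₗ_surjective b
      obtain ⟨c, rfl⟩ := I.mkₗ_surjective c
      rw [← map_add, ← mkₗ_mul, add_mul, map_add, mkₗ_mul, mkₗ_mul]
    zero_mul := by
      intro a
      obtain ⟨a, rfl⟩ := I.mkₗ_surjective a
      rw [← map_zero I.mkₗ, ← mkₗ_mul, zero_mul]
    mul_zero := by
      intro a
      obtain ⟨a, rfl⟩ := I.mkₗ_surjective a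
      rw [← map_zero I.mkₗ, ← mkₗ_mul, mul_zero]
    mul_assoc := by
      intro a b c
      obtain ⟨a, rfl⟩ := I.mkₗ_surjective a
      obtain ⟨b, rfl⟩ := I.mkₗ_surjective b
      obtain ⟨c, rfl⟩ := I.mkₗ_surjective c
      simp only [← mkₗ_mul, mul_assoc] }

instance : StarRing I.Quot where
  star_involutive := by
    intro a
    obtain ⟨a, rfl⟩ := I.mkₗ_surjective a
    rw [← mkₗ_star, ← mkₗ_star, star_star]
  star_mul := by
    intro a b
    obtain ⟨a, rfl⟩ := I.mkₗ_surjective a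
    obtain ⟨b, rfl⟩ := I.mkₗ_surjective b
    rw [← mkₗ_mul, ← mkₗ_star, star_mul, mkₗ_mul, mkₗ_star, mkₗ_star]
  star_add := by
    intro a b
    obtain ⟨a, rfl⟩ := I.mkₗ_surjective a
    obtain ⟨b, rfl⟩ := I.mkₗ_surjective b
    rw [← map_add, ← mkₗ_star, star_add, map_add, mkₗ_star, mkₗ_star]

instance [IsScalarTower ℂ R R] : IsScalarTower ℂ I.Quot I.Quot where
  smul_assoc := by
    intro z a b
    obtain ⟨a, rfl⟩ := I.mkₗ_surjective a
    obtain ⟨b, rfl⟩ := I.mkₗ_surjective b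
    rw [smul_eq_mul, smul_eq_mul, ← map_smul, ← mkₗ_mul, smul_mul_assoc, map_smul, mkₗ_mul]

instance [SMulCommClass ℂ R R] : SMulCommClass ℂ I.Quot I.Quot where
  smul_comm := by
    intro z a b
    obtain ⟨a, rfl⟩ := I.mkₗ_surjective a
    obtain ⟨b, rfl⟩ := I.mkₗ_surjective b
    rw [smul_eq_mul, smul_eq_mul, ← map_smul, ← mkₗ_mul, ← mkₗ_mul, ← map_smul, mul_smul_comm]

instance [StarModule ℂ R] : StarModule ℂ I.Quot where
  star_smul := by
    intro z a
    obtain ⟨a, rfl⟩ := I.mkₗ_surjective a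
    rw [← map_smul, ← mkₗ_star, star_smul, map_smul, mkₗ_star]

/-- The quotient map, as a `*`-homomorphism. -/
def proj : R →⋆ₙₐ[ℂ] I.Quot where
  toFun := I.mkₗ
  map_smul' := map_smul I.mkₗ
  map_zero' := map_zero I.mkₗ
  map_add' := map_add I.mkₗ
  map_mul' := I.mkₗ_mul
  map_star' := I.mkₗ_star

variable {S : Type*} [NonUnitalRing S] [StarRing S] [Module ℂ S]

/-- The `*`-homomorphism between quotients induced by a `*`-homomorphism `f` that maps the ideal
`I` into the ideal `J`. -/
def map (I : StarIdeal R) (J : StarIdeal S) (f : R →⋆ₙₐ[ℂ] S)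
    (h : ∀ x ∈ I.toSubmodule, f x ∈ J.toSubmodule) : I.Quot →⋆ₙₐ[ℂ] J.Quot where
  toFun := Quotient.map f (by
    intro a b hab
    have h1 : a - b ∈ I.toSubmodule := (Submodule.quotientRel_def _).1 hab
    refine (Submodule.quotientRel_def _).2 ?_
    rw [← map_sub]
    exact h _ h1)
  map_smul' := by
    intro z a
    obtain ⟨a, rfl⟩ := I.mkₗ_surjective a
    exact congrArg J.mkₗ (map_smul f z a)
  map_zero' := congrArg J.mkₗ (map_zero f)
  map_add' := by
    intro a b
    obtain ⟨a, rfl⟩ := I.mkₗ_surjective a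
    obtain ⟨b, rfl⟩ := I.mkₗ_surjective b
    exact congrArg J.mkₗ (map_add f a b)
  map_mul' := by
    intro a b
    obtain ⟨a, rfl⟩ := I.mkₗ_surjective a
    obtain ⟨b, rfl⟩ := I.mkₗ_surjective b
    exact congrArg J.mkₗ (map_mul f a b)
  map_star' := by
    intro a
    obtain ⟨a, rfl⟩ := I.mkₗ_surjective a
    exact congrArg J.mkₗ (map_star f a)

theorem map_proj (I : StarIdeal R) (J : StarIdeal S) (f : R →⋆ₙₐ[ℂ] S)
    (h : ∀ x ∈ I.toSubmodule, f x ∈ J.toSubmodule) (x : R) :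
    map I J f h (I.proj x) = J.proj (f x) := rfl

end StarIdeal

end Quotients

/-! ### Actions, fixed point algebras -/

/-- A continuous action of a topological group `G` on a `C*`-algebra `A`: a homomorphism
`G → Aut(A)` that is continuous in the point-norm topology. -/
structure CStarAction (G A : Type*) [Group G] [TopologicalSpace G] [NonUnitalCStarAlgebra A] where
  toHom : G →* (A ≃⋆ₐ[ℂ] A)
  continuous_apply : ∀ a : A, Continuous fun g => toHom g a

namespace CStarAction

section Fixed

variable {G A : Type*} [Group G] [TopologicalSpace G] [NonUnitalCStarAlgebra A]
  (α : CStarAction G A)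

theorem norm_apply (g : G) (a : A) : ‖α.toHom g a‖ = ‖a‖ :=
  NonUnitalStarAlgHom.norm_map (α.toHom g) (α.toHom g).injective a

theorem mul_apply (g h : G) (a : A) : α.toHom (g * h) a = α.toHom g (α.toHom h a) := by
  rw [map_mul]; rfl

theorem one_apply (a : A) : α.toHom 1 a = a := by
  rw [map_one]; rfl

/-- Joint continuity of the action. -/
theorem continuous_uncurry : Continuous fun p : G × A => α.toHom p.1 p.2 := by
  rw [continuous_iff_continuousAt]
  rintro ⟨g, a⟩
  rw [ContinuousAt, tendsto_iff_norm_sub_tendsto_zero]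
  have h1 : Tendsto (fun p : G × A => ‖p.2 - a‖ + ‖α.toHom p.1 a - α.toHom g a‖) (𝓝 (g, a))
      (𝓝 (‖a - a‖ + ‖α.toHom g a - α.toHom g a‖)) := by
    have hc : Continuous fun p : G × A => ‖p.2 - a‖ + ‖α.toHom p.1 a - α.toHom g a‖ :=
      ((continuous_snd.sub continuous_const).norm).add
        ((((α.continuous_apply a).comp continuous_fst).sub continuous_const).norm)
    exact hc.tendsto (g, a)
  simp only [sub_self, norm_zero, add_zero] at h1
  refine squeeze_zero (fun _ => norm_nonneg _) (fun p => ?_) h1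
  calc ‖α.toHom p.1 p.2 - α.toHom g a‖
      = ‖α.toHom p.1 (p.2 - a) + (α.toHom p.1 a - α.toHom g a)‖ := by
        rw [map_sub]; congr 1; abel
    _ ≤ ‖α.toHom p.1 (p.2 - a)‖ + ‖α.toHom p.1 a - α.toHom g a‖ := norm_add_le _ _
    _ = _ := by rw [α.norm_apply]

/-- The fixed point algebra `A^α`. -/
def fixedPoints : NonUnitalStarSubalgebra ℂ A where
  carrier := {a | ∀ g, α.toHom g a = a}
  add_mem' := by intro a b ha hb g; rw [map_add, ha, hb]
  zero_mem' := by intro g; exact map_zero _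
  mul_mem' := by intro a b ha hb g; rw [map_mul, ha, hb]
  smul_mem' := by intro z a ha g; rw [map_smul, ha]
  star_mem' := by intro a ha g; rw [map_star, ha]

instance : IsClosed (α.fixedPoints : Set A) := by
  have : (α.fixedPoints : Set A) = ⋂ g, {a | α.toHom g a = a} := by
    ext a; rw [Set.mem_iInter]; rfl
  rw [this]
  refine isClosed_iInter fun g => isClosed_eq ?_ continuous_id
  exact α.continuous_uncurry.comp (Continuous.prodMk_right g)

end Fixed

end CStarAction

/-! ### Sequence algebras -/

section Sequences

variable (A : Type*) [NonUnitalCStarAlgebra A]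

/-- The `C*`-algebra `ℓ^∞(ℕ, A)` of bounded sequences in `A`. -/
abbrev BddSeq : Type _ := lp (fun _ : ℕ => A) ∞

/-- The ideal `c₀(ℕ, A)` of `ℓ^∞(ℕ, A)`. -/
def nullSeq : StarIdeal (BddSeq A) where
  carrier := {a | Tendsto (fun n => ‖a n‖) atTop (𝓝 0)}
  add_mem' := by
    intro a b ha hb
    refine squeeze_zero (fun _ => norm_nonneg _) (fun n => ?_) (by simpa using ha.add hb)
    exact norm_add_le _ _
  zero_mem' := by simp
  smul_mem' := by
    intro z a ha
    have h : Tendsto (fun n => ‖z‖ * ‖a n‖) atTop (𝓝 0) := by simpa using ha.const_mul ‖z‖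
    refine h.congr fun n => ?_
    exact (norm_smul z (a n)).symm
  mul_left_mem' := by
    intro r x hx
    have h : Tendsto (fun n => ‖r‖ * ‖x n‖) atTop (𝓝 0) := by simpa using hx.const_mul ‖r‖
    refine squeeze_zero (fun _ => norm_nonneg _) (fun n => ?_) h
    exact (norm_mul_le (r n) (x n)).trans
      (mul_le_mul_of_nonneg_right (lp.norm_apply_le_norm (by simp) r n) (norm_nonneg _))
  mul_right_mem' := by
    intro r x hx
    have h : Tendsto (fun n => ‖x n‖ * ‖r‖) atTop (𝓝 0) := by simpa using hx.mul_const ‖r‖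
    refine squeeze_zero (fun _ => norm_nonneg _) (fun n => ?_) h
    exact (norm_mul_le (x n) (r n)).trans
      (mul_le_mul_of_nonneg_left (lp.norm_apply_le_norm (by simp) r n) (norm_nonneg _))
  star_mem' := by
    intro x hx
    refine Tendsto.congr (fun n => ?_) hx
    exact (norm_star (x n)).symm

/-- The sequence algebra `A_∞ = ℓ^∞(ℕ, A) / c₀(ℕ, A)`, as a `*`-algebra. -/
abbrev SeqAlg : Type _ := (nullSeq A).Quot

/-- The constant sequence with value `a`. -/
def constSeq (a : A) : BddSeq A :=
  ⟨fun _ => a, memℓp_infty ⟨‖a‖, by rintro _ ⟨n, rfl⟩; exact le_rfl⟩⟩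

variable {A}

/-- The canonical image of `a ∈ A` in `A_∞`. -/
def toSeqAlg (a : A) : SeqAlg A := (nullSeq A).proj (constSeq A a)

theorem toSeqAlg_star (a : A) : toSeqAlg (star a) = star (toSeqAlg a) := rfl

/-- The relative commutant `A_∞ ∩ D'` of a subalgebra `D ⊆ A`. -/
def relCommutant (D : NonUnitalStarSubalgebra ℂ A) : NonUnitalStarSubalgebra ℂ (SeqAlg A) where
  carrier := {x | ∀ d ∈ D, x * toSeqAlg d = toSeqAlg d * x}
  add_mem' := by intro a b ha hb d hd; rw [add_mul, mul_add, ha d hd, hb d hd]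
  zero_mem' := by intro d _; rw [zero_mul, mul_zero]
  mul_mem' := by
    intro a b ha hb d hd
    rw [mul_assoc, hb d hd, ← mul_assoc, ha d hd, mul_assoc]
  smul_mem' := by intro z a ha d hd; rw [smul_mul_assoc, mul_smul_comm, ha d hd]
  star_mem' := by
    intro a ha d hd
    have h : toSeqAlg d = star (toSeqAlg (star d)) := by
      rw [← toSeqAlg_star, star_star]
    rw [h, ← star_mul, ← star_mul, ha _ (star_mem hd)]

/-- The annihilator `Ann(D, A_∞) = {x : xD = Dx = 0}`, as an ideal of `A_∞ ∩ D'`. -/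
def annihilatorIdeal (D : NonUnitalStarSubalgebra ℂ A) : StarIdeal (relCommutant D) where
  carrier := {x | ∀ d ∈ D, (x : SeqAlg A) * toSeqAlg d = 0 ∧ toSeqAlg d * (x : SeqAlg A) = 0}
  add_mem' := by
    intro a b ha hb d hd
    refine ⟨?_, ?_⟩
    · change ((a : SeqAlg A) + b) * _ = 0
      rw [add_mul, (ha d hd).1, (hb d hd).1, add_zero]
    · change _ * ((a : SeqAlg A) + b) = 0
      rw [mul_add, (ha d hd).2, (hb d hd).2, add_zero]
  zero_mem' := by intro d _; exact ⟨zero_mul _, mul_zero _⟩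
  smul_mem' := by
    intro z a ha d hd
    refine ⟨?_, ?_⟩
    · change (z • (a : SeqAlg A)) * _ = 0
      rw [smul_mul_assoc, (ha d hd).1, smul_zero]
    · change _ * (z • (a : SeqAlg A)) = 0
      rw [mul_smul_comm, (ha d hd).2, smul_zero]
  mul_left_mem' := by
    intro r x hx d hd
    refine ⟨?_, ?_⟩
    · change ((r : SeqAlg A) * x) * _ = 0
      rw [mul_assoc, (hx d hd).1, mul_zero]
    · change _ * ((r : SeqAlg A) * x) = 0
      rw [← mul_assoc, ← r.2 d hd, mul_assoc, (hx d hd).2, mul_zero]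
  mul_right_mem' := by
    intro r x hx d hd
    refine ⟨?_, ?_⟩
    · change ((x : SeqAlg A) * r) * _ = 0
      rw [mul_assoc, r.2 d hd, ← mul_assoc, (hx d hd).1, zero_mul]
    · change _ * ((x : SeqAlg A) * r) = 0
      rw [← mul_assoc, (hx d hd).2, zero_mul]
  star_mem' := by
    intro x hx d hd
    have h : toSeqAlg d = star (toSeqAlg (star d)) := by
      rw [← toSeqAlg_star, star_star]
    refine ⟨?_, ?_⟩
    · change star (x : SeqAlg A) * _ = 0
      rw [h, ← star_mul, (hx _ (star_mem hd)).2, star_zero]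
    · change _ * star (x : SeqAlg A) = 0
      rw [h, ← star_mul, (hx _ (star_mem hd)).1, star_zero]

/-- Kirchberg's algebra `F(D, A) = (A_∞ ∩ D') / Ann(D, A_∞)`, as a `*`-algebra. -/
abbrev KirchbergAlg (D : NonUnitalStarSubalgebra ℂ A) : Type _ := (annihilatorIdeal D).Quot

/-- The quotient map `κ : A_∞ ∩ D' → F(D, A)`. -/
def kirchbergMk (D : NonUnitalStarSubalgebra ℂ A) : relCommutant D →⋆ₙₐ[ℂ] KirchbergAlg D :=
  (annihilatorIdeal D).proj

end Sequences

/-! ### Induced actions and the Rokhlin property -/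

namespace CStarAction

section Rokhlin

variable {G A : Type*} [Group G] [TopologicalSpace G] [NonUnitalCStarAlgebra A]
  (α : CStarAction G A)

/-- The automorphism `α^∞_g` of `ℓ^∞(ℕ, A)`: apply `α_g` in every coordinate. -/
def bddSeqMap (g : G) : BddSeq A →⋆ₙₐ[ℂ] BddSeq A where
  toFun a := ⟨fun n => α.toHom g (a n), by
    refine memℓp_infty ⟨‖a‖, ?_⟩
    rintro _ ⟨n, rfl⟩
    simp only [α.norm_apply]
    exact lp.norm_apply_le_norm (by simp) a n⟩
  map_smul' := by intro z a; ext n; exact map_smul (α.toHom g) z (a n)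
  map_zero' := by ext n; exact map_zero (α.toHom g)
  map_add' := by intro a b; ext n; exact map_add (α.toHom g) (a n) (b n)
  map_mul' := by intro a b; ext n; exact map_mul (α.toHom g) (a n) (b n)
  map_star' := by intro a; ext n; exact map_star (α.toHom g) (a n)

/-- The map `(α_∞)_g` of `A_∞`. -/
def seqAlgMap (g : G) : SeqAlg A →⋆ₙₐ[ℂ] SeqAlg A :=
  StarIdeal.map (nullSeq A) (nullSeq A) (α.bddSeqMap g) (by
    intro a ha
    refine Tendsto.congr (fun n => ?_) ha
    exact (α.norm_apply g (a n)).symm)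

theorem seqAlgMap_toSeqAlg (g : G) (a : A) :
    α.seqAlgMap g (toSeqAlg a) = toSeqAlg (α.toHom g a) := rfl

/-- `D` is an `α`-invariant subalgebra. -/
def IsInvariant (D : NonUnitalStarSubalgebra ℂ A) : Prop := ∀ g, ∀ d ∈ D, α.toHom g d ∈ D

variable {α} in
theorem IsInvariant.exists_eq {D : NonUnitalStarSubalgebra ℂ A} (hD : α.IsInvariant D) (g : G)
    {d : A} (hd : d ∈ D) : ∃ c ∈ D, toSeqAlg d = α.seqAlgMap g (toSeqAlg c) := by
  refine ⟨α.toHom g⁻¹ d, hD _ _ hd, ?_⟩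
  rw [seqAlgMap_toSeqAlg, ← α.mul_apply, mul_inv_cancel, α.one_apply]

/-- The restriction of `(α_∞)_g` to `A_∞ ∩ D'`, for an invariant subalgebra `D`. -/
def relCommutantMap (D : NonUnitalStarSubalgebra ℂ A) (hD : α.IsInvariant D) (g : G) :
    relCommutant D →⋆ₙₐ[ℂ] relCommutant D :=
  NonUnitalStarAlgHom.codRestrict
    ((α.seqAlgMap g).comp (NonUnitalStarSubalgebraClass.subtype (relCommutant D)))
    (relCommutant D) (by
      intro x d hd
      obtain ⟨c, hc, h⟩ := hD.exists_eq g hd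
      change α.seqAlgMap g x * _ = _ * α.seqAlgMap g x
      rw [h, ← map_mul, ← map_mul, x.2 c hc])

/-- The map `F(α)_g` of `F(D, A)`, for an invariant subalgebra `D`. -/
def kirchbergMap (D : NonUnitalStarSubalgebra ℂ A) (hD : α.IsInvariant D) (g : G) :
    KirchbergAlg D →⋆ₙₐ[ℂ] KirchbergAlg D :=
  StarIdeal.map (annihilatorIdeal D) (annihilatorIdeal D) (α.relCommutantMap D hD g) (by
    intro x hx d hd
    obtain ⟨c, hc, h⟩ := hD.exists_eq g hd
    refine ⟨?_, ?_⟩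
    · change α.seqAlgMap g x * _ = 0
      rw [h, ← map_mul, (hx c hc).1, map_zero]
    · change _ * α.seqAlgMap g x = 0
      rw [h, ← map_mul, (hx c hc).2, map_zero])

/-- The algebra `ℓ^∞_α(ℕ, A)` of the bounded sequences on which `G` acts continuously. -/
def contBddSeq : NonUnitalStarSubalgebra ℂ (BddSeq A) where
  carrier := {a | Continuous fun g => α.bddSeqMap g a}
  add_mem' := by
    intro a b ha hb
    simp only [Set.mem_ofPred_eq, map_add] at *
    exact ha.add hb
  zero_mem' := by
    simp only [Set.mem_ofPred_eq, map_zero]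
    exact continuous_const
  mul_mem' := by
    intro a b ha hb
    simp only [Set.mem_ofPred_eq, map_mul] at *
    exact ha.mul hb
  smul_mem' := by
    intro z a ha
    simp only [Set.mem_ofPred_eq, map_smul] at *
    exact ha.const_smul z
  star_mem' := by
    intro a ha
    simp only [Set.mem_ofPred_eq, map_star] at *
    exact ha.star

/-- `A_{∞,α}`, the image of `ℓ^∞_α(ℕ, A)` in `A_∞`. -/
def contSeqAlg : NonUnitalStarSubalgebra ℂ (SeqAlg A) :=
  α.contBddSeq.map (nullSeq A).proj

/-- `F_α(D, A) = κ(A_{∞,α} ∩ D')`. -/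
def contKirchberg (D : NonUnitalStarSubalgebra ℂ A) : NonUnitalStarSubalgebra ℂ (KirchbergAlg D) :=
  (α.contSeqAlg.comap (NonUnitalStarSubalgebraClass.subtype (relCommutant D))).map (kirchbergMk D)

variable [IsTopologicalGroup G]

/-- Left translation on `C(G)`: `(Lt_g f)(h) = f(g⁻¹h)`. -/
def leftTranslate (g : G) (f : C(G, ℂ)) : C(G, ℂ) :=
  ⟨fun h => f (g⁻¹ * h), f.continuous.comp (continuous_const.mul continuous_id)⟩

/-- The Rokhlin property: for every separable `α`-invariant (`C*`-)subalgebra `D` of `A` there is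
an equivariant unital homomorphism `(C(G), Lt) → (F_α(D, A), F(α))`. -/
def HasRokhlinProperty : Prop :=
  ∀ (D : NonUnitalStarSubalgebra ℂ A) (hD : α.IsInvariant D),
    IsClosed (D : Set A) → TopologicalSpace.IsSeparable (D : Set A) →
    ∃ φ : C(G, ℂ) →⋆ₙₐ[ℂ] α.contKirchberg D,
      IsUnitElement (φ 1) ∧
      ∀ (g : G) (f : C(G, ℂ)),
        (φ (leftTranslate g f) : KirchbergAlg D) = α.kirchbergMap D hD g (φ f)

end Rokhlin

end CStarAction

/-! ### The crossed product -/

section CrossedProduct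

set_option linter.unusedSectionVars false

variable {G A : Type*} [Group G] [TopologicalSpace G] [IsTopologicalGroup G] [CompactSpace G]
  [SecondCountableTopology G] [MeasurableSpace G] [BorelSpace G] [NonUnitalCStarAlgebra A]

/-- The normalized Haar measure of a compact group. -/
abbrev normHaar (G : Type*) [Group G] [TopologicalSpace G] [IsTopologicalGroup G] [CompactSpace G]
    [MeasurableSpace G] [BorelSpace G] : Measure G :=
  Measure.haarMeasure (⊤ : TopologicalSpace.PositiveCompacts G)

/-- The space `C(G, A)`, to be equipped with the convolution product and involution twisted by
the action `α`. -/
@[nolint unusedArguments]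
def ConvAlg (_α : CStarAction G A) : Type _ := C(G, A)

namespace ConvAlg

variable {α : CStarAction G A}

instance : AddCommGroup (ConvAlg α) := inferInstanceAs (AddCommGroup C(G, A))
instance : Module ℂ (ConvAlg α) := inferInstanceAs (Module ℂ C(G, A))
instance : FunLike (ConvAlg α) G A := inferInstanceAs (FunLike C(G, A) G A)

@[ext] theorem ext {f g : ConvAlg α} (h : ∀ s, f s = g s) : f = g := ContinuousMap.ext h

protected theorem continuous (f : ConvAlg α) : Continuous f := ContinuousMap.continuous f

@[simp] theorem add_apply (f g : ConvAlg α) (s : G) : (f + g) s = f s + g s := rfl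
@[simp] theorem zero_apply (s : G) : (0 : ConvAlg α) s = 0 := rfl
@[simp] theorem smul_apply (z : ℂ) (f : ConvAlg α) (s : G) : (z • f) s = z • f s := rfl

theorem integrable_of_continuous {E : Type*} [NormedAddCommGroup E] {f : G → E}
    (hf : Continuous f) : Integrable f (normHaar G) :=
  hf.integrable_of_hasCompactSupport (HasCompactSupport.of_compactSpace f)

theorem continuous_act {X : Type*} [TopologicalSpace X] (α : CStarAction G A) {u : X → G}
    {v : X → A} (hu : Continuous u) (hv : Continuous v) :
    Continuous fun x => α.toHom (u x) (v x) :=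
  α.continuous_uncurry.comp (hu.prodMk hv)

theorem continuous_integral {f : G → G → A} (hf : Continuous (Function.uncurry f)) :
    Continuous fun s => ∫ r, f s r ∂(normHaar G) := by
  simpa using continuous_parametric_integral_of_continuous (μ := normHaar G) hf isCompact_univ

theorem integral_act (α : CStarAction G A) (s : G) {f : G → A} (hf : Continuous f) :
    α.toHom s (∫ r, f r ∂(normHaar G)) = ∫ r, α.toHom s (f r) ∂(normHaar G) := by
  let L : A →L[ℂ] A := ⟨{ toFun := α.toHom s, map_add' := map_add _, map_smul' := map_smul _ },
    continuous_act α continuous_const continuous_id⟩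
  exact (L.integral_comp_comm (integrable_of_continuous hf)).symm

theorem integral_mul_left' (a : A) {f : G → A} (hf : Continuous f) :
    a * (∫ r, f r ∂(normHaar G)) = ∫ r, a * f r ∂(normHaar G) :=
  ((ContinuousLinearMap.mul ℂ A a).integral_comp_comm (integrable_of_continuous hf)).symm

theorem integral_mul_right' (a : A) {f : G → A} (hf : Continuous f) :
    (∫ r, f r ∂(normHaar G)) * a = ∫ r, f r * a ∂(normHaar G) :=
  (((ContinuousLinearMap.mul ℂ A).flip a).integral_comp_comm (integrable_of_continuous hf)).symm

theorem integral_star' {f : G → A} (hf : Continuous f) :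
    star (∫ r, f r ∂(normHaar G)) = ∫ r, star (f r) ∂(normHaar G) :=
  ((starL' ℝ : A ≃L[ℝ] A).toContinuousLinearMap.integral_comp_comm
    (integrable_of_continuous hf)).symm

/-- Twisted convolution: `(f * g)(s) = ∫ f(r) α_r(g(r⁻¹ s)) dr`. -/
instance : Mul (ConvAlg α) where
  mul f g := (⟨fun s => ∫ r, f r * α.toHom r (g (r⁻¹ * s)) ∂(normHaar G), by
    refine continuous_integral (f := fun s r => f r * α.toHom r (g (r⁻¹ * s))) ?_
    exact (f.continuous.comp continuous_snd).mul (continuous_act α continuous_snd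
      (g.continuous.comp (continuous_snd.inv.mul continuous_fst)))⟩ : C(G, A))

/-- Twisted involution: `f^*(s) = α_s(f(s⁻¹)^*)` (a compact group is unimodular). -/
instance : Star (ConvAlg α) where
  star f := (⟨fun s => α.toHom s (star (f s⁻¹)),
    continuous_act α continuous_id (f.continuous.comp continuous_inv).star⟩ : C(G, A))

theorem mul_apply (f g : ConvAlg α) (s : G) :
    (f * g) s = ∫ r, f r * α.toHom r (g (r⁻¹ * s)) ∂(normHaar G) := rfl

theorem star_apply (f : ConvAlg α) (s : G) : star f s = α.toHom s (star (f s⁻¹)) := rfl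

theorem continuous_integrand (f g : ConvAlg α) (s : G) :
    Continuous fun r => f r * α.toHom r (g (r⁻¹ * s)) :=
  f.continuous.mul (continuous_act α continuous_id
    (g.continuous.comp (continuous_inv.mul continuous_const)))

protected theorem mul_assoc' (f g h : ConvAlg α) : f * g * h = f * (g * h) := by
  ext s
  have h1 : ∀ t, (f * g) t * α.toHom t (h (t⁻¹ * s)) =
      ∫ r, f r * α.toHom r (g (r⁻¹ * t)) * α.toHom t (h (t⁻¹ * s)) ∂(normHaar G) := fun t => by
    rw [mul_apply, integral_mul_right' _ (continuous_integrand f g t)]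
  have h2 : ∀ r, f r * α.toHom r ((g * h) (r⁻¹ * s)) =
      ∫ t, f r * α.toHom r (g (r⁻¹ * t)) * α.toHom t (h (t⁻¹ * s)) ∂(normHaar G) := fun r => by
    rw [mul_apply, integral_act α r (continuous_integrand g h _), integral_mul_left' _
      (continuous_act α continuous_const (continuous_integrand g h _)),
      ← integral_mul_left_eq_self _ r⁻¹]
    congr 1
    ext t
    rw [map_mul, ← α.mul_apply, mul_assoc]
    congr 3
    · group
    · congr 1; group
  rw [mul_apply, mul_apply]
  simp only [h1, h2]
  refine integral_integral_swap_of_hasCompactSupport ?_ (HasCompactSupport.of_compactSpace _)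
  refine Continuous.mul (Continuous.mul (f.continuous.comp continuous_snd) ?_) ?_
  · exact continuous_act α continuous_snd
      (g.continuous.comp (continuous_snd.inv.mul continuous_fst))
  · exact continuous_act α continuous_fst
      (h.continuous.comp (continuous_fst.inv.mul continuous_const))

instance : NonUnitalRing (ConvAlg α) :=
  { (inferInstance : AddCommGroup (ConvAlg α)), (inferInstance : Mul (ConvAlg α)) with
    left_distrib := by
      intro f g h
      ext s
      simp only [mul_apply, add_apply, map_add, mul_add]
      exact integral_add (integrable_of_continuous (continuous_integrand f g s))
        (integrable_of_continuous (continuous_integrand f h s))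
    right_distrib := by
      intro f g h
      ext s
      simp only [mul_apply, add_apply, add_mul]
      exact integral_add (integrable_of_continuous (continuous_integrand f h s))
        (integrable_of_continuous (continuous_integrand g h s))
    zero_mul := by intro f; ext s; simp [mul_apply]
    mul_zero := by intro f; ext s; simp [mul_apply]
    mul_assoc := ConvAlg.mul_assoc' }

instance : StarRing (ConvAlg α) where
  star_involutive := by
    intro f
    ext s
    rw [star_apply, star_apply, ← map_star, star_star, ← α.mul_apply, mul_inv_cancel, α.one_apply,
      inv_inv]
  star_add := by
    intro f g
    ext s
    simp only [star_apply, add_apply, star_add, map_add]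
  star_mul := by
    intro f g
    ext s
    rw [star_apply, mul_apply, mul_apply, integral_star' (continuous_integrand f g _),
      integral_act α s (continuous_integrand f g _).star,
      ← integral_mul_left_eq_self (fun r => star g r * α.toHom r (star f (r⁻¹ * s))) s]
    congr 1
    ext r
    rw [star_apply, star_apply, star_mul, map_mul, ← map_star, ← α.mul_apply, ← α.mul_apply]
    congr 3
    · congr 2; group
    · group
    · congr 2; group

instance : IsScalarTower ℂ (ConvAlg α) (ConvAlg α) where
  smul_assoc := by
    intro z f g
    ext s
    simp only [smul_eq_mul, mul_apply, smul_apply, smul_mul_assoc]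
    exact integral_smul _ _

instance : SMulCommClass ℂ (ConvAlg α) (ConvAlg α) where
  smul_comm := by
    intro z f g
    ext s
    simp only [smul_eq_mul, mul_apply, smul_apply, map_smul, mul_smul_comm]
    exact (integral_smul _ _).symm

instance : StarModule ℂ (ConvAlg α) where
  star_smul := by
    intro z f
    ext s
    simp only [star_apply, smul_apply, star_smul, map_smul]

/-- The norm of `L¹(G, A)`. -/
def l1Norm (f : ConvAlg α) : ℝ := ∫ s, ‖f s‖ ∂(normHaar G)

/-- The `C*`-seminorms on the convolution algebra that are dominated by the `L¹`-norm. These are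
exactly the seminorms `f ↦ ‖π f‖` given by the `L¹`-contractive `*`-representations `π`. -/
structure CStarSeminorm (α : CStarAction G A) extends Seminorm ℂ (ConvAlg α) where
  mul_le' : ∀ f g : ConvAlg α, toFun (f * g) ≤ toFun f * toFun g
  star_mul_self' : ∀ f : ConvAlg α, toFun (star f * f) = toFun f ^ 2
  le_l1Norm' : ∀ f : ConvAlg α, toFun f ≤ l1Norm f

namespace CStarSeminorm

variable (p : CStarSeminorm α)

/-- The zero seminorm. -/
instance : Nonempty (CStarSeminorm α) :=
  ⟨{ (0 : Seminorm ℂ (ConvAlg α)) with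
      mul_le' := fun f g => by
        change (0 : ℝ) ≤ 0 * 0
        simp
      star_mul_self' := fun f => by
        change (0 : ℝ) = 0 ^ 2
        simp
      le_l1Norm' := fun f => integral_nonneg fun _ => norm_nonneg _ }⟩

theorem mul_le (f g : ConvAlg α) :
    p.toSeminorm (f * g) ≤ p.toSeminorm f * p.toSeminorm g := p.mul_le' f g
theorem star_mul_self (f : ConvAlg α) :
    p.toSeminorm (star f * f) = p.toSeminorm f ^ 2 := p.star_mul_self' f
theorem le_l1Norm (f : ConvAlg α) : p.toSeminorm f ≤ l1Norm f := p.le_l1Norm' f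

theorem le_star (f : ConvAlg α) : p.toSeminorm f ≤ p.toSeminorm (star f) := by
  rcases (apply_nonneg p.toSeminorm f).eq_or_lt with h | h
  · rw [← h]; exact apply_nonneg _ _
  · have h1 := p.mul_le (star f) f
    rw [p.star_mul_self, sq] at h1
    exact le_of_mul_le_mul_right h1 h

theorem star_eq (f : ConvAlg α) : p.toSeminorm (star f) = p.toSeminorm f :=
  le_antisymm (by simpa using p.le_star (star f)) (p.le_star f)

end CStarSeminorm

/-- The universal `C*`-seminorm: the largest one that is dominated by the `L¹`-norm. -/
def univNorm (f : ConvAlg α) : ℝ := ⨆ p : CStarSeminorm α, p.toSeminorm f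

theorem bddAbove_range (f : ConvAlg α) :
    BddAbove (Set.range fun p : CStarSeminorm α => p.toSeminorm f) :=
  ⟨l1Norm f, by rintro _ ⟨p, rfl⟩; exact p.le_l1Norm f⟩

theorem le_univNorm (p : CStarSeminorm α) (f : ConvAlg α) : p.toSeminorm f ≤ univNorm f :=
  le_ciSup (bddAbove_range f) p

theorem univNorm_nonneg (f : ConvAlg α) : 0 ≤ univNorm f :=
  Real.iSup_nonneg fun p => apply_nonneg p.toSeminorm f

theorem univNorm_star (f : ConvAlg α) : univNorm (star f) = univNorm f := by
  simp only [univNorm, CStarSeminorm.star_eq]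

instance : SeminormedAddCommGroup (ConvAlg α) :=
  AddGroupSeminorm.toSeminormedAddCommGroup
    { toFun := univNorm
      map_zero' := by simp [univNorm]
      add_le' := fun f g => ciSup_le fun p => (map_add_le_add p.toSeminorm f g).trans
        (add_le_add (le_univNorm p f) (le_univNorm p g))
      neg' := fun f => by simp [univNorm] }

theorem norm_def (f : ConvAlg α) : ‖f‖ = univNorm f := rfl

instance : NonUnitalSeminormedRing (ConvAlg α) :=
  { (inferInstance : SeminormedAddCommGroup (ConvAlg α)),
    (inferInstance : NonUnitalRing (ConvAlg α)) with
    norm_mul_le := fun f g => ciSup_le fun p => (p.mul_le f g).trans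
      (mul_le_mul (le_univNorm p f) (le_univNorm p g) (apply_nonneg _ _) (univNorm_nonneg f)) }

instance : NormedSpace ℂ (ConvAlg α) where
  norm_smul_le z f := ciSup_le fun p => by
    rw [map_smul_eq_mul]
    exact mul_le_mul_of_nonneg_left (le_univNorm p f) (norm_nonneg z)

theorem norm_mul_self_le (f : ConvAlg α) : ‖f‖ * ‖f‖ ≤ ‖star f * f‖ := by
  have h : ‖f‖ ≤ Real.sqrt ‖star f * f‖ := ciSup_le fun p => by
    refine Real.le_sqrt_of_sq_le ?_
    rw [← p.star_mul_self]
    exact le_univNorm p _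
  calc ‖f‖ * ‖f‖ ≤ Real.sqrt ‖star f * f‖ * Real.sqrt ‖star f * f‖ :=
        mul_self_le_mul_self (norm_nonneg f) h
    _ = _ := Real.mul_self_sqrt (norm_nonneg _)

theorem norm_star' (f : ConvAlg α) : ‖star f‖ = ‖f‖ := univNorm_star f

end ConvAlg

/-- The (full) crossed product `A ⋊_α G`: the completion of the convolution algebra `C(G, A)` in
its universal `C*`-norm, i.e. the enveloping `C*`-algebra of `L¹(G, A, α)`. -/
def CrossedProduct (α : CStarAction G A) : Type _ := UniformSpace.Completion (ConvAlg α)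

namespace CrossedProduct

open UniformSpace

variable {α : CStarAction G A}

instance : NormedAddCommGroup (CrossedProduct α) :=
  inferInstanceAs (NormedAddCommGroup (Completion (ConvAlg α)))
instance : NormedSpace ℂ (CrossedProduct α) :=
  inferInstanceAs (NormedSpace ℂ (Completion (ConvAlg α)))
instance : CompleteSpace (CrossedProduct α) :=
  inferInstanceAs (CompleteSpace (Completion (ConvAlg α)))

/-- The canonical map `C(G, A) → A ⋊_α G`. -/
def of : ConvAlg α →L[ℂ] CrossedProduct α := (Completion.toComplL : _ →L[ℂ] Completion (ConvAlg α))

theorem norm_of (f : ConvAlg α) : ‖of f‖ = ‖f‖ := Completion.norm_coe f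

theorem denseRange_of : DenseRange (of : ConvAlg α → CrossedProduct α) :=
  Completion.denseRange_coe

theorem isUniformInducing_of : IsUniformInducing (of : ConvAlg α → CrossedProduct α) :=
  Completion.isUniformInducing_coe _

theorem continuous_of : Continuous (of : ConvAlg α → CrossedProduct α) := of.continuous

/-- The product, as a bounded bilinear map: the continuous extension of the convolution. -/
def mulL : CrossedProduct α →L[ℂ] CrossedProduct α →L[ℂ] CrossedProduct α :=
  let B : ConvAlg α →L[ℂ] ConvAlg α →L[ℂ] CrossedProduct α :=
    (ContinuousLinearMap.compL ℂ (ConvAlg α) (ConvAlg α) (CrossedProduct α) of).comp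
      (ContinuousLinearMap.mul ℂ (ConvAlg α))
  ((B.extend of).flip.extend of).flip

instance : Mul (CrossedProduct α) := ⟨fun x y => mulL x y⟩

/-- The involution: the continuous extension of the involution of the convolution algebra. -/
instance : Star (CrossedProduct α) :=
  ⟨fun x => (Completion.map (star : ConvAlg α → ConvAlg α) x : Completion (ConvAlg α))⟩

theorem of_mul (f g : ConvAlg α) : of (f * g) = of f * of g := by
  change _ = mulL (of f) (of g)
  simp only [mulL, ContinuousLinearMap.flip_apply]
  rw [ContinuousLinearMap.extend_eq _ denseRange_of isUniformInducing_of,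
    ContinuousLinearMap.flip_apply,
    ContinuousLinearMap.extend_eq _ denseRange_of isUniformInducing_of]
  rfl

theorem uniformContinuous_star' : UniformContinuous (star : ConvAlg α → ConvAlg α) := by
  refine (AddMonoidHomClass.isometry_of_norm (starAddEquiv : ConvAlg α ≃+ ConvAlg α)
    fun f => ?_).uniformContinuous
  exact ConvAlg.norm_star' f

theorem of_star (f : ConvAlg α) : of (star f) = star (of f) :=
  (Completion.map_coe uniformContinuous_star' f).symm

instance : ContinuousMul (CrossedProduct α) := ⟨mulL.continuous₂⟩

instance : ContinuousStar (CrossedProduct α) :=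
  ⟨(Completion.continuous_map : Continuous (Completion.map (star : ConvAlg α → ConvAlg α)))⟩

theorem ind {P : CrossedProduct α → Prop} (x : CrossedProduct α) (hc : IsClosed {x | P x})
    (h : ∀ f, P (of f)) : P x :=
  Completion.induction_on (p := P) x hc h

instance : NonUnitalNormedRing (CrossedProduct α) :=
  { (inferInstance : NormedAddCommGroup (CrossedProduct α)),
    (inferInstance : Mul (CrossedProduct α)) with
    left_distrib := fun x y z => map_add (mulL x) y z
    right_distrib := fun x y z => by
      change mulL (x + y) z = mulL x z + mulL y z
      rw [map_add]; rfl
    zero_mul := fun x => by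
      change mulL 0 x = 0
      rw [map_zero]; rfl
    mul_zero := fun x => map_zero (mulL x)
    mul_assoc := fun x y z => by
      induction x using ind
      case hc => exact isClosed_eq (by fun_prop) (by fun_prop)
      rename_i f
      induction y using ind
      case hc => exact isClosed_eq (by fun_prop) (by fun_prop)
      rename_i g
      induction z using ind
      case hc => exact isClosed_eq (by fun_prop) (by fun_prop)
      rename_i h
      simp only [← of_mul, mul_assoc]
    norm_mul_le := fun x y => by
      induction x using ind
      case hc => exact isClosed_le (by fun_prop) (by fun_prop)
      rename_i f
      induction y using ind
      case hc => exact isClosed_le (by fun_prop) (by fun_prop)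
      rename_i g
      simp only [← of_mul, norm_of]
      exact norm_mul_le f g }

instance : StarRing (CrossedProduct α) where
  star_involutive x := by
    change star (star x) = x
    induction x using ind
    case hc => exact isClosed_eq (by fun_prop) (by fun_prop)
    rename_i f
    simp only [← of_star, star_star]
  star_mul x y := by
    induction x using ind
    case hc => exact isClosed_eq (by fun_prop) (by fun_prop)
    rename_i f
    induction y using ind
    case hc => exact isClosed_eq (by fun_prop) (by fun_prop)
    rename_i g
    simp only [← of_star, ← of_mul, star_mul]
  star_add x y := by
    induction x using ind
    case hc => exact isClosed_eq (by fun_prop) (by fun_prop)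
    rename_i f
    induction y using ind
    case hc => exact isClosed_eq (by fun_prop) (by fun_prop)
    rename_i g
    simp only [← of_star, ← map_add, star_add]

instance : CStarRing (CrossedProduct α) where
  norm_mul_self_le x := by
    induction x using ind
    case hc => exact isClosed_le (by fun_prop) (by fun_prop)
    rename_i f
    simp only [← of_star, ← of_mul, norm_of]
    exact ConvAlg.norm_mul_self_le f

instance : IsScalarTower ℂ (CrossedProduct α) (CrossedProduct α) where
  smul_assoc z x y := by
    change mulL (z • x) y = z • mulL x y
    rw [map_smul]; rfl

instance : SMulCommClass ℂ (CrossedProduct α) (CrossedProduct α) where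
  smul_comm z x y := (map_smul (mulL x) z y).symm

instance : StarModule ℂ (CrossedProduct α) where
  star_smul z x := by
    induction x using ind
    case hc =>
      exact isClosed_eq (continuous_star.comp (continuous_const_smul z))
        ((continuous_const_smul (star z)).comp continuous_star)
    rename_i f
    rw [← map_smul, ← of_star, ← of_star, star_smul, map_smul]

/-- The crossed product is a `C*`-algebra. -/
instance : NonUnitalCStarAlgebra (CrossedProduct α) where

end CrossedProduct

end CrossedProduct

end

/-! Both ranks are first expressed through quasiregular elements, those `b` for which `1 + b` is
invertible in the unitization. Real rank zero and stable rank one say that quasiregular elements are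
dense, among the self-adjoint elements or in all of `A`, with no case distinction on units. The
parameter `sa` of `QuasiDense` treats both at once. A quasi-inverse is given by two algebraic
relations that are stable under small perturbation, so approximate solutions suffice
(`exists_isQuasiregular_near`).

Averaging an approximate unit over `G` makes it invariant, so any separable set lies in a separable
invariant `D` containing an approximate unit of `A`. The Rokhlin homomorphism `f ↦ x_f`, multiplied
by elements of `D`, becomes an equivariant `*`-homomorphism `T : C(G, D) → A_∞` with `T (f d) = x_f
d`. The orbit function `h ↦ α_h(d)` is fixed by the diagonal action, so `Ψ d = T (h ↦ α_h(d))` is a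
`*`-homomorphism into the fixed points, equal to the inclusion on fixed elements of `D`. A fixed
class with a continuous lift is represented, after averaging, by a sequence in `A^α`. To treat `a ∈
A^α`, take a quasiregular `b ∈ A` near `a`, with quasi-inverse `c`. Then `Ψ b` and `Ψ c` give
sequences in `A^α` that are asymptotically quasi-inverse, the first of them eventually near `a`.

For the crossed product, a continuous `F : G → A` acts on `L²(G, A)` by the integral kernel
`α_h⁻¹(F(h t⁻¹))`. This kernel is uniformly close to `∑ ξ_i(h) conj(ξ_j(t)) a_ij` with `ξ`
orthonormal in `L²(G)`. Schur complements show that the matrix `a` can be perturbed to a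
quasiregular one (`QuasiDense.matrix`). The assignment `M ↦ (s ↦ ∑ x_{ξ_i} Ψ(M_ij) α_s(x_{ξ_j})^*)`
is a `*`-homomorphism modulo null sequences: the product involves the average of `x_f^* x_g Ψ(d)`,
which is `⟨f, g⟩ Ψ(d)`, so orthonormality produces matrix multiplication. It sends the perturbed
matrix close to `F`. Hence `F` is near an asymptotically quasiregular sequence of continuous
functions, and these functions are dense in `A ⋊ G`. -/

noncomputable section

/-! ### Density of quasiregular elements -/

section QuasiDense

/-- The quasiregular elements are dense in `A`; if `sa` holds, the same is required within the
self-adjoint elements. -/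
def QuasiDense (sa : Prop) (A : Type*) [NonUnitalCStarAlgebra A] : Prop :=
  ∀ a : A, (sa → IsSelfAdjoint a) → ∀ ε > (0 : ℝ),
    ∃ b : A, (sa → IsSelfAdjoint b) ∧ ‖a - b‖ < ε ∧ IsQuasiregular b

theorem isQuasiregular_iff_exists {R : Type*} [NonUnitalRing R] {x : R} :
    IsQuasiregular x ↔ ∃ y, x + y + x * y = 0 ∧ x + y + y * x = 0 := by
  rw [isQuasiregular_iff]
  constructor
  · rintro ⟨y, h1, h2⟩
    exact ⟨y, by rw [add_comm x y]; exact h1, h2⟩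
  · rintro ⟨y, h1, h2⟩
    exact ⟨y, by rw [add_comm y x]; exact h1, h2⟩

variable {A : Type*} [NonUnitalCStarAlgebra A]

theorem IsUnitElement.isSelfAdjoint {e : A} (he : IsUnitElement e) : IsSelfAdjoint e := by
  have h1 := (he (star e)).1
  have h2 := congrArg star h1
  rw [star_mul, star_star] at h2
  exact h1.symm.trans h2

theorem IsUnitElement.isInvertibleFor_add_iff {e : A} (he : IsUnitElement e) (b : A) :
    IsInvertibleFor e (e + b) ↔ IsQuasiregular b := by
  have key : ∀ x y : A, (e + x) * (e + y) = e + (x + y + x * y) := fun x y => by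
    rw [add_mul, mul_add, mul_add, (he e).1, (he y).1, (he x).2]; abel
  rw [isQuasiregular_iff_exists]
  constructor
  · rintro ⟨c, h1, h2⟩
    refine ⟨c - e, ?_, ?_⟩
    · have := key b (c - e)
      rw [add_sub_cancel, h1] at this
      exact left_eq_add.1 this
    · have := key (c - e) b
      rw [add_sub_cancel, h2, add_comm (c - e) b] at this
      exact left_eq_add.1 this
  · rintro ⟨y, h1, h2⟩
    refine ⟨e + y, ?_, ?_⟩
    · rw [key, h1, add_zero]
    · rw [key, add_comm y b, h2, add_zero]

/-- Translation by the self-adjoint unit `e` is an isometry that exchanges quasiregular and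
invertible elements. -/
theorem quasiDense_iff_of_unit (sa : Prop) {e : A} (he : IsUnitElement e) :
    QuasiDense sa A ↔ {a : A | sa → IsSelfAdjoint a} ⊆
      closure {b : A | (sa → IsSelfAdjoint b) ∧ IsInvertibleFor e b} := by
  constructor
  · intro h a ha
    rw [Metric.mem_closure_iff]
    intro ε hε
    obtain ⟨b, hb, hab, hq⟩ := h (a - e) (fun s => (ha s).sub he.isSelfAdjoint) ε hε
    refine ⟨e + b, ⟨fun s => he.isSelfAdjoint.add (hb s), (he.isInvertibleFor_add_iff b).2 hq⟩, ?_⟩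
    rwa [dist_eq_norm, ← sub_sub]
  · intro h a ha ε hε
    have h1 := h (show e + a ∈ _ from fun s => he.isSelfAdjoint.add (ha s))
    rw [Metric.mem_closure_iff] at h1
    obtain ⟨b, ⟨hb, hi⟩, hd⟩ := h1 ε hε
    refine ⟨b - e, fun s => (hb s).sub he.isSelfAdjoint, ?_, ?_⟩
    · rw [dist_eq_norm] at hd
      rwa [← sub_add, sub_add_eq_add_sub, add_comm a e]
    · rwa [← he.isInvertibleFor_add_iff, add_sub_cancel]

/-- An element of the unitization with scalar part `t ≠ 0` is `t (1 + b)`, so its invertibility is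
quasiregularity of `b`. Scalar part zero is avoided by a small perturbation. This holds whether or
not `A` has a unit. -/
theorem quasiDense_iff_unitization (sa : Prop) :
    QuasiDense sa A ↔ {a : Unitization ℂ A | sa → IsSelfAdjoint a} ⊆
      closure {b : Unitization ℂ A | (sa → IsSelfAdjoint b) ∧ IsUnit b} := by
  have hSA : ∀ x : Unitization ℂ A, IsSelfAdjoint x → IsSelfAdjoint x.fst ∧ IsSelfAdjoint x.snd :=
    fun x hx => ⟨by rw [isSelfAdjoint_iff, ← Unitization.fst_star, hx.star_eq],
      by rw [isSelfAdjoint_iff, ← Unitization.snd_star, hx.star_eq]⟩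
  constructor
  · intro h x hx
    rw [Metric.mem_closure_iff]
    intro ε hε
    -- A nonzero scalar near the scalar part; if that part vanishes, the real number `ε / 4` is
    -- used, so self-adjointness survives.
    obtain ⟨t, ht0, ht, hts⟩ : ∃ t : ℂ, t ≠ 0 ∧ ‖x.fst - t‖ < ε / 2 ∧ (sa → IsSelfAdjoint t) := by
      by_cases h0 : x.fst = 0
      · refine ⟨((ε / 4 : ℝ) : ℂ), ?_, ?_, fun _ => Complex.conj_ofReal _⟩
        · exact_mod_cast (by positivity : ε / 4 ≠ 0)
        · rw [h0, zero_sub, norm_neg, Complex.norm_real, Real.norm_of_nonneg (by positivity)]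
          linarith
      · exact ⟨x.fst, h0, by simpa using hε, fun s => (hSA x (hx s)).1⟩
    have htp : 0 < ‖t‖ := norm_pos_iff.2 ht0
    obtain ⟨b, hb, hab, hq⟩ := h (t⁻¹ • x.snd)
      (fun s => by
        have h1 := (hSA x (hx s)).2
        have h2 := (hts s).star_eq
        rw [isSelfAdjoint_iff, star_smul, star_inv₀, h1.star_eq, h2]) (ε / (2 * ‖t‖))
      (by positivity)
    refine ⟨t • (1 + (b : Unitization ℂ A)), ⟨fun s => ?_, ?_⟩, ?_⟩
    · rw [isSelfAdjoint_iff, star_smul, star_add, star_one, ← Unitization.inr_star,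
        (hb s).star_eq, (hts s).star_eq]
    · rw [isQuasiregular_iff_isUnit' ℂ] at hq
      exact (isUnit_smul_iff (Units.mk0 t ht0) _).2 hq
    · have : x - t • (1 + (b : Unitization ℂ A)) =
          algebraMap ℂ _ (x.fst - t) + ((x.snd - t • b : A) : Unitization ℂ A) := by
        simp only [sub_eq_add_neg]
        ext <;> simp [Algebra.algebraMap_eq_smul_one]
      rw [dist_eq_norm, this]
      refine (norm_add_le _ _).trans_lt ?_
      rw [norm_algebraMap', Unitization.norm_inr]
      have h3 : x.snd - t • b = t • (t⁻¹ • x.snd - b) := by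
        rw [smul_sub, smul_inv_smul₀ ht0]
      rw [h3, norm_smul]
      have h4 : ‖t‖ * ‖t⁻¹ • x.snd - b‖ < ‖t‖ * (ε / (2 * ‖t‖)) := mul_lt_mul_of_pos_left hab htp
      have h5 : ‖t‖ * (ε / (2 * ‖t‖)) = ε / 2 := by field_simp
      linarith
  · intro h a ha ε hε
    have h1 := h (show (1 + (a : Unitization ℂ A)) ∈ _ from fun s => by
      rw [isSelfAdjoint_iff, star_add, star_one, ← Unitization.inr_star, (ha s).star_eq])
    rw [mem_closure_iff_frequently] at h1
    have hf : Continuous (fun x : Unitization ℂ A => x.fst) := Unitization.continuous_fst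
    have hs : Continuous (fun x : Unitization ℂ A => x.snd) := Unitization.continuous_snd
    have hfa : (1 + (a : Unitization ℂ A)).fst = 1 := by simp
    have hsa : (1 + (a : Unitization ℂ A)).snd = a := by simp
    -- Normalizing the scalar part to `1` is continuous near `1 + a`, and sends `1 + a` to `a`.
    have hc : ContinuousAt (fun x : Unitization ℂ A => ‖a - x.fst⁻¹ • x.snd‖)
        (1 + (a : Unitization ℂ A)) := by
      refine (continuousAt_const.sub (ContinuousAt.smul (ContinuousAt.inv₀ hf.continuousAt ?_)
        hs.continuousAt)).norm
      rw [hfa]; exact one_ne_zero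
    have e1 := hc.eventually_lt (continuousAt_const (y := ε)) (by
      rw [hfa, hsa]; simpa using hε)
    have e2 : ∀ᶠ x in 𝓝 (1 + (a : Unitization ℂ A)), x.fst ≠ 0 :=
      hf.continuousAt.eventually_ne (by rw [hfa]; exact one_ne_zero)
    obtain ⟨x, ⟨hx, hxu⟩, hx1, hx2⟩ := (h1.and_eventually (e1.and e2)).exists
    refine ⟨x.fst⁻¹ • x.snd, fun s => ?_, hx1, ?_⟩
    · have h2 := hSA x (hx s)
      rw [isSelfAdjoint_iff, star_smul, star_inv₀, h2.1.star_eq, h2.2.star_eq]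
    · rw [isQuasiregular_iff_isUnit' ℂ]
      have : x = x.fst • (1 + ((x.fst⁻¹ • x.snd : A) : Unitization ℂ A)) := by
        ext
        · simp
        · simp [smul_inv_smul₀ hx2]
      rw [this] at hxu
      exact (isUnit_smul_iff (Units.mk0 x.fst hx2) _).1 hxu

theorem realRankZero_iff : RealRankZero A ↔ QuasiDense True A := by
  have h := quasiDense_iff_unitization (A := A) True
  simp only [true_imp_iff] at h
  constructor
  · rintro (⟨e, he, h1⟩ | ⟨_, h1⟩)
    · rw [quasiDense_iff_of_unit _ he]
      simpa only [true_imp_iff] using h1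
    · exact h.2 h1
  · intro h1
    by_cases hu : ∃ e : A, IsUnitElement e
    · obtain ⟨e, he⟩ := hu
      refine Or.inl ⟨e, he, ?_⟩
      have := (quasiDense_iff_of_unit _ he).1 h1
      simpa only [true_imp_iff] using this
    · exact Or.inr ⟨hu, h.1 h1⟩

theorem stableRankOne_iff : StableRankOne A ↔ QuasiDense False A := by
  have h := quasiDense_iff_unitization (A := A) False
  simp only [false_imp_iff, true_and, Set.ofPred_true, Set.univ_subset_iff,
    ← dense_iff_closure_eq] at h
  have h' : ∀ {e : A}, IsUnitElement e → _ := fun he => quasiDense_iff_of_unit (A := A) False he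
  simp only [false_imp_iff, true_and, Set.ofPred_true, Set.univ_subset_iff,
    ← dense_iff_closure_eq] at h'
  constructor
  · rintro (⟨e, he, h1⟩ | ⟨_, h1⟩)
    · exact (h' he).2 h1
    · exact h.2 h1
  · intro h1
    by_cases hu : ∃ e : A, IsUnitElement e
    · obtain ⟨e, he⟩ := hu
      exact Or.inl ⟨e, he, (h' he).1 h1⟩
    · exact Or.inr ⟨hu, h.1 h1⟩

/-- The products of `1 + b` and `1 + c` in both orders are within distance less than `1` of `1`,
hence invertible; so `1 + b` has a right and a left inverse. -/
theorem isQuasiregular_of_norm_lt {b c : A} (h1 : ‖b + c + b * c‖ < 1) (h2 : ‖b + c + c * b‖ < 1) :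
    IsQuasiregular b := by
  rw [isQuasiregular_iff_isUnit' ℂ]
  have key : ∀ x y : A, (1 + (x : Unitization ℂ A)) * (1 + (y : Unitization ℂ A)) =
      1 + ((x + y + x * y : A) : Unitization ℂ A) := fun x y => by
    simp only [Unitization.inr_add, Unitization.inr_mul]; noncomm_ring
  have hu : ∀ x : A, ‖x‖ < 1 → IsUnit (1 + (x : Unitization ℂ A)) := fun x hx => by
    have := isUnit_one_sub_of_norm_lt_one (x := ((-x : A) : Unitization ℂ A))
      (by rwa [Unitization.norm_inr, norm_neg])
    simpa using this
  have u1 := hu _ h1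
  have u2 := hu _ h2
  rw [← key] at u1
  rw [add_comm b c, ← key] at u2
  obtain ⟨u, hu⟩ := u1
  obtain ⟨v, hv⟩ := u2
  have r : (1 + (b : Unitization ℂ A)) * ((1 + (c : Unitization ℂ A)) * ↑u⁻¹) = 1 := by
    rw [← mul_assoc, ← hu, Units.mul_inv]
  have l : (↑v⁻¹ * (1 + (c : Unitization ℂ A))) * (1 + (b : Unitization ℂ A)) = 1 := by
    rw [mul_assoc, ← hv, Units.inv_mul]
  have := left_inv_eq_right_inv l r
  exact ⟨⟨_, _, r, by rw [← this, l]⟩, rfl⟩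

/-- A quasiregular element is produced from asymptotically quasiregular sequences. -/
theorem exists_isQuasiregular_near {sa : Prop} {x : A} {ε : ℝ} {b c : ℕ → A}
    (hb : ∀ᶠ n in atTop, ‖b n - x‖ ≤ ε)
    (h1 : Tendsto (fun n => b n + c n + b n * c n) atTop (𝓝 0))
    (h2 : Tendsto (fun n => b n + c n + c n * b n) atTop (𝓝 0))
    (hs : sa → Tendsto (fun n => b n - star (b n)) atTop (𝓝 0))
    {K : ℝ} (hK : ∀ n, ‖c n‖ ≤ K) {δ : ℝ} (hδ : ε < δ) :
    ∃ y : A, (sa → IsSelfAdjoint y) ∧ ‖x - y‖ < δ ∧ IsQuasiregular y := by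
  -- In the self-adjoint case `b n` is replaced by its real part, a null perturbation. Boundedness
  -- of `c` keeps the relations valid in the limit.
  obtain ⟨b', hb's, hb'⟩ : ∃ b' : ℕ → A, (∀ n, sa → IsSelfAdjoint (b' n)) ∧
      Tendsto (fun n => b' n - b n) atTop (𝓝 0) := by
    by_cases h : sa
    · refine ⟨fun n => (2⁻¹ : ℝ) • (b n + star (b n)), fun n _ => ?_, ?_⟩
      · rw [isSelfAdjoint_iff, star_smul, star_add, star_star, add_comm (star (b n))]
        rfl
      · have := (hs h).const_smul (-(2⁻¹ : ℝ))
        rw [smul_zero] at this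
        refine this.congr fun n => ?_
        module
    · exact ⟨b, fun n s => (h s).elim, by simp⟩
  have hz1 : Tendsto (fun n => (b' n - b n) * c n) atTop (𝓝 0) := by
    have h := (tendsto_zero_iff_norm_tendsto_zero.1 hb').mul_const K
    rw [zero_mul] at h
    refine squeeze_zero_norm (fun n => ?_) h
    exact (norm_mul_le _ _).trans (mul_le_mul_of_nonneg_left (hK n) (norm_nonneg _))
  have hz2 : Tendsto (fun n => c n * (b' n - b n)) atTop (𝓝 0) := by
    have h := (tendsto_zero_iff_norm_tendsto_zero.1 hb').const_mul K
    rw [mul_zero] at h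
    refine squeeze_zero_norm (fun n => ?_) h
    exact (norm_mul_le _ _).trans (mul_le_mul_of_nonneg_right (hK n) (norm_nonneg _))
  have t1 : Tendsto (fun n => b' n + c n + b' n * c n) atTop (𝓝 0) := by
    have := (h1.add hb').add hz1
    rw [add_zero, add_zero] at this
    refine this.congr fun n => ?_
    rw [sub_mul]; abel
  have t2 : Tendsto (fun n => b' n + c n + c n * b' n) atTop (𝓝 0) := by
    have := (h2.add hb').add hz2
    rw [add_zero, add_zero] at this
    refine this.congr fun n => ?_
    rw [mul_sub]; abel
  have n0 : ∀ {f : ℕ → A} {r : ℝ}, 0 < r → Tendsto f atTop (𝓝 0) → ∀ᶠ n in atTop, ‖f n‖ < r :=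
    fun hr hf => (tendsto_zero_iff_norm_tendsto_zero.1 hf).eventually_lt_const hr
  obtain ⟨n, ⟨⟨g1, g2⟩, g3⟩, g4⟩ := (((n0 one_pos t1).and (n0 one_pos t2)).and
    (n0 (sub_pos.2 hδ) hb')).and hb |>.exists
  refine ⟨b' n, hb's n, ?_, isQuasiregular_of_norm_lt g1 g2⟩
  rw [norm_sub_rev]
  calc ‖b' n - x‖ = ‖(b' n - b n) + (b n - x)‖ := by congr 1; abel
    _ ≤ ‖b' n - b n‖ + ‖b n - x‖ := norm_add_le _ _
    _ < δ := by linarith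

end QuasiDense

/-! ### Matrices -/

section Matrices

/-- This is the product `(1 + x) (1 + y)` with the unit removed. -/
theorem IsQuasiregular.add_add_mul {R : Type*} [NonUnitalRing R] {x y : R} (hx : IsQuasiregular x)
    (hy : IsQuasiregular y) : IsQuasiregular (x + y + x * y) := by
  obtain ⟨u, rfl⟩ := hx
  obtain ⟨v, rfl⟩ := hy
  refine ⟨u * v, ?_⟩
  simp [add_comm]

theorem isQuasiregular_of_mul_self_eq_zero {R : Type*} [NonUnitalRing R] {x : R} (h : x * x = 0) :
    IsQuasiregular x :=
  isQuasiregular_iff_exists.2 ⟨-x, by simp [h], by simp [h]⟩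

theorem quasiinverse_unique {R : Type*} [NonUnitalRing R] {x y z : R} (h1 : x + y + y * x = 0)
    (h2 : x + z + x * z = 0) : y = z := by
  have e1 : (x + y + y * x) * z = 0 := by rw [h1, zero_mul]
  have e2 : y * (x + z + x * z) = 0 := by rw [h2, mul_zero]
  rw [add_mul, add_mul, mul_assoc] at e1
  rw [mul_add, mul_add] at e2
  have e3 : y = -x - y * x := by rw [eq_sub_iff_add_eq, eq_neg_iff_add_eq_zero, ← h1]; abel
  have e4 : z = -x - x * z := by rw [eq_sub_iff_add_eq, eq_neg_iff_add_eq_zero, ← h2]; abel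
  have e5 : x * z = y * x := by
    have := e1.trans e2.symm
    have h : x * z + y * z + y * (x * z) = x * z + (y * z + y * (x * z)) := by abel
    have h' : y * x + y * z + y * (x * z) = y * x + (y * z + y * (x * z)) := by abel
    rw [h, h'] at this
    exact add_right_cancel this
  rw [e3, e4, e5]

variable {A : Type*} [NonUnitalCStarAlgebra A]

open Matrix

/-- Entrywise density of the quasiregular matrices. -/
def MatrixQuasiDense (sa : Prop) (A : Type*) [NonUnitalCStarAlgebra A] (ι : Type*) [Fintype ι] :
    Prop :=
  ∀ M : Matrix ι ι A, (sa → M.IsHermitian) → ∀ ε > (0 : ℝ),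
    ∃ N : Matrix ι ι A, (sa → N.IsHermitian) ∧ (∀ i j, ‖M i j - N i j‖ < ε) ∧ IsQuasiregular N

/-- Schur complements. -/
theorem isQuasiregular_fromBlocks {m k : Type*} [Fintype m] [Fintype k] {a a' : Matrix m m A}
    (h1 : a + a' + a * a' = 0) (h2 : a + a' + a' * a = 0) {c : Matrix k k A}
    (hc : IsQuasiregular c) (b : Matrix m k A) (d : Matrix k m A) :
    IsQuasiregular (fromBlocks a b d (c + d * (b + a' * b))) := by
  obtain ⟨c', h3, h4⟩ := isQuasiregular_iff_exists.1 hc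
  have hL : IsQuasiregular (fromBlocks 0 0 (d + d * a') 0 : Matrix (m ⊕ k) (m ⊕ k) A) :=
    isQuasiregular_of_mul_self_eq_zero (by simp [fromBlocks_multiply])
  have hU : IsQuasiregular (fromBlocks 0 (b + a' * b) 0 0 : Matrix (m ⊕ k) (m ⊕ k) A) :=
    isQuasiregular_of_mul_self_eq_zero (by simp [fromBlocks_multiply])
  have hD : IsQuasiregular (fromBlocks a 0 0 c : Matrix (m ⊕ k) (m ⊕ k) A) :=
    isQuasiregular_iff_exists.2 ⟨fromBlocks a' 0 0 c',
      by simp [fromBlocks_multiply, fromBlocks_add, h1, h3],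
      by simp [fromBlocks_multiply, fromBlocks_add, h2, h4]⟩
  -- The factorization of `1 + M` into lower triangular, diagonal and upper triangular factors,
  -- where `1 + a'` plays the role of `(1 + a)⁻¹`.
  have := (hL.add_add_mul hD).add_add_mul hU
  have e1 : d + d * a' + (d + d * a') * a = d + d * (a + a' + a' * a) := by
    simp only [Matrix.add_mul, Matrix.mul_add, Matrix.mul_assoc]; abel
  have e2 : b + a' * b + a * (b + a' * b) = b + (a + a' + a * a') * b := by
    simp only [Matrix.add_mul, Matrix.mul_add, Matrix.mul_assoc]; abel
  simpa only [fromBlocks_multiply, fromBlocks_add, zero_add, add_zero, Matrix.zero_mul,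
    Matrix.mul_zero, e1, e2, h1, h2, add_comm c] using this

/-- Only the diagonal blocks are perturbed: first the upper left one, then the Schur complement that
it determines. The off-diagonal blocks stay, and hermitian matrices stay hermitian because the
quasi-inverse of a hermitian matrix is hermitian. -/
theorem MatrixQuasiDense.sum {sa : Prop} {m k : Type*} [Fintype m] [Fintype k]
    (hm : MatrixQuasiDense sa A m) (hk : MatrixQuasiDense sa A k) :
    MatrixQuasiDense sa A (m ⊕ k) := by
  intro M hM ε hε
  obtain ⟨a, b, d, c, rfl⟩ : ∃ a b d c, M = fromBlocks a b d c :=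
    ⟨_, _, _, _, (fromBlocks_toBlocks M).symm⟩
  have hM' : sa → aᴴ = a ∧ bᴴ = d ∧ dᴴ = b ∧ cᴴ = c := fun s => by
    have h := isHermitian_fromBlocks_iff.1 (hM s)
    exact ⟨h.1, h.2.1, h.2.2.1, h.2.2.2⟩
  obtain ⟨x, hx, hax, hxq⟩ := hm a (fun s => (hM' s).1) ε hε
  obtain ⟨x', h1, h2⟩ := isQuasiregular_iff_exists.1 hxq
  have hx' : sa → x'ᴴ = x' := fun s => by
    refine quasiinverse_unique (x := x) ?_ h1
    have := congrArg conjTranspose h1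
    simpa [conjTranspose_add, conjTranspose_mul, (hx s).eq] using this
  have hS : sa → (d * (b + x' * b))ᴴ = d * (b + x' * b) := fun s => by
    simp only [conjTranspose_add, conjTranspose_mul, hx' s, (hM' s).2.1, (hM' s).2.2.1,
      Matrix.mul_add, Matrix.mul_assoc]
  obtain ⟨y, hy, hcy, hyq⟩ := hk (c - d * (b + x' * b))
    (fun s => by rw [IsHermitian, conjTranspose_sub, hS s, (hM' s).2.2.2]) ε hε
  refine ⟨_, fun s => ?_, ?_, isQuasiregular_fromBlocks h1 h2 hyq b d⟩
  · exact isHermitian_fromBlocks_iff.2 ⟨hx s, (hM' s).2.1, (hM' s).2.2.1, by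
      rw [IsHermitian, conjTranspose_add, hS s, (hy s).eq]⟩
  · rintro (i | i) (j | j)
    · exact hax i j
    · simpa using hε
    · simpa using hε
    · have := hcy i j
      rw [Matrix.sub_apply] at this
      simpa only [fromBlocks_apply₂₂, Matrix.add_apply, sub_sub, add_comm] using this

theorem MatrixQuasiDense.equiv {sa : Prop} {m k : Type*} [Fintype m] [Fintype k] (e : m ≃ k)
    (hm : MatrixQuasiDense sa A m) : MatrixQuasiDense sa A k := by
  intro M hM ε hε
  obtain ⟨N, h1, h2, h3⟩ := hm (M.submatrix e e) (fun s => (hM s).submatrix e) ε hε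
  obtain ⟨P, h4, h5⟩ := isQuasiregular_iff_exists.1 h3
  refine ⟨N.submatrix e.symm e.symm, fun s => (h1 s).submatrix _, fun i j => ?_,
    isQuasiregular_iff_exists.2 ⟨P.submatrix e.symm e.symm, ?_, ?_⟩⟩
  · simpa using h2 (e.symm i) (e.symm j)
  · rw [submatrix_mul_equiv]
    exact congrArg (fun X : Matrix m m A => X.submatrix e.symm e.symm) h4
  · rw [submatrix_mul_equiv]
    exact congrArg (fun X : Matrix m m A => X.submatrix e.symm e.symm) h5

theorem QuasiDense.matrix {sa : Prop} (h : QuasiDense sa A) (n : ℕ) :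
    MatrixQuasiDense sa A (Fin n) := by
  induction n with
  | zero =>
    exact fun M hM ε hε => ⟨0, fun _ => isHermitian_zero, fun i => i.elim0,
      isQuasiregular_of_mul_self_eq_zero (by simp)⟩
  | succ n ih =>
    refine MatrixQuasiDense.equiv finSumFinEquiv (ih.sum (k := Fin 1) ?_)
    intro M hM ε hε
    obtain ⟨b, hb, hab, hq⟩ := h (M 0 0) (fun s => (hM s).apply 0 0) ε hε
    obtain ⟨c, h1, h2⟩ := isQuasiregular_iff_exists.1 hq
    refine ⟨of fun _ _ => b, fun s => ?_, fun i j => ?_, isQuasiregular_iff_exists.2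
      ⟨of fun _ _ => c, ?_, ?_⟩⟩
    · ext i j; exact hb s
    · rw [Subsingleton.elim i 0, Subsingleton.elim j 0]; exact hab
    · ext i j; simpa [Matrix.mul_apply] using h1
    · ext i j; simpa [Matrix.mul_apply] using h2

end Matrices

/-! ### The sequence algebra is a `C*`-algebra -/

section SeqAlgNorm

variable {A : Type*} [NonUnitalCStarAlgebra A]

/-- The quotient map `ℓ^∞(ℕ, A) → A_∞`. -/
abbrev seqMk : BddSeq A →⋆ₙₐ[ℂ] SeqAlg A := (nullSeq A).proj

theorem seqMk_surjective : Function.Surjective (seqMk : BddSeq A → SeqAlg A) :=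
  (nullSeq A).mkₗ_surjective

theorem seqMk_eq_iff {a b : BddSeq A} :
    seqMk a = seqMk b ↔ Tendsto (fun n => ‖a n - b n‖) atTop (𝓝 0) :=
  (nullSeq A).mkₗ_eq_iff

theorem seqMk_eq_zero_iff {a : BddSeq A} :
    seqMk a = 0 ↔ Tendsto (fun n => ‖a n‖) atTop (𝓝 0) := by
  rw [← map_zero seqMk, seqMk_eq_iff]
  simp

theorem BddSeq.norm_apply_le (a : BddSeq A) (n : ℕ) : ‖a n‖ ≤ ‖a‖ :=
  lp.norm_apply_le_norm (by simp) a n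

theorem BddSeq.norm_le {a : BddSeq A} {r : ℝ} (hr : 0 ≤ r) (h : ∀ n, ‖a n‖ ≤ r) : ‖a‖ ≤ r :=
  lp.norm_le_of_forall_le hr h

/-- The sequence with given bounded terms. -/
def BddSeq.mk (f : ℕ → A) (r : ℝ) (h : ∀ n, ‖f n‖ ≤ r) : BddSeq A :=
  ⟨f, memℓp_infty ⟨r, by rintro _ ⟨n, rfl⟩; exact h n⟩⟩

theorem BddSeq.mk_apply (f : ℕ → A) (r : ℝ) (h : ∀ n, ‖f n‖ ≤ r) (n : ℕ) :
    BddSeq.mk f r h n = f n := rfl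

/-- Closedness turns the quotient seminorm on the algebraically defined `A_∞` into a complete norm.
-/
theorem isClosed_nullSeq : IsClosed ((nullSeq A).toSubmodule : Set (BddSeq A)) := by
  rw [← isSeqClosed_iff_isClosed]
  intro u a hu hua
  change Tendsto (fun n => ‖a n‖) atTop (𝓝 0)
  rw [Metric.tendsto_atTop]
  intro ε hε
  obtain ⟨k, hk⟩ := (Metric.tendsto_atTop.1 hua) (ε / 2) (half_pos hε)
  have hk := hk k le_rfl
  have huk : Tendsto (fun n => ‖u k n‖) atTop (𝓝 0) := hu k
  obtain ⟨N, hN⟩ := (Metric.tendsto_atTop.1 huk) (ε / 2) (half_pos hε)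
  refine ⟨N, fun n hn => ?_⟩
  have h1 := hN n hn
  rw [Real.dist_0_eq_abs, abs_norm] at h1 ⊢
  rw [dist_comm, dist_eq_norm] at hk
  have h2 : ‖a n - u k n‖ ≤ ‖a - u k‖ := BddSeq.norm_apply_le (a - u k) n
  have h3 := norm_add_le (a n - u k n) (u k n)
  rw [sub_add_cancel] at h3
  linarith

instance : NormedAddCommGroup (SeqAlg A) :=
  haveI : IsClosed ((nullSeq A).toSubmodule : Set (BddSeq A)) := isClosed_nullSeq
  inferInstanceAs (NormedAddCommGroup (BddSeq A ⧸ (nullSeq A).toSubmodule))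

instance : CompleteSpace (SeqAlg A) :=
  haveI : IsClosed ((nullSeq A).toSubmodule : Set (BddSeq A)) := isClosed_nullSeq
  inferInstanceAs (CompleteSpace (BddSeq A ⧸ (nullSeq A).toSubmodule))

instance : NormedSpace ℂ (SeqAlg A) :=
  haveI : IsClosed ((nullSeq A).toSubmodule : Set (BddSeq A)) := isClosed_nullSeq
  inferInstanceAs (NormedSpace ℂ (BddSeq A ⧸ (nullSeq A).toSubmodule))

theorem norm_seqMk_le (a : BddSeq A) : ‖seqMk a‖ ≤ ‖a‖ :=
  Submodule.Quotient.norm_mk_le (nullSeq A).toSubmodule a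

theorem exists_seqMk_eq_of_norm_lt {x : SeqAlg A} {r : ℝ} (h : ‖x‖ < r) :
    ∃ a : BddSeq A, seqMk a = x ∧ ‖a‖ < r :=
  (QuotientAddGroup.norm_lt_iff (S := (nullSeq A).toSubmodule.toAddSubgroup) (x := x)).1 h

theorem eventually_norm_lt_of_norm_seqMk_lt {a : BddSeq A} {r : ℝ} (h : ‖seqMk a‖ < r) :
    ∀ᶠ n in atTop, ‖a n‖ < r := by
  obtain ⟨b, hb, hbr⟩ := exists_seqMk_eq_of_norm_lt h
  have h0 := seqMk_eq_iff.1 hb.symm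
  filter_upwards [h0.eventually_lt_const (sub_pos.2 hbr)] with n hn
  have h2 := BddSeq.norm_apply_le b n
  have h3 := norm_add_le (a n - b n) (b n)
  rw [sub_add_cancel] at h3
  linarith

/-- Finitely many terms may be set to zero without changing the class. With
`eventually_norm_lt_of_norm_seqMk_lt` this identifies the quotient norm with the limit superior of
the norms. -/
theorem norm_seqMk_le_of_eventually {a : BddSeq A} {r : ℝ} (hr : 0 ≤ r)
    (h : ∀ᶠ n in atTop, ‖a n‖ ≤ r) : ‖seqMk a‖ ≤ r := by
  obtain ⟨N, hN⟩ := eventually_atTop.1 h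
  let b : BddSeq A := BddSeq.mk (fun n => if n < N then 0 else a n) r (fun n => by
    split_ifs with hn
    · simpa using hr
    · exact hN n (not_lt.1 hn))
  have hb : seqMk a = seqMk b := by
    rw [seqMk_eq_iff]
    refine tendsto_const_nhds.congr' ?_
    filter_upwards [eventually_ge_atTop N] with n hn
    simp [b, BddSeq.mk_apply, not_lt.2 hn]
  rw [hb]
  refine (norm_seqMk_le b).trans (BddSeq.norm_le hr fun n => ?_)
  simp only [b, BddSeq.mk_apply]
  split_ifs with hn
  · simpa using hr
  · exact hN n (not_lt.1 hn)

instance : NonUnitalNormedRing (SeqAlg A) :=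
  { (inferInstance : NormedAddCommGroup (SeqAlg A)), (inferInstance : NonUnitalRing (SeqAlg A)) with
    norm_mul_le := fun x y => by
      have key : ∀ δ > (0 : ℝ), ‖x * y‖ ≤ (‖x‖ + δ) * (‖y‖ + δ) := fun δ hδ => by
        obtain ⟨a, rfl, ha⟩ := exists_seqMk_eq_of_norm_lt (lt_add_of_pos_right ‖x‖ hδ)
        obtain ⟨b, rfl, hb⟩ := exists_seqMk_eq_of_norm_lt (lt_add_of_pos_right ‖y‖ hδ)
        rw [← map_mul]
        exact ((norm_seqMk_le _).trans (norm_mul_le a b)).trans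
          (mul_le_mul ha.le hb.le (norm_nonneg _) (by positivity))
      have hc : Tendsto (fun δ : ℝ => (‖x‖ + δ) * (‖y‖ + δ)) (𝓝[>] 0) (𝓝 (‖x‖ * ‖y‖)) := by
        have : Continuous fun δ : ℝ => (‖x‖ + δ) * (‖y‖ + δ) := by fun_prop
        simpa using (this.tendsto 0).mono_left nhdsWithin_le_nhds
      refine ge_of_tendsto hc ?_
      filter_upwards [self_mem_nhdsWithin] with δ hδ
      exact key δ hδ }

/-- The `C*`-identity holds termwise and passes to the limit superior. -/
instance : CStarRing (SeqAlg A) where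
  norm_mul_self_le x := by
    obtain ⟨a, rfl⟩ := seqMk_surjective x
    have key : ∀ δ > (0 : ℝ), ‖seqMk a‖ * ‖seqMk a‖ ≤ ‖star (seqMk a) * seqMk a‖ + δ := by
      intro δ hδ
      have h0 : 0 ≤ ‖star (seqMk a) * seqMk a‖ + δ := by positivity
      have h1 := lt_add_of_pos_right ‖star (seqMk a) * seqMk a‖ hδ
      rw [← map_star, ← map_mul] at h1
      have h2 : ‖seqMk a‖ ≤ √(‖star (seqMk a) * seqMk a‖ + δ) := by
        refine norm_seqMk_le_of_eventually (Real.sqrt_nonneg _) ?_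
        filter_upwards [eventually_norm_lt_of_norm_seqMk_lt h1] with n hn
        refine Real.le_sqrt_of_sq_le ?_
        have h3 : ‖(star a * a) n‖ = ‖a n‖ * ‖a n‖ := CStarRing.norm_star_mul_self
        rw [h3, map_mul, map_star] at hn
        rw [sq]
        exact hn.le
      calc _ ≤ √(‖star (seqMk a) * seqMk a‖ + δ) * √(‖star (seqMk a) * seqMk a‖ + δ) :=
            mul_self_le_mul_self (norm_nonneg _) h2
        _ = _ := Real.mul_self_sqrt h0
    exact le_of_forall_pos_le_add key

instance : NonUnitalCStarAlgebra (SeqAlg A) where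

theorem norm_toSeqAlg_le (a : A) : ‖toSeqAlg a‖ ≤ ‖a‖ :=
  norm_seqMk_le_of_eventually (norm_nonneg a) (.of_forall fun _ => le_rfl)

theorem continuous_constSeq : Continuous (constSeq A) := by
  have h : ∀ b c : A, ‖constSeq A b - constSeq A c‖ ≤ ‖b - c‖ := fun b c =>
    BddSeq.norm_le (norm_nonneg _) fun _ => le_rfl
  exact continuous_iff_continuousAt.2 fun b => tendsto_iff_norm_sub_tendsto_zero.2
    (squeeze_zero (fun _ => norm_nonneg _) (fun c => h c b)
      (tendsto_iff_norm_sub_tendsto_zero.1 tendsto_id))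

variable (A) in
/-- The quotient map, as a continuous linear map. -/
def seqMkL : BddSeq A →L[ℂ] SeqAlg A :=
  LinearMap.mkContinuous (nullSeq A).mkₗ 1 fun a => by
    rw [one_mul]; exact norm_seqMk_le a

variable (A) in
/-- Evaluation of bounded sequences, as a continuous linear map. -/
def BddSeq.evalL (n : ℕ) : BddSeq A →L[ℂ] A :=
  LinearMap.mkContinuous
    { toFun := fun a => a n, map_add' := fun _ _ => rfl, map_smul' := fun _ _ => rfl } 1
    fun a => by rw [one_mul]; exact BddSeq.norm_apply_le a n

end SeqAlgNorm

/-! ### The induced action on sequences and closedness of its continuous part -/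

namespace CStarAction

variable {G A : Type*} [Group G] [TopologicalSpace G] [NonUnitalCStarAlgebra A]
  (α : CStarAction G A)

theorem bddSeqMap_apply (g : G) (a : BddSeq A) (n : ℕ) : α.bddSeqMap g a n = α.toHom g (a n) := rfl

theorem bddSeqMap_mul (g h : G) (a : BddSeq A) :
    α.bddSeqMap (g * h) a = α.bddSeqMap g (α.bddSeqMap h a) := by
  ext n; exact α.mul_apply g h (a n)

theorem bddSeqMap_one (a : BddSeq A) : α.bddSeqMap 1 a = a := by
  ext n; exact α.one_apply (a n)

theorem norm_bddSeqMap (g : G) (a : BddSeq A) : ‖α.bddSeqMap g a‖ = ‖a‖ := by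
  have key : ∀ (g : G) (a : BddSeq A), ‖α.bddSeqMap g a‖ ≤ ‖a‖ := fun g a =>
    BddSeq.norm_le (norm_nonneg _) fun n => by
      rw [bddSeqMap_apply, α.norm_apply]; exact BddSeq.norm_apply_le a n
  refine (key g a).antisymm ?_
  have := key g⁻¹ (α.bddSeqMap g a)
  rwa [← bddSeqMap_mul, inv_mul_cancel, bddSeqMap_one] at this

theorem seqAlgMap_seqMk (g : G) (a : BddSeq A) :
    α.seqAlgMap g (seqMk a) = seqMk (α.bddSeqMap g a) := rfl

theorem norm_seqAlgMap_le (g : G) (x : SeqAlg A) : ‖α.seqAlgMap g x‖ ≤ ‖x‖ := by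
  refine le_of_forall_pos_lt_add fun ε hε => ?_
  obtain ⟨a, rfl, ha⟩ := exists_seqMk_eq_of_norm_lt (lt_add_of_pos_right ‖x‖ hε)
  rw [seqAlgMap_seqMk]
  refine (norm_seqMk_le _).trans_lt ?_
  rwa [norm_bddSeqMap]

theorem continuous_seqAlgMap (g : G) : Continuous (α.seqAlgMap g) :=
  AddMonoidHomClass.continuous_of_bound (α.seqAlgMap g) 1 fun x => by
    rw [one_mul]; exact α.norm_seqAlgMap_le g x

instance isClosed_contBddSeq : IsClosed (α.contBddSeq : Set (BddSeq A)) := by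
  refine isClosed_of_closure_subset fun a ha => ?_
  change Continuous fun g => α.bddSeqMap g a
  refine continuous_of_uniform_approx_of_continuous fun u hu => ?_
  obtain ⟨ε, hε, h⟩ := Metric.mem_uniformity_dist.1 hu
  obtain ⟨b, hb, hab⟩ := Metric.mem_closure_iff.1 ha ε hε
  refine ⟨fun g => α.bddSeqMap g b, hb, fun g => h ?_⟩
  rwa [dist_eq_norm, ← map_sub, norm_bddSeqMap, ← dist_eq_norm]

/-- Null sequences are norm limits of finitely supported ones, on which continuity of the action is
that on `A`. -/
theorem nullSeq_subset_contBddSeq {a : BddSeq A} (ha : a ∈ (nullSeq A).toSubmodule) :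
    a ∈ α.contBddSeq := by
  refine (isClosed_contBddSeq α).closure_subset_iff.2 (le_refl _) ?_
  rw [Metric.mem_closure_iff]
  intro ε hε
  have ha' : Tendsto (fun n => ‖a n‖) atTop (𝓝 0) := ha
  obtain ⟨N, hN⟩ := eventually_atTop.1 (ha'.eventually_lt_const (half_pos hε))
  refine ⟨∑ n ∈ Finset.range N, lp.single ∞ n (a n), ?_, ?_⟩
  · refine sum_mem fun n _ => ?_
    change Continuous fun g => α.bddSeqMap g (lp.single ∞ n (a n))
    have : (fun g => α.bddSeqMap g (lp.single ∞ n (a n))) =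
        fun g => lp.single ∞ n (α.toHom g (a n)) := by
      ext g m
      rw [bddSeqMap_apply]
      by_cases h : m = n
      · subst h; simp
      · simp [lp.single_apply, h]
    rw [this]
    have hi : Isometry (fun x : A => (lp.single ∞ n x : BddSeq A)) :=
      Isometry.of_dist_eq fun x y => by
        rw [dist_eq_norm, dist_eq_norm, ← lp.single_sub, lp.norm_single (by simp)]
    exact hi.continuous.comp (α.continuous_apply (a n))
  · rw [dist_eq_norm]
    refine (BddSeq.norm_le (half_pos hε).le fun n => ?_).trans_lt (half_lt_self hε)
    rw [lp.coeFn_sub, Pi.sub_apply, lp.coeFn_sum, Finset.sum_apply]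
    by_cases hn : n < N
    · rw [Finset.sum_eq_single_of_mem n (Finset.mem_range.2 hn)
        (fun m _ hm => by simp [lp.single_apply, hm.symm])]
      simpa [lp.single_apply] using (half_pos hε).le
    · rw [Finset.sum_eq_zero (fun m hm => ?_), sub_zero]
      · exact (hN n (not_lt.1 hn)).le
      · have : n ≠ m := fun h => hn (h ▸ Finset.mem_range.1 hm)
        simp [lp.single_apply, this]

/-- Every lift of a continuous class differs from a continuous sequence by a null sequence, so any
lift of a limit point is itself a limit of continuous sequences. This keeps the values of `T` in
`A_{∞,α}` when `T` is extended by density. -/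
theorem isClosed_contSeqAlg : IsClosed (α.contSeqAlg : Set (SeqAlg A)) := by
  refine isClosed_of_closure_subset fun x hx => ?_
  obtain ⟨a, rfl⟩ := seqMk_surjective x
  refine ⟨a, ?_, rfl⟩
  refine (isClosed_contBddSeq α).closure_subset_iff.2 (le_refl _) ?_
  rw [Metric.mem_closure_iff]
  intro ε hε
  obtain ⟨_, ⟨b, hb, rfl⟩, hab⟩ := Metric.mem_closure_iff.1 hx ε hε
  change dist (seqMk a) (seqMk b) < ε at hab
  rw [dist_eq_norm, ← map_sub] at hab
  obtain ⟨c, hc, hcε⟩ := exists_seqMk_eq_of_norm_lt hab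
  refine ⟨a - c, ?_, by rwa [dist_eq_norm, sub_sub_cancel]⟩
  have h0 : (a - b) - c ∈ (nullSeq A).toSubmodule := (nullSeq A).mkₗ_eq_iff.1 hc.symm
  have h1 : a - c = (a - b - c) + b := by abel
  rw [h1]
  exact add_mem (α.nullSeq_subset_contBddSeq h0) hb

end CStarAction

/-! ### Partitions of unity and approximation of kernels -/

section Partitions

variable {X : Type*} [TopologicalSpace X]

/-- The partition is subordinate to a finite cover by sets on which `F` varies little, so `F` is
uniformly close to `∑ p i • F (y i)`. -/
theorem exists_partition_of_unity [CompactSpace X] [T2Space X] {E : Type*}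
    [SeminormedAddCommGroup E] (F : C(X, E)) {ε : ℝ}
    (hε : 0 < ε) : ∃ (n : ℕ) (p : Fin n → C(X, ℝ)) (y : Fin n → X), (∀ i x, 0 ≤ p i x) ∧
      (∀ x, ∑ i, p i x = 1) ∧ ∀ i x, p i x ≠ 0 → ‖F x - F (y i)‖ < ε := by
  let U : X → Set X := fun y => {x | ‖F x - F y‖ < ε}
  have hU : ∀ y, IsOpen (U y) := fun y =>
    isOpen_lt (F.continuous.sub continuous_const).norm continuous_const
  obtain ⟨t, ht⟩ := isCompact_univ.elim_finite_subcover U hU (fun x _ =>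
    Set.mem_iUnion.2 ⟨x, by simpa [U] using hε⟩)
  let y : Fin t.card → X := fun i => (t.equivFin.symm i : X)
  obtain ⟨f, hf⟩ := PartitionOfUnity.exists_isSubordinate isClosed_univ (fun i => U (y i))
    (fun i => hU _) (by
      intro x hx
      obtain ⟨z, hz, hxz⟩ := Set.mem_iUnion₂.1 (ht hx)
      exact Set.mem_iUnion.2 ⟨t.equivFin ⟨z, hz⟩, by simpa [y] using hxz⟩)
  refine ⟨t.card, fun i => f i, y, fun i x => f.nonneg i x, fun x => ?_, fun i x hx => ?_⟩
  · rw [← f.sum_eq_one (Set.mem_univ x), finsum_eq_sum_of_fintype]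
  · exact hf i (subset_tsupport _ hx)

theorem norm_sub_sum_smul_le {E ι : Type*} [SeminormedAddCommGroup E] [NormedSpace ℝ E] [Fintype ι]
    {p : ι → ℝ} (hp : ∀ i, 0 ≤ p i) (hs : ∑ i, p i = 1) {x : E} {v : ι → E} {ε : ℝ}
    (h : ∀ i, p i ≠ 0 → ‖x - v i‖ ≤ ε) : ‖x - ∑ i, p i • v i‖ ≤ ε := by
  have : x - ∑ i, p i • v i = ∑ i, p i • (x - v i) := by
    simp only [smul_sub, Finset.sum_sub_distrib]
    rw [← Finset.sum_smul, hs, one_smul]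
  rw [this]
  calc ‖∑ i, p i • (x - v i)‖ ≤ ∑ i, ‖p i • (x - v i)‖ := norm_sum_le _ _
    _ ≤ ∑ i, p i * ε := Finset.sum_le_sum fun i _ => by
        rw [norm_smul, Real.norm_of_nonneg (hp i)]
        rcases eq_or_ne (p i) 0 with h0 | h0
        · simp [h0]
        · exact mul_le_mul_of_nonneg_left (h i h0) (hp i)
    _ = ε := by rw [← Finset.sum_mul, hs, one_mul]

/-- A complex valued version of a real valued function. -/
def ofRealMap (f : C(X, ℝ)) : C(X, ℂ) := ⟨fun x => (f x : ℂ), by fun_prop⟩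

theorem ofRealMap_apply (f : C(X, ℝ)) (x : X) : ofRealMap f x = (f x : ℂ) := rfl

/-- A finite family of continuous functions lies in the span of an orthonormal family. -/
theorem exists_orthonormal_family [CompactSpace X] [MeasurableSpace X] [BorelSpace X]
    (μ : Measure X) [IsFiniteMeasure μ] [μ.IsOpenPosMeasure] {ι : Type*} [Finite ι]
    (f : ι → C(X, ℂ)) :
    ∃ (n : ℕ) (ξ : Fin n → C(X, ℂ)) (c : ι → Fin n → ℂ),
      (∀ i j, ∫ x, star (ξ i x) * ξ j x ∂μ = if i = j then 1 else 0) ∧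
      ∀ k x, f k x = ∑ i, c k i * ξ i x := by
  let T : C(X, ℂ) →L[ℂ] Lp ℂ 2 μ := ContinuousMap.toLp 2 μ ℂ
  let V : Submodule ℂ (Lp ℂ 2 μ) := Submodule.span ℂ (Set.range fun k => T (f k))
  have : FiniteDimensional ℂ V := FiniteDimensional.span_of_finite ℂ (Set.finite_range _)
  let b := stdOrthonormalBasis ℂ V
  -- The span consists of classes of continuous functions, so its orthonormal basis has continuous
  -- representatives. Identities in `L²` then hold pointwise, since `μ` charges nonempty open sets.
  have hV : V ≤ LinearMap.range (T : C(X, ℂ) →ₗ[ℂ] Lp ℂ 2 μ) := by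
    rw [Submodule.span_le]
    rintro _ ⟨k, rfl⟩
    exact ⟨f k, rfl⟩
  choose ξ hξ using fun i => hV (b i).2
  have hξ : ∀ i, T (ξ i) = (b i : Lp ℂ 2 μ) := hξ
  refine ⟨_, ξ, fun k i => b.repr ⟨T (f k), Submodule.subset_span ⟨k, rfl⟩⟩ i, fun i j => ?_,
    fun k x => ?_⟩
  · have h1 := orthonormal_iff_ite.1 b.orthonormal i j
    rw [Submodule.coe_inner, ← hξ, ← hξ, ContinuousMap.inner_toLp] at h1
    rw [← h1]
    congr 1
    ext x
    exact mul_comm _ _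
  · have h1 := congrArg Subtype.val (b.sum_repr ⟨T (f k), Submodule.subset_span ⟨k, rfl⟩⟩)
    have h2 : T (∑ i, b.repr ⟨T (f k), Submodule.subset_span ⟨k, rfl⟩⟩ i • ξ i) = T (f k) := by
      rw [map_sum]
      refine Eq.trans ?_ h1
      rw [AddSubmonoidClass.coe_finsetSum]
      exact Finset.sum_congr rfl fun i _ => by rw [map_smul, hξ]; rfl
    have h3 := ContinuousMap.toLp_injective μ h2
    rw [← h3]
    simp

end Partitions

section Kernels

variable {G A : Type*} [Group G] [TopologicalSpace G] [IsTopologicalGroup G] [CompactSpace G]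
  [T2Space G] [MeasurableSpace G] [BorelSpace G] [NonUnitalCStarAlgebra A]

/-- Partitions of unity in each variable give `∑ p_k(h) q_l(t) K(y_k, z_l)`; all the `p_k` and `q_l`
are then expanded in one orthonormal family. -/
theorem exists_kernel_approx (K : C(G × G, A)) {ε : ℝ} (hε : 0 < ε) :
    ∃ (n : ℕ) (ξ : Fin n → C(G, ℂ)) (a : Matrix (Fin n) (Fin n) A),
      (∀ i j, ∫ x, star (ξ i x) * ξ j x ∂(normHaar G) = if i = j then 1 else 0) ∧
      ∀ h t, ‖K (h, t) - ∑ i, ∑ j, (ξ i h * star (ξ j t)) • a i j‖ ≤ ε := by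
  obtain ⟨n, p, y, hp0, hp1, hp⟩ := exists_partition_of_unity K.curry (half_pos hε)
  obtain ⟨m, q, z, hq0, hq1, hq⟩ := exists_partition_of_unity
    (K.comp ⟨Prod.swap, continuous_swap⟩).curry (half_pos hε)
  obtain ⟨N, ξ, c, hξ, hc⟩ := exists_orthonormal_family (normHaar G)
    (Sum.elim (fun k => ofRealMap (p k)) (fun l => ofRealMap (q l)))
  have hcp : ∀ k h, (p k h : ℂ) = ∑ i, c (Sum.inl k) i * ξ i h := fun k h => hc (Sum.inl k) h
  -- Since `q l` is real, its expansion may be conjugated, which yields the factor `star (ξ j t)`.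
  have hcq : ∀ l t, (q l t : ℂ) = ∑ j, star (c (Sum.inr l) j) * star (ξ j t) := fun l t => by
    have := congrArg star (hc (Sum.inr l) t)
    rw [star_sum] at this
    simp only [star_mul'] at this
    rw [← this]
    exact (Complex.conj_ofReal _).symm
  refine ⟨N, ξ, fun i j => ∑ k, ∑ l, (c (Sum.inl k) i * star (c (Sum.inr l) j)) • K (y k, z l), hξ,
    fun h t => ?_⟩
  have e : ∑ i, ∑ j, (ξ i h * star (ξ j t)) •
      (∑ k, ∑ l, (c (Sum.inl k) i * star (c (Sum.inr l) j)) • K (y k, z l)) =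
      ∑ k, p k h • ∑ l, q l t • K (y k, z l) := by
    have e1 : ∀ k l, p k h • q l t • K (y k, z l) = ∑ i, ∑ j, ((ξ i h * star (ξ j t)) *
        (c (Sum.inl k) i * star (c (Sum.inr l) j))) • K (y k, z l) := fun k l => by
      rw [smul_smul, ← Complex.coe_smul, Complex.ofReal_mul, hcp, hcq, Finset.sum_mul_sum]
      simp only [Finset.sum_smul]
      refine Finset.sum_congr rfl fun i _ => Finset.sum_congr rfl fun j _ => ?_
      congr 1; ring
    simp only [Finset.smul_sum, e1, smul_smul]
    calc _ = ∑ i, ∑ k, ∑ j, ∑ l, _ := Finset.sum_congr rfl fun i _ => Finset.sum_comm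
      _ = ∑ k, ∑ i, ∑ j, ∑ l, _ := Finset.sum_comm
      _ = ∑ k, ∑ i, ∑ l, ∑ j, _ :=
        Finset.sum_congr rfl fun k _ => Finset.sum_congr rfl fun i _ => Finset.sum_comm
      _ = _ := Finset.sum_congr rfl fun k _ => Finset.sum_comm
  rw [e]
  refine norm_sub_sum_smul_le (hp0 · h) (hp1 h) fun k hk => ?_
  have h1 : ‖K (h, t) - K (y k, t)‖ ≤ ε / 2 :=
    ((K.curry h - K.curry (y k)).norm_coe_le_norm t).trans (hp k h hk).le
  have h2 : ‖K (y k, t) - ∑ l, q l t • K (y k, z l)‖ ≤ ε / 2 :=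
    norm_sub_sum_smul_le (hq0 · t) (hq1 t) fun l hl =>
      (((K.comp ⟨Prod.swap, continuous_swap⟩).curry t -
        (K.comp ⟨Prod.swap, continuous_swap⟩).curry (z l)).norm_coe_le_norm (y k)).trans
        (hq l t hl).le
  calc _ = ‖(K (h, t) - K (y k, t)) + (K (y k, t) - ∑ l, q l t • K (y k, z l))‖ := by
        congr 1; abel
    _ ≤ ε := (norm_add_le _ _).trans (by linarith)

end Kernels

/-! ### Separable invariant subalgebras -/

section Subalgebras

theorem countable_subsemigroup_closure {M : Type*} [Semigroup M] {s : Set M} (hs : s.Countable) :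
    (Subsemigroup.closure s : Set M).Countable := by
  have := hs.to_subtype
  refine (Set.countable_range fun p : s × List s =>
    p.2.foldl (fun (a : M) (b : s) => a * b) (p.1 : M)).mono fun x hx => ?_
  have hfold : ∀ (l : List s) (a b : M), l.foldl (fun (a : M) (b : s) => a * b) (a * b) =
      a * l.foldl (fun (a : M) (b : s) => a * b) b := fun l => by
    induction l with
    | nil => intro a b; rfl
    | cons c l ih => intro a b; rw [List.foldl_cons, List.foldl_cons, mul_assoc, ih]
  induction hx using Subsemigroup.closure_induction with
  | mem x hx => exact ⟨(⟨x, hx⟩, []), rfl⟩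
  | mul x y _ _ hx hy =>
    obtain ⟨⟨a, l⟩, rfl⟩ := hx
    obtain ⟨⟨b, m⟩, rfl⟩ := hy
    exact ⟨(a, l ++ b :: m), by simp only [List.foldl_append, List.foldl_cons, hfold]⟩

theorem NonUnitalStarAlgebra.isSeparable_adjoin {A : Type*} [NonUnitalCStarAlgebra A] {s : Set A}
    (hs : s.Countable) :
    TopologicalSpace.IsSeparable (NonUnitalStarAlgebra.adjoin ℂ s : Set A) := by
  have h : (NonUnitalStarAlgebra.adjoin ℂ s : Set A) =
      (Submodule.span ℂ (Subsemigroup.closure (s ∪ star s) : Set A) : Set A) := by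
    rw [← NonUnitalAlgebra.adjoin_eq_span]
    rfl
  rw [h]
  refine TopologicalSpace.IsSeparable.span ?_
  refine (countable_subsemigroup_closure (hs.union ?_)).isSeparable
  exact hs.preimage star_injective

/-- The orbit of `S` is separable by joint continuity; `D` is generated by a countable dense subset
of it. The preimage of `D` under each `α_g` is a closed subalgebra containing these generators,
whence invariance. -/
theorem CStarAction.exists_invariant_subalgebra {G A : Type*} [Group G] [TopologicalSpace G]
    [TopologicalSpace.SeparableSpace G] [NonUnitalCStarAlgebra A] (α : CStarAction G A) {S : Set A}
    (hS : TopologicalSpace.IsSeparable S) : ∃ D : NonUnitalStarSubalgebra ℂ A,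
      α.IsInvariant D ∧ IsClosed (D : Set A) ∧ TopologicalSpace.IsSeparable (D : Set A) ∧
        S ⊆ D := by
  let O : Set A := (fun p : G × A => α.toHom p.1 p.2) '' (Set.univ ×ˢ S)
  have hO : TopologicalSpace.IsSeparable O :=
    ((TopologicalSpace.isSeparable_univ_iff.2 inferInstance).prod hS).image α.continuous_uncurry
  have hinv : ∀ g, ∀ a ∈ O, α.toHom g a ∈ O := by
    rintro g _ ⟨⟨h, a⟩, ⟨-, ha⟩, rfl⟩
    exact ⟨(g * h, a), ⟨trivial, ha⟩, α.mul_apply g h a⟩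
  obtain ⟨c, hcO, hc, hOc⟩ := hO.exists_countable_dense_subset
  let D := (NonUnitalStarAlgebra.adjoin ℂ c).topologicalClosure
  have hD : (D : Set A) = closure (NonUnitalStarAlgebra.adjoin ℂ c : Set A) :=
    rfl
  have hOD : O ⊆ D := by
    rw [hD]
    exact hOc.trans (closure_mono (NonUnitalStarAlgebra.subset_adjoin ℂ c))
  have hDc : IsClosed (D : Set A) := NonUnitalStarSubalgebra.isClosed_topologicalClosure _
  refine ⟨D, fun g => ?_, hDc, ?_, fun a ha => hOD ⟨(1, a), ⟨trivial, ha⟩, α.one_apply a⟩⟩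
  · have h1 : NonUnitalStarAlgebra.adjoin ℂ c ≤ D.comap (α.toHom g : A →⋆ₙₐ[ℂ] A) :=
      NonUnitalStarAlgebra.adjoin_le fun a ha => hOD (hinv g a (hcO ha))
    have h2 : IsClosed
        ((D.comap (α.toHom g : A →⋆ₙₐ[ℂ] A) : NonUnitalStarSubalgebra ℂ A) : Set A) :=
      hDc.preimage (α.continuous_uncurry.comp (Continuous.prodMk_right g))
    exact NonUnitalStarSubalgebra.topologicalClosure_minimal _ h1 h2
  · rw [hD]
    exact (NonUnitalStarAlgebra.isSeparable_adjoin hc).closure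

end Subalgebras

/-! ### Averaging -/

section Averaging

set_option linter.unusedSectionVars false

variable {G A : Type*} [Group G] [TopologicalSpace G] [IsTopologicalGroup G] [CompactSpace G]
  [SecondCountableTopology G] [MeasurableSpace G] [BorelSpace G] [NonUnitalCStarAlgebra A]

instance : IsProbabilityMeasure (normHaar G) :=
  ⟨Measure.haarMeasure_self (K₀ := (⊤ : TopologicalSpace.PositiveCompacts G))⟩

namespace CStarAction

variable (α : CStarAction G A)

/-- The average of `a` over its orbit. -/
def average (a : A) : A := ∫ g, α.toHom g a ∂(normHaar G)

theorem apply_average (h : G) (a : A) : α.toHom h (α.average a) = α.average a := by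
  rw [average, ConvAlg.integral_act α h (α.continuous_apply a),
    ← integral_mul_left_eq_self (fun g => α.toHom g a) h]
  simp only [α.mul_apply]

theorem norm_average_le (a : A) : ‖α.average a‖ ≤ ‖a‖ := by
  refine (norm_integral_le_of_norm_le_const (C := ‖a‖)
    (.of_forall fun g => (α.norm_apply g a).le)).trans ?_
  simp

theorem star_average (a : A) : star (α.average a) = α.average (star a) := by
  rw [average, ConvAlg.integral_star' (α.continuous_apply a)]
  exact integral_congr_ae (.of_forall fun g => (map_star (α.toHom g) a).symm)

end CStarAction

/-- The approximate unit is averaged over `G`. Pointwise, `α_g(e_n) a = α_g(e_n α_g⁻¹(a))` tends to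
`a`, and dominated convergence applies because the approximate unit is a sequence. -/
theorem IsSigmaUnital.exists_invariant (hA : IsSigmaUnital A) (α : CStarAction G A) :
    ∃ v : ℕ → A, (∀ n g, α.toHom g (v n) = v n) ∧ (∀ n, IsSelfAdjoint (v n)) ∧ (∀ n, ‖v n‖ ≤ 1) ∧
      ∀ a, Tendsto (fun n => v n * a) atTop (𝓝 a) ∧ Tendsto (fun n => a * v n) atTop (𝓝 a) := by
  obtain ⟨e, he, hea⟩ := hA
  have hsa : ∀ n, star (e n) = e n := fun n => by
    obtain ⟨b, hb⟩ := (he n).1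
    rw [hb, star_mul, star_star]
  have hs : ∀ n, IsSelfAdjoint (α.average (e n)) := fun n => by
    rw [isSelfAdjoint_iff, α.star_average, hsa]
  have hl : ∀ a, Tendsto (fun n => α.average (e n) * a) atTop (𝓝 a) := fun a => by
    have h1 : ∀ n, α.average (e n) * a = ∫ g, α.toHom g (e n) * a ∂(normHaar G) := fun n =>
      ConvAlg.integral_mul_right' a (α.continuous_apply (e n))
    have h2 : a = ∫ _g : G, a ∂(normHaar G) := by simp
    simp only [h1]
    conv => arg 3; rw [h2]
    refine tendsto_integral_of_dominated_convergence (fun _ => ‖a‖) (fun n => ?_)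
      (integrable_const _) (fun n => .of_forall fun g => ?_) (.of_forall fun g => ?_)
    · exact (ConvAlg.integrable_of_continuous
        ((α.continuous_apply (e n)).mul continuous_const)).aestronglyMeasurable
    · refine (norm_mul_le _ _).trans ?_
      rw [α.norm_apply]
      exact mul_le_of_le_one_left (norm_nonneg _) (he n).2
    · have h3 := (hea (α.toHom g⁻¹ a)).1
      have h4 := ((α.continuous_uncurry.comp (Continuous.prodMk_right g)).tendsto _).comp h3
      simpa only [Function.comp_def, map_mul, ← α.mul_apply, mul_inv_cancel, α.one_apply] using h4
  refine ⟨fun n => α.average (e n), fun n g => α.apply_average g _, hs, fun n =>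
    (α.norm_average_le _).trans (he n).2, fun a => ⟨hl a, ?_⟩⟩
  have := (continuous_star.tendsto _).comp (hl (star a))
  simpa [Function.comp_def, (hs _).star_eq] using this

end Averaging

/-! ### Lifts of Rokhlin homomorphisms -/

section Lifts

variable {G A : Type*} [Group G] [TopologicalSpace G] [IsTopologicalGroup G]
  [NonUnitalCStarAlgebra A]

/-- An equivariant unital homomorphism `C(G) → F_α(D, A)`, lifted elementwise to `A_{∞,α} ∩ D'`,
together with an approximate unit contained in `D`. -/
structure RokhlinLift (α : CStarAction G A) (D : NonUnitalStarSubalgebra ℂ A) where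
  isInvariant : α.IsInvariant D
  /-- The approximate unit. -/
  v : ℕ → A
  v_mem : ∀ n, v n ∈ D
  v_star : ∀ n, star (v n) = v n
  norm_v : ∀ n, ‖v n‖ ≤ 1
  tendsto_v : ∀ a, Tendsto (fun n => v n * a) atTop (𝓝 a)
  tendsto_v' : ∀ a, Tendsto (fun n => a * v n) atTop (𝓝 a)
  /-- The lifts. -/
  toFun : C(G, ℂ) → SeqAlg A
  mem_cont : ∀ f, toFun f ∈ α.contSeqAlg
  comm : ∀ f, ∀ d ∈ D, toFun f * toSeqAlg d = toSeqAlg d * toFun f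
  toFun_add : ∀ f g, ∀ d ∈ D, toFun (f + g) * toSeqAlg d =
    toFun f * toSeqAlg d + toFun g * toSeqAlg d
  toFun_smul : ∀ (z : ℂ) (f), ∀ d ∈ D, toFun (z • f) * toSeqAlg d = z • (toFun f * toSeqAlg d)
  toFun_mul : ∀ f g, ∀ d ∈ D, toFun (f * g) * toSeqAlg d = toFun f * (toFun g * toSeqAlg d)
  toFun_star : ∀ f, ∀ d ∈ D, toFun (star f) * toSeqAlg d = star (toFun f) * toSeqAlg d
  toFun_one : ∀ d ∈ D, toFun 1 * toSeqAlg d = toSeqAlg d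
  toFun_map : ∀ g f, ∀ d ∈ D, α.seqAlgMap g (toFun f) * toSeqAlg d =
    toFun (CStarAction.leftTranslate g f) * toSeqAlg d

theorem kirchbergMk_eq_imp {D : NonUnitalStarSubalgebra ℂ A} {x y : relCommutant D}
    (h : kirchbergMk D x = kirchbergMk D y) {d : A} (hd : d ∈ D) :
    (x : SeqAlg A) * toSeqAlg d = y * toSeqAlg d := by
  have h1 : x - y ∈ (annihilatorIdeal D).toSubmodule := (annihilatorIdeal D).mkₗ_eq_iff.1 h
  have h2 := (h1 d hd).1
  rwa [AddSubgroupClass.coe_sub, sub_mul, sub_eq_zero] at h2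

/-- An identity in `F(D, A)` is an identity in `A_∞` after multiplication by elements of `D`, for
any choice of lifts. -/
theorem CStarAction.HasRokhlinProperty.nonempty_lift {α : CStarAction G A}
    (hα : α.HasRokhlinProperty) {D : NonUnitalStarSubalgebra ℂ A} (hD : α.IsInvariant D)
    (hDc : IsClosed (D : Set A)) (hDs : TopologicalSpace.IsSeparable (D : Set A)) {v : ℕ → A}
    (hvD : ∀ n, v n ∈ D) (hvα : ∀ n g, α.toHom g (v n) = v n) (hvs : ∀ n, IsSelfAdjoint (v n))
    (hv1 : ∀ n, ‖v n‖ ≤ 1) (hv : ∀ a, Tendsto (fun n => v n * a) atTop (𝓝 a) ∧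
      Tendsto (fun n => a * v n) atTop (𝓝 a)) : Nonempty (RokhlinLift α D) := by
  obtain ⟨φ, hφ1, hφ⟩ := hα D hD hDc hDs
  have hlift : ∀ f, ∃ x : relCommutant D, (x : SeqAlg A) ∈ α.contSeqAlg ∧
      kirchbergMk D x = (φ f : KirchbergAlg D) := fun f => (φ f).2
  choose x hx hxφ using hlift
  let u : BddSeq A := BddSeq.mk v 1 hv1
  have hu1 : ∀ d, seqMk u * toSeqAlg d = toSeqAlg d := fun d =>
    seqMk_eq_iff.2 (tendsto_iff_norm_sub_tendsto_zero.1 (hv d).1)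
  have hu2 : ∀ d, toSeqAlg d * seqMk u = toSeqAlg d := fun d =>
    seqMk_eq_iff.2 (tendsto_iff_norm_sub_tendsto_zero.1 (hv d).2)
  let U : relCommutant D := ⟨seqMk u, fun d _ => by rw [hu1, hu2]⟩
  -- `φ 1` is a unit only for `F_α(D, A)`, so it is tested on the class of the approximate unit,
  -- which lies there because the `v n` are invariant.
  have hU : kirchbergMk D U ∈ α.contKirchberg D := by
    refine ⟨U, ⟨u, ?_, rfl⟩, rfl⟩
    have : (fun g => α.bddSeqMap g u) = fun _ => u := by
      ext g n; exact hvα n g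
    change Continuous fun g => α.bddSeqMap g u
    rw [this]; exact continuous_const
  have h1 : kirchbergMk D (x 1 * U) = kirchbergMk D U := by
    rw [map_mul, hxφ]
    exact congrArg Subtype.val (hφ1 ⟨_, hU⟩).1
  refine ⟨{ isInvariant := hD, v := v, v_mem := hvD,
            v_star := fun n => (hvs n).star_eq, norm_v := hv1, tendsto_v := fun a => (hv a).1,
            tendsto_v' := fun a => (hv a).2
            toFun := fun f => x f, mem_cont := hx, comm := fun f => (x f).2
            toFun_add := ?_, toFun_smul := ?_, toFun_mul := ?_, toFun_star := ?_, toFun_one := ?_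
            toFun_map := ?_ }⟩
  · intro f g d hd
    have : kirchbergMk D (x (f + g)) = kirchbergMk D (x f + x g) := by
      simp only [map_add, hxφ]; rfl
    rw [kirchbergMk_eq_imp this hd, ← add_mul]; rfl
  · intro z f d hd
    have : kirchbergMk D (x (z • f)) = kirchbergMk D (z • x f) := by
      simp only [map_smul, hxφ]; rfl
    rw [kirchbergMk_eq_imp this hd, ← smul_mul_assoc]; rfl
  · intro f g d hd
    have : kirchbergMk D (x (f * g)) = kirchbergMk D (x f * x g) := by
      simp only [map_mul, hxφ]; rfl
    rw [kirchbergMk_eq_imp this hd, ← mul_assoc]; rfl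
  · intro f d hd
    have : kirchbergMk D (x (star f)) = kirchbergMk D (star (x f)) := by
      simp only [map_star, hxφ]; rfl
    rw [kirchbergMk_eq_imp this hd]; rfl
  · intro d hd
    have h2 := kirchbergMk_eq_imp h1 hd
    change (x 1 : SeqAlg A) * seqMk u * toSeqAlg d = seqMk u * toSeqAlg d at h2
    rwa [mul_assoc, hu1] at h2
  · intro g f d hd
    have : kirchbergMk D (α.relCommutantMap D hD g (x f)) =
        kirchbergMk D (x (CStarAction.leftTranslate g f)) := by
      rw [hxφ, hφ, ← hxφ]; rfl
    exact kirchbergMk_eq_imp this hd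

end Lifts

/-! ### The homomorphism `C(G, D) → A_∞` -/

instance {A : Type*} [NonUnitalCStarAlgebra A] (D : NonUnitalStarSubalgebra ℂ A) :
    ContinuousStar D :=
  ⟨(continuous_subtype_val.star).subtype_mk _⟩

/-- From `0 ≤ a + b ≤ 2b`. The constant is not sharp, but any fixed constant suffices. -/
theorem norm_le_three_mul_of_le_of_neg_le {B : Type*} [NonUnitalCStarAlgebra B] [PartialOrder B]
    [StarOrderedRing B] {a b : B} (h1 : a ≤ b) (h2 : -a ≤ b) : ‖a‖ ≤ 3 * ‖b‖ := by
  have h3 : 0 ≤ a + b := by simpa using add_le_add_right h2 a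
  have h4 : a + b ≤ b + b := by gcongr
  have h5 := CStarAlgebra.norm_le_norm_of_nonneg_of_le h3 h4
  calc ‖a‖ = ‖(a + b) - b‖ := by rw [add_sub_cancel_right]
    _ ≤ ‖a + b‖ + ‖b‖ := norm_sub_le _ _
    _ ≤ 3 * ‖b‖ := by linarith [norm_add_le b b]

namespace RokhlinLift

variable {G A : Type*} [Group G] [TopologicalSpace G] [IsTopologicalGroup G]
  [NonUnitalCStarAlgebra A] {α : CStarAction G A} {D : NonUnitalStarSubalgebra ℂ A}
  (R : RokhlinLift α D)

/-- The pairing `(f, d) ↦ x_f d`. -/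
def pair : C(G, ℂ) →ₗ[ℂ] D →ₗ[ℂ] SeqAlg A :=
  LinearMap.mk₂ ℂ (fun f d => R.toFun f * toSeqAlg (d : A))
    (fun f g d => R.toFun_add f g d d.2) (fun z f d => R.toFun_smul z f d d.2)
    (fun f d d' => mul_add (R.toFun f) (toSeqAlg (d : A)) (toSeqAlg (d' : A)))
    (fun z f d => mul_smul_comm z (R.toFun f) (toSeqAlg (d : A)))

theorem pair_apply (f : C(G, ℂ)) (d : D) : R.pair f d = R.toFun f * toSeqAlg (d : A) := rfl

theorem star_comm (f : C(G, ℂ)) {d : A} (hd : d ∈ D) :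
    star (R.toFun f) * toSeqAlg d = toSeqAlg d * star (R.toFun f) := by
  have h := congrArg star (R.comm f (star d) (star_mem hd))
  rw [star_mul, star_mul, ← toSeqAlg_star, star_star] at h
  exact h.symm

theorem star_mul_pair (f g : C(G, ℂ)) (d : D) :
    star (R.toFun f) * R.pair g d = R.pair (star f * g) d := by
  rw [pair_apply, pair_apply, R.comm g d d.2, ← mul_assoc, ← R.toFun_star f d d.2, mul_assoc,
    ← R.comm g d d.2, R.toFun_mul _ _ d d.2]

theorem toSeqAlg_mul_pair (f : C(G, ℂ)) (d e : D) :
    toSeqAlg (e : A) * R.pair f d = R.pair f (e * d) := by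
  rw [pair_apply, pair_apply, ← mul_assoc, ← R.comm f e e.2, mul_assoc]
  rfl

theorem pair_one (d : D) : R.pair 1 d = toSeqAlg (d : A) := R.toFun_one d d.2

theorem tendsto_pair (f : C(G, ℂ)) {d : ℕ → D} {e : D}
    (h : Tendsto (fun n => (d n : A)) atTop (𝓝 e)) :
    Tendsto (fun n => R.pair f (d n)) atTop (𝓝 (R.pair f e)) := by
  have h1 : Tendsto (fun n => toSeqAlg (d n : A)) atTop (𝓝 (toSeqAlg (e : A))) := by
    rw [tendsto_iff_norm_sub_tendsto_zero] at h ⊢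
    refine squeeze_zero (fun _ => norm_nonneg _) (fun n => ?_) h
    exact norm_toSeqAlg_le ((d n : A) - e)
  simp only [pair_apply]
  exact h1.const_mul (R.toFun f)

/-- The elements of the approximate unit, as elements of `D`. -/
def vD (n : ℕ) : D := ⟨R.v n, R.v_mem n⟩

/-- The element `x_f v_n`. -/
def cut (f : C(G, ℂ)) (n : ℕ) : SeqAlg A := R.pair f (R.vD n)

theorem star_cut (f : C(G, ℂ)) (n : ℕ) :
    star (R.cut f n) = toSeqAlg (R.v n) * star (R.toFun f) := by
  change star (R.toFun f * toSeqAlg (R.v n)) = _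
  rw [star_mul, ← toSeqAlg_star, R.v_star]

theorem star_cut_mul_pair (f g : C(G, ℂ)) (d : D) (n : ℕ) :
    star (R.cut f n) * R.pair g d = R.pair (star f * g) (R.vD n * d) := by
  rw [star_cut, mul_assoc, star_mul_pair]
  exact R.toSeqAlg_mul_pair _ _ (R.vD n)

theorem star_cut_mul_cut (f g : C(G, ℂ)) (n : ℕ) :
    star (R.cut f n) * R.cut g n = R.pair (star f * g) (R.vD n * R.vD n) :=
  R.star_cut_mul_pair f g _ n

theorem norm_vD_mul_vD_le (n : ℕ) : ‖toSeqAlg ((R.vD n * R.vD n : D) : A)‖ ≤ 1 :=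
  (norm_toSeqAlg_le _).trans ((norm_mul_le (R.v n) (R.v n)).trans
    (mul_le_one₀ (R.norm_v n) (norm_nonneg _) (R.norm_v n)))

section Compact

variable [CompactSpace G]

/-- The lifts carry no norm bound of their own; positivity supplies one after multiplication by `v
n`. -/
theorem norm_cut_le (f : C(G, ℂ)) (n : ℕ) : ‖R.cut f n‖ ≤ ‖f‖ := by
  let _ : PartialOrder (SeqAlg A) := CStarAlgebra.spectralOrder _
  let _ : StarOrderedRing (SeqAlg A) := CStarAlgebra.spectralOrderedRing _
  -- Complements `f` so that `f^* f + g^* g` is the constant `‖f‖²`, whose image is dominated by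
  -- `‖f‖² v_n²`.
  let g : C(G, ℂ) := ⟨fun h => ((√(‖f‖ ^ 2 - ‖f h‖ ^ 2) : ℝ) : ℂ), by fun_prop⟩
  have hfg : star f * f + star g * g = ((‖f‖ ^ 2 : ℝ) : ℂ) • (1 : C(G, ℂ)) := by
    ext h
    have h0 : 0 ≤ ‖f‖ ^ 2 - ‖f h‖ ^ 2 :=
      sub_nonneg.2 (pow_le_pow_left₀ (norm_nonneg _) (f.norm_coe_le_norm h) 2)
    have h1 : star (f h) * f h = ((‖f h‖ ^ 2 : ℝ) : ℂ) := by
      rw [mul_comm, Complex.star_def, Complex.mul_conj, Complex.normSq_eq_norm_sq]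
    have h2 : star (g h) * g h = ((‖f‖ ^ 2 - ‖f h‖ ^ 2 : ℝ) : ℂ) := by
      change star ((√(‖f‖ ^ 2 - ‖f h‖ ^ 2) : ℝ) : ℂ) * ((√(‖f‖ ^ 2 - ‖f h‖ ^ 2) : ℝ) : ℂ) = _
      rw [Complex.star_def, Complex.conj_ofReal, ← Complex.ofReal_mul, Real.mul_self_sqrt h0]
    change star (f h) * f h + star (g h) * g h = ((‖f‖ ^ 2 : ℝ) : ℂ) * 1
    rw [h1, h2, ← Complex.ofReal_add, mul_one, add_sub_cancel]
  have h1 : star (R.cut f n) * R.cut f n + star (R.cut g n) * R.cut g n =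
      ((‖f‖ ^ 2 : ℝ) : ℂ) • toSeqAlg ((R.vD n * R.vD n : D) : A) := by
    rw [star_cut_mul_cut, star_cut_mul_cut, ← LinearMap.add_apply, ← map_add, hfg, map_smul,
      LinearMap.smul_apply, pair_one]
  have h2 : star (R.cut f n) * R.cut f n ≤
      ((‖f‖ ^ 2 : ℝ) : ℂ) • toSeqAlg ((R.vD n * R.vD n : D) : A) := by
    rw [← h1]
    exact le_add_of_nonneg_right (star_mul_self_nonneg _)
  have h3 := CStarAlgebra.norm_le_norm_of_nonneg_of_le (star_mul_self_nonneg _) h2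
  rw [CStarRing.norm_star_mul_self, norm_smul, Complex.norm_real,
    Real.norm_of_nonneg (by positivity)] at h3
  have h4 := mul_le_of_le_one_right (sq_nonneg ‖f‖) (R.norm_vD_mul_vD_le n)
  exact (sq_le_sq₀ (norm_nonneg _) (norm_nonneg _)).1 (by rw [sq ‖R.cut f n‖]; exact h3.trans h4)

theorem norm_pair_le (f : C(G, ℂ)) (d : D) : ‖R.pair f d‖ ≤ ‖f‖ * ‖d‖ := by
  have h := R.tendsto_pair f (d := fun n => R.vD n * d) (e := d) (R.tendsto_v d)
  refine le_of_tendsto h.norm (.of_forall fun n => ?_)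
  have : R.pair f (R.vD n * d) = R.cut f n * toSeqAlg (d : A) :=
    (mul_assoc (R.toFun f) (toSeqAlg (R.v n)) (toSeqAlg (d : A))).symm
  rw [this]
  exact (norm_mul_le _ _).trans (mul_le_mul (R.norm_cut_le f n) (norm_toSeqAlg_le _)
    (norm_nonneg _) (norm_nonneg _))

end Compact

/-- With `y_k = x_{√p_k} v_n`, each `y_k^* d_k y_k` lies between `± c y_k^* y_k`, and these bounds
sum to `± c v_n²`. Letting `n` tend to infinity removes `v_n`. The bound does not depend on the
number of summands. -/
theorem norm_sum_pair_le_of_isSelfAdjoint {ι : Type*} [Fintype ι] {p : ι → C(G, ℝ)}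
    (hp0 : ∀ k h, 0 ≤ p k h) (hp1 : ∀ h, ∑ k, p k h = 1) {d : ι → D}
    (hd : ∀ k, IsSelfAdjoint (d k)) {c : ℝ} (hc : 0 ≤ c) (hdc : ∀ k, ‖d k‖ ≤ c) :
    ‖∑ k, R.pair (ofRealMap (p k)) (d k)‖ ≤ 3 * c := by
  let _ : PartialOrder (SeqAlg A) := CStarAlgebra.spectralOrder _
  let _ : StarOrderedRing (SeqAlg A) := CStarAlgebra.spectralOrderedRing _
  let q : ι → C(G, ℂ) := fun k => ofRealMap ⟨fun h => √(p k h), by fun_prop⟩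
  have hq : ∀ k, star (q k) * q k = ofRealMap (p k) := fun k => by
    ext h
    change star ((√(p k h) : ℝ) : ℂ) * ((√(p k h) : ℝ) : ℂ) = ((p k h : ℝ) : ℂ)
    rw [Complex.star_def, Complex.conj_ofReal, ← Complex.ofReal_mul, Real.mul_self_sqrt (hp0 k h)]
  have hsum : ∑ k, ofRealMap (p k) = 1 := by
    ext h
    rw [ContinuousMap.sum_apply]
    simp only [ofRealMap_apply, ContinuousMap.one_apply]
    exact_mod_cast hp1 h
  have hlim : Tendsto (fun n => ∑ k, R.pair (ofRealMap (p k)) (R.vD n * (d k * R.vD n))) atTop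
      (𝓝 (∑ k, R.pair (ofRealMap (p k)) (d k))) := by
    refine tendsto_finsetSum _ fun k _ => R.tendsto_pair _ ?_
    have h1 := R.tendsto_v' (d k)
    have h2 : Tendsto (fun n => R.v n * ((d k : A) * R.v n - d k)) atTop (𝓝 0) := by
      have h3 := tendsto_iff_norm_sub_tendsto_zero.1 h1
      refine squeeze_zero_norm (fun n => ?_) h3
      exact (norm_mul_le _ _).trans (mul_le_of_le_one_left (norm_nonneg _) (R.norm_v n))
    have h3 := h2.add (R.tendsto_v (d k))
    rw [zero_add] at h3
    refine h3.congr fun n => ?_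
    rw [mul_sub, sub_add_cancel]
    rfl
  refine le_of_tendsto hlim.norm (.of_forall fun n => ?_)
  have hconj : ∀ k (e : D), star (R.cut (q k) n) * toSeqAlg (e : A) * R.cut (q k) n =
      R.pair (ofRealMap (p k)) (R.vD n * (e * R.vD n)) := fun k e => by
    rw [mul_assoc, cut, toSeqAlg_mul_pair]
    change star (R.cut (q k) n) * _ = _
    rw [star_cut_mul_pair, hq]
  have hle : ∀ k (e : D), IsSelfAdjoint e → ‖e‖ ≤ c →
      R.pair (ofRealMap (p k)) (R.vD n * (e * R.vD n)) ≤
        c • R.pair (ofRealMap (p k)) (R.vD n * R.vD n) := fun k e he hec => by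
    have hs : IsSelfAdjoint (toSeqAlg (e : A)) := by
      rw [isSelfAdjoint_iff, ← toSeqAlg_star]
      exact congrArg (fun z : D => toSeqAlg (z : A)) he.star_eq
    have h1 := CStarAlgebra.star_left_conjugate_le_norm_smul (a := R.cut (q k) n) hs
    rw [hconj] at h1
    rw [← hq, ← star_cut_mul_cut, hq]
    refine h1.trans (smul_le_smul_of_nonneg_right ((norm_toSeqAlg_le _).trans hec)
      (star_mul_self_nonneg _))
  have hB : ∑ k, c • R.pair (ofRealMap (p k)) (R.vD n * R.vD n) =
      c • toSeqAlg ((R.vD n * R.vD n : D) : A) := by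
    rw [← Finset.smul_sum, ← LinearMap.sum_apply, ← map_sum, hsum, pair_one]
  have hnorm : ‖c • toSeqAlg ((R.vD n * R.vD n : D) : A)‖ ≤ c := by
    rw [norm_smul, Real.norm_of_nonneg hc]
    exact mul_le_of_le_one_right hc (R.norm_vD_mul_vD_le n)
  refine (norm_le_three_mul_of_le_of_neg_le (b := c • toSeqAlg ((R.vD n * R.vD n : D) : A))
    ?_ ?_).trans (by linarith)
  · rw [← hB]
    exact Finset.sum_le_sum fun k _ => hle k (d k) (hd k) (hdc k)
  · rw [← hB, ← Finset.sum_neg_distrib]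
    refine Finset.sum_le_sum fun k _ => ?_
    have := hle k (-(d k)) (hd k).neg (by rw [norm_neg]; exact hdc k)
    rwa [neg_mul, mul_neg, map_neg] at this

theorem norm_sum_pair_le {ι : Type*} [Fintype ι] {p : ι → C(G, ℝ)}
    (hp0 : ∀ k h, 0 ≤ p k h) (hp1 : ∀ h, ∑ k, p k h = 1) {d : ι → D} {c : ℝ} (hc : 0 ≤ c)
    (hdc : ∀ k, ‖d k‖ ≤ c) : ‖∑ k, R.pair (ofRealMap (p k)) (d k)‖ ≤ 6 * c := by
  -- Real and imaginary parts `a`, `b` of the coefficients each contribute `3 * c`.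
  have hsn : ∀ e : D, ‖star e‖ = ‖e‖ := fun e => norm_star (e : A)
  let a : ι → D := fun k => (2⁻¹ : ℂ) • (d k + star (d k))
  let b : ι → D := fun k => (-(2⁻¹ : ℂ) * Complex.I) • (d k - star (d k))
  have ha : ∀ k, IsSelfAdjoint (a k) := fun k => by
    rw [isSelfAdjoint_iff]
    simp only [a, star_smul, star_add, star_star, add_comm (star (d k))]
    simp
  have hb : ∀ k, IsSelfAdjoint (b k) := fun k => by
    rw [isSelfAdjoint_iff]
    simp only [b, star_smul, star_sub, star_star]
    rw [← neg_sub, smul_neg, ← neg_smul]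
    congr 1
    simp
  have hab : ∀ k, d k = a k + Complex.I • b k := fun k => by
    simp only [a, b, smul_smul]
    have : Complex.I * (-(2⁻¹ : ℂ) * Complex.I) = 2⁻¹ := by
      linear_combination (-(2⁻¹ : ℂ)) * Complex.I_mul_I
    rw [this]
    module
  have hna : ∀ k, ‖a k‖ ≤ c := fun k => by
    have := norm_add_le (d k) (star (d k))
    rw [hsn] at this
    simp only [a, norm_smul, norm_inv, Complex.norm_ofNat]
    linarith [hdc k]
  have hnb : ∀ k, ‖b k‖ ≤ c := fun k => by
    have := norm_sub_le (d k) (star (d k))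
    rw [hsn] at this
    simp only [b, norm_smul, norm_mul, norm_neg, norm_inv, Complex.norm_ofNat, Complex.norm_I]
    linarith [hdc k]
  have e : ∑ k, R.pair (ofRealMap (p k)) (d k) = ∑ k, R.pair (ofRealMap (p k)) (a k) +
      Complex.I • ∑ k, R.pair (ofRealMap (p k)) (b k) := by
    rw [Finset.smul_sum, ← Finset.sum_add_distrib]
    refine Finset.sum_congr rfl fun k _ => ?_
    rw [← map_smul, ← map_add, ← hab]
  rw [e]
  refine (norm_add_le _ _).trans ?_
  rw [norm_smul, Complex.norm_I]
  linarith [R.norm_sum_pair_le_of_isSelfAdjoint hp0 hp1 ha hc hna,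
    R.norm_sum_pair_le_of_isSelfAdjoint hp0 hp1 hb hc hnb]

end RokhlinLift

/-! ### Extension to `C(G, D)`, equivariance, and the homomorphism into the fixed points -/

namespace RokhlinLift

section Extension

open scoped TensorProduct

set_option linter.unusedSectionVars false

variable {G A : Type*} [Group G] [TopologicalSpace G] [IsTopologicalGroup G] [CompactSpace G]
  [T2Space G] [NonUnitalCStarAlgebra A] {α : CStarAction G A} {D : NonUnitalStarSubalgebra ℂ A}

/-- The function `h ↦ f(h) d`. -/
def elem (D : NonUnitalStarSubalgebra ℂ A) : C(G, ℂ) →ₗ[ℂ] D →ₗ[ℂ] C(G, D) :=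
  LinearMap.mk₂ ℂ (fun f d => (⟨fun h => f h • d, by fun_prop⟩ : C(G, D)))
    (fun f g d => by ext1 h; exact add_smul (f h) (g h) d)
    (fun z f d => by ext1 h; exact mul_smul z (f h) d)
    (fun f d e => by ext1 h; exact smul_add (f h) d e)
    (fun z f d => by ext1 h; exact smul_comm (f h) z d)

/-- The linear map `f ⊗ d ↦ f d`. -/
def simple (D : NonUnitalStarSubalgebra ℂ A) : C(G, ℂ) ⊗[ℂ] D →ₗ[ℂ] C(G, D) :=
  TensorProduct.lift (elem D)

theorem denseRange_simple :
    Dense ((LinearMap.range (simple (G := G) D) : Submodule ℂ C(G, D)) : Set C(G, D)) := by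
  intro F
  rw [Metric.mem_closure_iff]
  intro ε hε
  obtain ⟨n, p, y, hp0, hp1, hp⟩ := exists_partition_of_unity F (half_pos hε)
  refine ⟨_, ⟨∑ k, ofRealMap (p k) ⊗ₜ F (y k), rfl⟩, ?_⟩
  rw [dist_eq_norm]
  refine lt_of_le_of_lt ?_ (half_lt_self hε)
  rw [ContinuousMap.norm_le _ (half_pos hε).le]
  intro h
  rw [map_sum, ContinuousMap.sub_apply, ContinuousMap.sum_apply]
  exact norm_sub_sum_smul_le (hp0 · h) (hp1 h) fun k hk => (hp k h hk).le

variable (R : RokhlinLift α D)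

/-- The linear map `f ⊗ d ↦ x_f d`. -/
def lin : C(G, ℂ) ⊗[ℂ] D →ₗ[ℂ] SeqAlg A := TensorProduct.lift R.pair

/-- The tensor is replaced by `∑ p_k ⊗ F(y_k)`, for which the partition-of-unity estimate gives the
constant 6. The error is controlled by `norm_pair_le` and becomes arbitrarily small. -/
theorem norm_lin_le (t : C(G, ℂ) ⊗[ℂ] D) : ‖R.lin t‖ ≤ 6 * ‖simple D t‖ := by
  obtain ⟨S, rfl⟩ := TensorProduct.exists_finset t
  set F := simple D (∑ i ∈ S, i.1 ⊗ₜ i.2) with hF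
  have hFh : ∀ h, F h = ∑ i ∈ S, i.1 h • i.2 := fun h => by
    rw [hF, map_sum, ContinuousMap.sum_apply]
    rfl
  refine le_of_forall_pos_le_add fun δ hδ => ?_
  let M : ℝ := ∑ i ∈ S, ‖i.2‖
  have hM : 0 ≤ M := Finset.sum_nonneg fun _ _ => norm_nonneg _
  let ε := δ / (M + 1)
  have hε : 0 < ε := by positivity
  -- All scalar factors at once, so that one partition approximates each of them.
  let Φ : C(G, S → ℂ) := ⟨fun h i => i.1.1 h, by fun_prop⟩
  obtain ⟨n, p, y, hp0, hp1, hp⟩ := exists_partition_of_unity Φ hε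
  have e : R.lin (∑ i ∈ S, i.1 ⊗ₜ i.2) = ∑ k, R.pair (ofRealMap (p k)) (F (y k)) +
      ∑ i ∈ S, R.pair (i.1 - ∑ k, i.1 (y k) • ofRealMap (p k)) i.2 := by
    have e1 : ∀ i : C(G, ℂ) × D, R.pair (i.1 - ∑ k, i.1 (y k) • ofRealMap (p k)) i.2 =
        R.pair i.1 i.2 - ∑ k, i.1 (y k) • R.pair (ofRealMap (p k)) i.2 := fun i => by
      simp only [map_sub, map_sum, map_smul, LinearMap.sub_apply, LinearMap.sum_apply,
        LinearMap.smul_apply]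
    have e2 : ∀ k, R.pair (ofRealMap (p k)) (F (y k)) =
        ∑ i ∈ S, i.1 (y k) • R.pair (ofRealMap (p k)) i.2 := fun k => by
      rw [hFh, map_sum]
      simp only [map_smul]
    simp only [e1, e2, Finset.sum_sub_distrib]
    rw [Finset.sum_comm, add_sub_cancel, map_sum]
    rfl
  rw [e]
  refine (norm_add_le _ _).trans (add_le_add ?_ ?_)
  · exact R.norm_sum_pair_le hp0 hp1 (norm_nonneg F) fun k => F.norm_coe_le_norm _
  · calc _ ≤ ∑ i ∈ S, ‖R.pair (i.1 - ∑ k, i.1 (y k) • ofRealMap (p k)) i.2‖ := norm_sum_le _ _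
      _ ≤ ∑ i ∈ S, ε * ‖i.2‖ := Finset.sum_le_sum fun i hi => by
          refine (R.norm_pair_le _ _).trans (mul_le_mul_of_nonneg_right ?_ (norm_nonneg _))
          rw [ContinuousMap.norm_le _ hε.le]
          intro h
          have h1 : ‖i.1 h - ∑ k, p k h • i.1 (y k)‖ ≤ ε :=
            norm_sub_sum_smul_le (hp0 · h) (hp1 h) fun k hk =>
              (norm_le_pi_norm (Φ h - Φ (y k)) ⟨i, hi⟩).trans (hp k h hk).le
          rw [ContinuousMap.sub_apply, ContinuousMap.sum_apply]
          have h2 : ∀ k, (i.1 (y k) • ofRealMap (p k)) h = p k h • i.1 (y k) := fun k =>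
            mul_comm (i.1 (y k)) (p k h : ℂ)
          simpa only [h2] using h1
      _ = ε * M := by rw [← Finset.mul_sum]
      _ ≤ δ := by
          rw [div_mul_eq_mul_div, div_le_iff₀ (by positivity)]
          nlinarith

/-- The norm estimate makes `R.lin t` depend only on the function represented by `t`; injectivity of
`simple` is not required. -/
theorem ker_simple_le : LinearMap.ker (simple (G := G) D) ≤ LinearMap.ker R.lin := fun t ht => by
  have h := R.norm_lin_le t
  rw [LinearMap.mem_ker.1 ht, norm_zero, mul_zero] at h
  exact norm_le_zero_iff.1 h

/-- `f d ↦ x_f d`, as a linear map on the span of the functions `f d`. -/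
def linOnRange : LinearMap.range (simple (G := G) D) →ₗ[ℂ] SeqAlg A :=
  ((LinearMap.ker (simple (G := G) D)).liftQ R.lin R.ker_simple_le).comp
    (simple (G := G) D).quotKerEquivRange.symm.toLinearMap

theorem linOnRange_apply (t : C(G, ℂ) ⊗[ℂ] D) :
    R.linOnRange ⟨simple D t, t, rfl⟩ = R.lin t := by
  have : (simple (G := G) D).quotKerEquivRange.symm ⟨simple D t, t, rfl⟩ =
      Submodule.Quotient.mk t :=
    (simple (G := G) D).quotKerEquivRange.symm_apply_apply (Submodule.Quotient.mk t)
  rw [linOnRange, LinearMap.comp_apply, LinearEquiv.coe_coe, this]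
  rfl

/-- `f d ↦ x_f d`, as a bounded map on the span of the functions `f d`. -/
def onRange : LinearMap.range (simple (G := G) D) →L[ℂ] SeqAlg A :=
  LinearMap.mkContinuous R.linOnRange 6 (by
    rintro ⟨_, t, rfl⟩
    rw [linOnRange_apply]
    exact R.norm_lin_le t)

theorem onRange_apply (t : C(G, ℂ) ⊗[ℂ] D) : R.onRange ⟨simple D t, t, rfl⟩ = R.lin t :=
  R.linOnRange_apply t

/-- The homomorphism `T : C(G, D) → A_∞` with `T(f d) = x_f d`. -/
def T : C(G, D) →L[ℂ] SeqAlg A :=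
  R.onRange.extend (LinearMap.range (simple (G := G) D)).subtypeL

theorem T_simple (t : C(G, ℂ) ⊗[ℂ] D) : R.T (simple D t) = R.lin t := by
  rw [← onRange_apply]
  exact ContinuousLinearMap.extend_eq R.onRange
    (e := (LinearMap.range (simple (G := G) D)).subtypeL) denseRange_simple.denseRange_val
    (IsUniformEmbedding.isUniformInducing isUniformEmbedding_subtype_val) ⟨simple D t, t, rfl⟩

theorem T_elem (f : C(G, ℂ)) (d : D) : R.T (elem D f d) = R.toFun f * toSeqAlg (d : A) :=
  R.T_simple (f ⊗ₜ d)

theorem norm_T_le (F : C(G, D)) : ‖R.T F‖ ≤ 6 * ‖F‖ := by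
  refine denseRange_simple.induction (P := fun F => ‖R.T F‖ ≤ 6 * ‖F‖) ?_
    (isClosed_le (by fun_prop) (by fun_prop)) F
  rintro _ ⟨t, rfl⟩
  rw [T_simple]
  exact R.norm_lin_le t

theorem ind {P : C(G, D) → Prop} (hc : IsClosed {F | P F}) (hadd : ∀ F F', P F → P F' → P (F + F'))
    (h : ∀ f d, P (elem D f d)) (F : C(G, D)) : P F := by
  refine denseRange_simple.induction (P := P) ?_ hc F
  rintro _ ⟨t, rfl⟩
  induction t using TensorProduct.induction_on with
  | zero => rw [map_zero, ← map_zero (elem D (0 : C(G, ℂ)))]; exact h 0 0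
  | tmul f d => exact h f d
  | add t u ht hu => rw [map_add]; exact hadd _ _ ht hu

theorem continuous_smul_left (f : C(G, ℂ)) : Continuous fun F : C(G, D) => f • F :=
  ContinuousMap.continuous_of_continuous_uncurry _
    ((f.continuous.comp continuous_snd).smul (continuous_fst.eval continuous_snd))

/-- Although `f ↦ x_f` is not multiplicative itself, the `x_f` act on the range of `T` as
multipliers. -/
theorem toFun_mul_T (f : C(G, ℂ)) (F : C(G, D)) : R.toFun f * R.T F = R.T (f • F) := by
  induction F using ind with
  | hc =>
    have := continuous_smul_left (D := D) (f)
    exact isClosed_eq (by fun_prop) (by fun_prop)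
  | hadd F F' h h' => rw [map_add, mul_add, h, h', smul_add, map_add]
  | h g d =>
    have : f • elem D g d = elem D (f * g) d := by ext1 h; exact smul_smul _ _ _
    rw [this, T_elem, T_elem, R.toFun_mul _ _ d d.2]

theorem star_toFun_mul_T (f : C(G, ℂ)) (F : C(G, D)) :
    star (R.toFun f) * R.T F = R.T (star f • F) := by
  induction F using ind with
  | hc =>
    have := continuous_smul_left (D := D) (star f)
    exact isClosed_eq (by fun_prop) (by fun_prop)
  | hadd F F' h h' => rw [map_add, mul_add, h, h', smul_add, map_add]
  | h g d =>
    have : star f • elem D g d = elem D (star f * g) d := by ext1 h; exact smul_smul _ _ _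
    rw [this, T_elem, T_elem]
    exact R.star_mul_pair f g d

theorem T_mul (F F' : C(G, D)) : R.T (F * F') = R.T F * R.T F' := by
  induction F using ind with
  | hc => exact isClosed_eq (by fun_prop) (by fun_prop)
  | hadd F₁ F₂ h h' => rw [add_mul, map_add, h, h', map_add, add_mul]
  | h f d =>
    induction F' using ind with
    | hc => exact isClosed_eq (by fun_prop) (by fun_prop)
    | hadd F₁ F₂ h h' => rw [mul_add, map_add, h, h', map_add, mul_add]
    | h g e =>
      have : elem D f d * elem D g e = elem D (f * g) (d * e) := by
        ext1 h; exact smul_mul_smul_comm _ _ _ _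
      rw [this, T_elem, T_elem, T_elem, R.toFun_mul _ _ _ (d * e).2]
      change _ * (_ * (toSeqAlg (d : A) * toSeqAlg (e : A))) = _
      rw [← mul_assoc (R.toFun g), R.comm g d d.2]
      simp only [mul_assoc]

theorem continuous_star_map : Continuous (star : C(G, D) → C(G, D)) :=
  ContinuousMap.continuous_of_continuous_uncurry _ (continuous_fst.eval continuous_snd).star

theorem T_star (F : C(G, D)) : R.T (star F) = star (R.T F) := by
  induction F using ind with
  | hc => exact isClosed_eq (R.T.continuous.comp continuous_star_map) R.T.continuous.star
  | hadd F₁ F₂ h h' => rw [star_add, map_add, h, h', map_add, star_add]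
  | h f d =>
    have : star (elem D f d) = elem D (star f) (star d) := by
      ext1 h; exact star_smul _ _
    rw [this, T_elem, T_elem, R.toFun_star _ _ (star d).2, star_mul,
      R.star_comm f (star d).2]
    rfl

theorem T_const (d : D) : R.T (ContinuousMap.const G d) = toSeqAlg (d : A) := by
  have : ContinuousMap.const G d = elem D 1 d := by ext1 h; exact (one_smul ℂ d).symm
  rw [this, T_elem, R.toFun_one d d.2]

theorem toSeqAlg_mem_contSeqAlg (a : A) : toSeqAlg a ∈ α.contSeqAlg := by
  refine ⟨constSeq A a, ?_, rfl⟩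
  change Continuous fun g => α.bddSeqMap g (constSeq A a)
  exact continuous_constSeq.comp (α.continuous_apply a)

theorem T_mem (F : C(G, D)) : R.T F ∈ α.contSeqAlg := by
  induction F using ind with
  | hc => exact α.isClosed_contSeqAlg.preimage R.T.continuous
  | hadd F₁ F₂ h h' => rw [map_add]; exact add_mem h h'
  | h f d =>
    rw [T_elem]
    exact mul_mem (R.mem_cont f) (toSeqAlg_mem_contSeqAlg _)

/-- The translate `h ↦ α_g(F(g⁻¹h))`. -/
def translate (g : G) (F : C(G, D)) : C(G, D) :=
  ⟨fun h => ⟨α.toHom g (F (g⁻¹ * h)), R.isInvariant g _ (F (g⁻¹ * h)).2⟩,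
    (α.continuous_uncurry.comp (continuous_const.prodMk
      (continuous_subtype_val.comp (F.continuous.comp (by fun_prop))))).subtype_mk _⟩

theorem translate_apply (g : G) (F : C(G, D)) (h : G) :
    (R.translate g F h : A) = α.toHom g (F (g⁻¹ * h)) := rfl

theorem continuous_translate (g : G) : Continuous (R.translate g) := by
  refine ContinuousMap.continuous_of_continuous_uncurry _ ?_
  refine Continuous.subtype_mk (α.continuous_uncurry.comp (continuous_const.prodMk ?_)) _
  exact continuous_subtype_val.comp (continuous_fst.eval (by fun_prop))

theorem map_T (g : G) (F : C(G, D)) : α.seqAlgMap g (R.T F) = R.T (R.translate g F) := by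
  induction F using ind with
  | hc =>
    exact isClosed_eq ((α.continuous_seqAlgMap g).comp R.T.continuous)
      (R.T.continuous.comp (R.continuous_translate g))
  | hadd F₁ F₂ h h' =>
    have : R.translate g (F₁ + F₂) = R.translate g F₁ + R.translate g F₂ := by
      ext h; exact map_add (α.toHom g) _ _
    rw [this, map_add, map_add, h, h', map_add]
  | h f d =>
    have : R.translate g (elem D f d) = elem D (CStarAction.leftTranslate g f)
        ⟨α.toHom g d, R.isInvariant g _ d.2⟩ := by
      ext h; exact map_smul (α.toHom g) _ _
    rw [this, T_elem, T_elem, map_mul, α.seqAlgMap_toSeqAlg]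
    exact R.toFun_map g f _ (R.isInvariant g _ d.2)

/-- The function `h ↦ α_h(d)`. -/
def orbit (d : D) : C(G, D) :=
  ⟨fun h => ⟨α.toHom h d, R.isInvariant h _ d.2⟩, (α.continuous_apply (d : A)).subtype_mk _⟩

theorem orbit_apply (d : D) (h : G) : (R.orbit d h : A) = α.toHom h d := rfl

/-- The homomorphism `D → A_∞` with values in the fixed points, `d ↦ T(h ↦ α_h(d))`. -/
def Ψ : D →⋆ₙₐ[ℂ] SeqAlg A where
  toFun d := R.T (R.orbit d)
  map_smul' z d := by
    rw [← map_smul]; congr 1; ext h; exact map_smul (α.toHom h) z (d : A)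
  map_zero' := by
    rw [← map_zero R.T]; congr 1; ext h; exact map_zero (α.toHom h)
  map_add' d e := by
    rw [← map_add]; congr 1; ext h; exact map_add (α.toHom h) (d : A) e
  map_mul' d e := by
    rw [← T_mul]; congr 1; ext h; exact map_mul (α.toHom h) (d : A) e
  map_star' d := by
    rw [← T_star]; congr 1; ext h; exact map_star (α.toHom h) (d : A)

theorem Ψ_apply (d : D) : R.Ψ d = R.T (R.orbit d) := rfl

theorem norm_Ψ_le (d : D) : ‖R.Ψ d‖ ≤ 6 * ‖d‖ := by
  refine (R.norm_T_le _).trans (mul_le_mul_of_nonneg_left ?_ (by norm_num))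
  rw [ContinuousMap.norm_le _ (norm_nonneg d)]
  exact fun h => (α.norm_apply h (d : A)).le

/-- The orbit function is invariant: `α_g(α_{g⁻¹h}(d)) = α_h(d)`. -/
theorem map_Ψ (g : G) (d : D) : α.seqAlgMap g (R.Ψ d) = R.Ψ d := by
  rw [Ψ_apply, map_T]
  congr 1
  ext h
  rw [translate_apply, orbit_apply, orbit_apply, ← α.mul_apply, mul_inv_cancel_left]

theorem Ψ_of_fixed (d : D) (hd : ∀ g, α.toHom g d = d) : R.Ψ d = toSeqAlg (d : A) := by
  rw [Ψ_apply, ← R.T_const]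
  congr 1
  ext h
  exact hd h

theorem Ψ_mem (d : D) : R.Ψ d ∈ α.contSeqAlg := R.T_mem _

end Extension

end RokhlinLift

/-! ### Fixed point algebras -/

section FixedPoints

set_option linter.unusedSectionVars false

variable {G A : Type*} [Group G] [TopologicalSpace G] [IsTopologicalGroup G] [CompactSpace G]
  [T2Space G] [SecondCountableTopology G] [MeasurableSpace G] [BorelSpace G]
  [NonUnitalCStarAlgebra A] (α : CStarAction G A)

namespace CStarAction

/-- The termwise average of a sequence. -/
def averageSeq (a : BddSeq A) : BddSeq A := ∫ g, α.bddSeqMap g a ∂(normHaar G)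

variable {α}

theorem averageSeq_apply {a : BddSeq A} (ha : a ∈ α.contBddSeq) (n : ℕ) :
    α.averageSeq a n = α.average (a n) := by
  have h := (BddSeq.evalL A n).integral_comp_comm
    (ConvAlg.integrable_of_continuous (G := G) (f := fun g => α.bddSeqMap g a) ha)
  exact h.symm

theorem seqMk_averageSeq {a : BddSeq A} (ha : a ∈ α.contBddSeq) :
    seqMk (α.averageSeq a) = ∫ g, α.seqAlgMap g (seqMk a) ∂(normHaar G) := by
  have h := (seqMkL A).integral_comp_comm
    (ConvAlg.integrable_of_continuous (G := G) (f := fun g => α.bddSeqMap g a) ha)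
  exact h.symm

end CStarAction

variable {α}

/-- A fixed element of `A_{∞,α}` lifts to a sequence in the fixed point algebra. -/
theorem CStarAction.exists_fixed_lift {x : SeqAlg A} (hx : x ∈ α.contSeqAlg)
    (hfix : ∀ g, α.seqAlgMap g x = x) :
    ∃ b : ℕ → α.fixedPoints, ∃ b' : BddSeq A, seqMk b' = x ∧ ∀ n, (b n : A) = b' n := by
  obtain ⟨a, ha, rfl⟩ := hx
  -- Evaluation and quotient map commute with the vector-valued integral, so the terms are averages
  -- in `A` and the class is the integral of the constant `x`.
  refine ⟨fun n => ⟨α.averageSeq a n, fun g => ?_⟩, α.averageSeq a, ?_, fun n => rfl⟩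
  · rw [averageSeq_apply ha, α.apply_average]
  · rw [seqMk_averageSeq ha]
    change ∫ g, α.seqAlgMap g (seqMk a) ∂(normHaar G) = seqMk a
    have : ∀ g, α.seqAlgMap g (seqMk a) = seqMk a := hfix
    simp [this]

/-- The invariant approximate unit is adjoined to `S` before the separable subalgebra is formed. -/
theorem CStarAction.HasRokhlinProperty.exists_lift (hA : IsSigmaUnital A)
    (hα : α.HasRokhlinProperty) {S : Set A} (hS : TopologicalSpace.IsSeparable S) :
    ∃ D : NonUnitalStarSubalgebra ℂ A, S ⊆ D ∧ Nonempty (RokhlinLift α D) := by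
  obtain ⟨v, h1, h2, h3, h4⟩ := hA.exists_invariant α
  obtain ⟨D, hD, hDc, hDs, hSD⟩ := α.exists_invariant_subalgebra
    (hS.union (Set.countable_range v).isSeparable)
  exact ⟨D, Set.subset_union_left.trans hSD, hα.nonempty_lift hD hDc hDs
    (fun n => hSD (Or.inr ⟨n, rfl⟩)) h1 h2 h3 h4⟩

theorem tendsto_zero_of_seqMk_eq_zero {B : Type*} [NonUnitalCStarAlgebra B] {f : ℕ → B}
    {a : BddSeq A} (h : seqMk a = 0) (hf : ∀ n, ‖f n‖ ≤ ‖a n‖) : Tendsto f atTop (𝓝 0) :=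
  squeeze_zero_norm hf (seqMk_eq_zero_iff.1 h)

/-- `Ψ` carries a quasiregular approximant and its quasi-inverse to classes of sequences in `A^α`,
while leaving `a` in place. -/
theorem QuasiDense.fixedPoints {sa : Prop} (h : QuasiDense sa A) (hA : IsSigmaUnital A)
    (hα : α.HasRokhlinProperty) : QuasiDense sa α.fixedPoints := by
  intro a ha ε hε
  -- The tolerance `ε / 12` becomes `ε / 2` under `Ψ`, whose norm is at most 6.
  obtain ⟨b, hb, hab, hbq⟩ := h a (fun s => by
    rw [isSelfAdjoint_iff]; exact congrArg Subtype.val (ha s).star_eq) (ε / 12) (by positivity)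
  obtain ⟨c, h1, h2⟩ := isQuasiregular_iff_exists.1 hbq
  obtain ⟨D, hSD, ⟨R⟩⟩ := hα.exists_lift hA (S := {(a : A), b, c})
    (Set.Finite.countable (by simp)).isSeparable
  let aD : D := ⟨a, hSD (by simp)⟩
  let bD : D := ⟨b, hSD (by simp)⟩
  let cD : D := ⟨c, hSD (by simp)⟩
  obtain ⟨u, u', hu, huu⟩ := CStarAction.exists_fixed_lift (R.Ψ_mem bD) (fun g => R.map_Ψ g bD)
  obtain ⟨w, w', hw, hww⟩ := CStarAction.exists_fixed_lift (R.Ψ_mem cD) (fun g => R.map_Ψ g cD)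
  have e1 : bD + cD + bD * cD = 0 := Subtype.ext h1
  have e2 : bD + cD + cD * bD = 0 := Subtype.ext h2
  refine exists_isQuasiregular_near (ε := ε / 2) (b := u) (c := w) ?_ ?_ ?_ ?_
    (K := ‖w'‖) (fun n => ?_) (half_lt_self hε)
  · have h3 : ‖seqMk (u' - constSeq A a)‖ < ε / 2 := by
      have h4 : seqMk (u' - constSeq A a) = R.Ψ (bD - aD) := by
        rw [map_sub, map_sub, hu, R.Ψ_of_fixed aD a.2]; rfl
      rw [h4]
      refine (R.norm_Ψ_le _).trans_lt ?_
      have h5 : ‖bD - aD‖ < ε / 12 := by rw [norm_sub_rev]; exact hab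
      linarith
    filter_upwards [eventually_norm_lt_of_norm_seqMk_lt h3] with n hn
    have h6 : ‖u n - a‖ = ‖(u' - constSeq A a) n‖ := by
      change ‖(u n : A) - a‖ = _
      rw [huu]; rfl
    rw [h6]
    exact hn.le
  · refine tendsto_zero_of_seqMk_eq_zero (a := u' + w' + u' * w') ?_ fun n => ?_
    · rw [map_add, map_add, map_mul, hu, hw, ← map_mul, ← map_add, ← map_add, e1, map_zero]
    · change ‖(u n : A) + w n + u n * w n‖ ≤ _
      rw [huu, hww]; rfl
  · refine tendsto_zero_of_seqMk_eq_zero (a := u' + w' + w' * u') ?_ fun n => ?_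
    · rw [map_add, map_add, map_mul, hu, hw, ← map_mul, ← map_add, ← map_add, e2, map_zero]
    · change ‖(u n : A) + w n + w n * u n‖ ≤ _
      rw [huu, hww]; rfl
  · intro s
    refine tendsto_zero_of_seqMk_eq_zero (a := u' - star u') ?_ fun n => ?_
    · have e3 : star bD = bD := Subtype.ext (hb s).star_eq
      rw [map_sub, map_star, hu, ← map_star, e3, sub_self]
    · change ‖(u n : A) - star (u n : A)‖ ≤ _
      rw [huu]; rfl
  · change ‖(w n : A)‖ ≤ _
    rw [hww]
    exact BddSeq.norm_apply_le w' n

end FixedPoints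

/-! ### Crossed products -/

section RankOne

set_option linter.unusedSectionVars false

variable {G A : Type*} [Group G] [TopologicalSpace G] [IsTopologicalGroup G] [CompactSpace G]
  [SecondCountableTopology G] [MeasurableSpace G] [BorelSpace G] [NonUnitalCStarAlgebra A]

namespace ConvAlg

variable (α : CStarAction G A)

/-- The element `s ↦ u α_s(v^*)` of the convolution algebra. -/
def rankOne (u v : A) : ConvAlg α :=
  (⟨fun s => u * α.toHom s (star v), continuous_const.mul (α.continuous_apply (star v))⟩ : C(G, A))

theorem rankOne_apply (u v : A) (s : G) : rankOne α u v s = u * α.toHom s (star v) := rfl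

/-- In the convolution integral the last factor `α_s(z^*)` does not depend on `r`, and what remains
is the average of `v^* w`. -/
theorem rankOne_mul_rankOne (u v w z : A) :
    rankOne α u v * rankOne α w z = rankOne α (u * α.average (star v * w)) z := by
  ext s
  have hc : Continuous fun r => α.toHom r (star v * w) := α.continuous_apply _
  rw [mul_apply, rankOne_apply, CStarAction.average, integral_mul_left' u hc,
    integral_mul_right' (f := fun r => u * α.toHom r (star v * w)) _ (continuous_const.mul hc)]
  congr 1
  ext r
  rw [rankOne_apply, rankOne_apply, map_mul (α.toHom r), map_mul (α.toHom r), ← α.mul_apply,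
    mul_inv_cancel_left]
  simp only [mul_assoc]

theorem star_rankOne (u v : A) : star (rankOne α u v) = rankOne α v u := by
  ext s
  rw [star_apply, rankOne_apply, rankOne_apply, star_mul, map_mul, ← map_star, star_star,
    ← α.mul_apply, mul_inv_cancel, α.one_apply]

variable {α}

/-- Evaluation at a point, as an additive map. -/
def evalHom (s : G) : ConvAlg α →+ A where
  toFun f := f s
  map_zero' := rfl
  map_add' _ _ := rfl

/-- The Haar measure is a probability measure, so the supremum norm dominates the `L¹`-norm and
hence the universal norm. -/
theorem norm_of_le {f : ConvAlg α} {r : ℝ} (h : ∀ s, ‖f s‖ ≤ r) : ‖CrossedProduct.of f‖ ≤ r := by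
  rw [CrossedProduct.norm_of]
  refine ciSup_le fun p => (p.le_l1Norm f).trans ?_
  calc l1Norm f ≤ ∫ _s : G, r ∂(normHaar G) :=
        integral_mono (integrable_of_continuous f.continuous.norm) (integrable_const r) h
    _ = r := by simp

end ConvAlg

end RankOne

/-! ### Convolution algebra with coefficients in sequences, and termwise evaluation -/

namespace CStarAction

section SeqAction

set_option linter.unusedSectionVars false

variable {G A : Type*} [Group G] [TopologicalSpace G] [IsTopologicalGroup G]
  [NonUnitalCStarAlgebra A] (α : CStarAction G A)

theorem bddSeqMap_mem (g : G) {a : BddSeq A} (ha : a ∈ α.contBddSeq) :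
    α.bddSeqMap g a ∈ α.contBddSeq := by
  change Continuous fun h => α.bddSeqMap h (α.bddSeqMap g a)
  simp only [← bddSeqMap_mul]
  exact Continuous.comp (g := fun h => α.bddSeqMap h a) ha (continuous_mul_const g)

/-- The automorphism of `ℓ^∞_α(ℕ, A)` that applies `α_g` in every coordinate. -/
def seqEquiv (g : G) : α.contBddSeq ≃⋆ₐ[ℂ] α.contBddSeq where
  toFun a := ⟨α.bddSeqMap g a, α.bddSeqMap_mem g a.2⟩
  invFun a := ⟨α.bddSeqMap g⁻¹ a, α.bddSeqMap_mem g⁻¹ a.2⟩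
  left_inv a := Subtype.ext (by
    change α.bddSeqMap g⁻¹ (α.bddSeqMap g a) = a
    rw [← bddSeqMap_mul, inv_mul_cancel, bddSeqMap_one])
  right_inv a := Subtype.ext (by
    change α.bddSeqMap g (α.bddSeqMap g⁻¹ a) = a
    rw [← bddSeqMap_mul, mul_inv_cancel, bddSeqMap_one])
  map_mul' a b := Subtype.ext (map_mul (α.bddSeqMap g) (a : BddSeq A) b)
  map_add' a b := Subtype.ext (map_add (α.bddSeqMap g) (a : BddSeq A) b)
  map_star' a := Subtype.ext (map_star (α.bddSeqMap g) (a : BddSeq A))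
  map_smul' z a := Subtype.ext (map_smul (α.bddSeqMap g) z (a : BddSeq A))

/-- The action of `G` on `ℓ^∞_α(ℕ, A)`. -/
def seqAction : CStarAction G α.contBddSeq where
  toHom :=
    { toFun := α.seqEquiv
      map_one' := by ext1 a; exact Subtype.ext (α.bddSeqMap_one a)
      map_mul' := fun g h => by ext1 a; exact Subtype.ext (α.bddSeqMap_mul g h a) }
  continuous_apply a := Continuous.subtype_mk a.2 _

/-- The class of a sequence in `ℓ^∞_α(ℕ, A)`. -/
def contMk : α.contBddSeq →⋆ₙₐ[ℂ] SeqAlg A :=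
  seqMk.comp (NonUnitalStarSubalgebraClass.subtype α.contBddSeq)

theorem contMk_seqAction (g : G) (a : α.contBddSeq) :
    α.contMk (α.seqAction.toHom g a) = α.seqAlgMap g (α.contMk a) := rfl

theorem exists_contMk_eq {x : SeqAlg A} (hx : x ∈ α.contSeqAlg) : ∃ a, α.contMk a = x := by
  obtain ⟨a, ha, rfl⟩ := hx
  exact ⟨⟨a, ha⟩, rfl⟩

/-- Evaluation of sequences, as a continuous linear map. -/
def contEvalL (n : ℕ) : α.contBddSeq →L[ℂ] A :=
  LinearMap.mkContinuous
    { toFun := fun a => (a : BddSeq A) n, map_add' := fun _ _ => rfl, map_smul' := fun _ _ => rfl }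
    1 fun a => by rw [one_mul]; exact BddSeq.norm_apply_le (a : BddSeq A) n

/-- The quotient map, as a continuous linear map. -/
def contMkL : α.contBddSeq →L[ℂ] SeqAlg A :=
  LinearMap.mkContinuous
    { toFun := α.contMk, map_add' := map_add α.contMk, map_smul' := map_smul α.contMk }
    1 fun a => by rw [one_mul]; exact norm_seqMk_le (a : BddSeq A)

variable [CompactSpace G] [SecondCountableTopology G] [MeasurableSpace G] [BorelSpace G]

theorem contMk_average (a : α.contBddSeq) :
    α.contMk (α.seqAction.average a) = ∫ g, α.seqAlgMap g (α.contMk a) ∂(normHaar G) :=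
  (α.contMkL.integral_comp_comm
    (ConvAlg.integrable_of_continuous (α.seqAction.continuous_apply a))).symm

variable {α}

/-- Termwise evaluation of functions with values in sequences. -/
def evalConv (n : ℕ) (K : ConvAlg α.seqAction) : ConvAlg α :=
  (⟨fun s => (K s : BddSeq A) n, (α.contEvalL n).continuous.comp K.continuous⟩ : C(G, A))

theorem evalConv_apply (n : ℕ) (K : ConvAlg α.seqAction) (s : G) :
    evalConv n K s = (K s : BddSeq A) n := rfl

theorem evalConv_add (n : ℕ) (K L : ConvAlg α.seqAction) :
    evalConv n (K + L) = evalConv n K + evalConv n L := rfl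

theorem evalConv_sub (n : ℕ) (K L : ConvAlg α.seqAction) :
    evalConv n (K - L) = evalConv n K - evalConv n L := rfl

theorem evalConv_star (n : ℕ) (K : ConvAlg α.seqAction) :
    evalConv n (star K) = star (evalConv n K) := rfl

theorem evalConv_mul (n : ℕ) (K L : ConvAlg α.seqAction) :
    evalConv n (K * L) = evalConv n K * evalConv n L := by
  ext s
  exact ((α.contEvalL n).integral_comp_comm
    (ConvAlg.integrable_of_continuous (ConvAlg.continuous_integrand K L s))).symm

/-- A pointwise bound in `A_∞` is eventually a uniform bound. -/
theorem eventually_norm_evalConv_le {K : ConvAlg α.seqAction} {r : ℝ}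
    (h : ∀ s, ‖α.contMk (K s)‖ < r) : ∀ᶠ n in atTop, ∀ s, ‖evalConv n K s‖ ≤ r := by
  -- Continuity of `K` into `ℓ^∞` makes its terms equicontinuous, so a bound at `s` spreads to a
  -- neighbourhood independent of `n`; compactness finishes.
  have hloc : ∀ s : G, ∃ U ∈ 𝓝 s, ∀ᶠ n in atTop, ∀ t ∈ U, ‖evalConv n K t‖ ≤ r := fun s => by
    obtain ⟨r', h1, h2⟩ := exists_between (h s)
    have hc : Continuous fun t => ‖K t - K s‖ := (K.continuous.sub continuous_const).norm
    refine ⟨{t | ‖K t - K s‖ < r - r'},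
      (isOpen_lt hc continuous_const).mem_nhds (by simpa using h2), ?_⟩
    filter_upwards [eventually_norm_lt_of_norm_seqMk_lt (a := (K s : BddSeq A)) h1] with n hn t ht
    have h3 : ‖(K t : BddSeq A) n - (K s : BddSeq A) n‖ ≤ ‖K t - K s‖ :=
      BddSeq.norm_apply_le ((K t - K s : α.contBddSeq) : BddSeq A) n
    have h4 := norm_add_le ((K t : BddSeq A) n - (K s : BddSeq A) n) ((K s : BddSeq A) n)
    rw [sub_add_cancel] at h4
    have h5 : ‖K t - K s‖ < r - r' := ht
    rw [evalConv_apply]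
    linarith
  choose U hU hUn using hloc
  obtain ⟨t, ht⟩ := CompactSpace.elim_nhds_subcover U hU
  filter_upwards [(Finset.eventually_all t).2 fun s _ => hUn s] with n hn s
  have hs : s ∈ ⋃ x ∈ t, U x := by rw [ht]; trivial
  obtain ⟨x, hx, hsx⟩ := Set.mem_iUnion₂.1 hs
  exact hn x hx s hsx

theorem tendsto_of_evalConv {K : ConvAlg α.seqAction} (h : ∀ s, α.contMk (K s) = 0) :
    Tendsto (fun n => CrossedProduct.of (evalConv n K)) atTop (𝓝 0) := by
  rw [Metric.tendsto_nhds]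
  intro ε hε
  filter_upwards [eventually_norm_evalConv_le (K := K) (r := ε / 2) fun s => by
    rw [h, norm_zero]; exact half_pos hε] with n hn
  rw [dist_zero_right]
  exact (ConvAlg.norm_of_le hn).trans_lt (half_lt_self hε)

theorem exists_norm_of_evalConv_le (K : ConvAlg α.seqAction) :
    ∃ C, ∀ n, ‖CrossedProduct.of (evalConv n K)‖ ≤ C := by
  obtain ⟨C, hC⟩ := (isCompact_range K.continuous).isBounded.exists_norm_le
  refine ⟨C, fun n => ConvAlg.norm_of_le fun s => ?_⟩
  exact (BddSeq.norm_apply_le (K s : BddSeq A) n).trans (hC _ ⟨s, rfl⟩)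

variable (α) in
/-- The constant sequence with value `a`, as an element of `ℓ^∞_α(ℕ, A)`. -/
def constCont (a : A) : α.contBddSeq := ⟨constSeq A a, by
  change Continuous fun g => α.bddSeqMap g (constSeq A a)
  exact (continuous_constSeq).comp (α.continuous_apply a)⟩

/-- A function, as a function with values in the constant sequences. -/
def constConv (F : ConvAlg α) : ConvAlg α.seqAction :=
  (⟨fun s => α.constCont (F s), (continuous_constSeq.comp F.continuous).subtype_mk _⟩ :
    C(G, α.contBddSeq))

theorem evalConv_constConv (F : ConvAlg α) (n : ℕ) : evalConv n (constConv F) = F := rfl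

end SeqAction

end CStarAction

/-- Compact groups are unimodular. -/
theorem integral_inv_mul_eq_integral {G : Type*} [Group G] [TopologicalSpace G]
    [IsTopologicalGroup G] [CompactSpace G] [SecondCountableTopology G] [MeasurableSpace G]
    [BorelSpace G] (f : C(G, ℂ)) (h : G) :
    ∫ r, f (r⁻¹ * h) ∂(normHaar G) = ∫ x, f x ∂(normHaar G) := by
  have h1 : ∀ h, ∫ r, f (r⁻¹ * h) ∂(normHaar G) = ∫ r, f r⁻¹ ∂(normHaar G) := fun h => by
    rw [← integral_mul_left_eq_self (fun r => f (r⁻¹ * h)) h]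
    simp [mul_assoc]
  -- One order of integration gives the integral of `f (r⁻¹)`, the other that of `f`.
  have h2 : ∫ t, ∫ r, f (r⁻¹ * t) ∂(normHaar G) ∂(normHaar G) =
      ∫ r, ∫ t, f (r⁻¹ * t) ∂(normHaar G) ∂(normHaar G) :=
    integral_integral_swap_of_hasCompactSupport (f := fun t r => f (r⁻¹ * t))
      (f.continuous.comp (continuous_snd.inv.mul continuous_fst))
      (HasCompactSupport.of_compactSpace _)
  have h3 : ∀ r : G, ∫ t, f (r⁻¹ * t) ∂(normHaar G) = ∫ x, f x ∂(normHaar G) := fun r =>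
    integral_mul_left_eq_self f r⁻¹
  simp only [h1, h3] at h2
  rw [h1]
  simpa using h2

/-! ### Asymptotic matrix units in the convolution algebra -/

namespace RokhlinLift

section Kernels

set_option linter.unusedSectionVars false

variable {G A : Type*} [Group G] [TopologicalSpace G] [IsTopologicalGroup G] [CompactSpace G]
  [T2Space G] [SecondCountableTopology G] [MeasurableSpace G] [BorelSpace G]
  [NonUnitalCStarAlgebra A] {α : CStarAction G A} {D : NonUnitalStarSubalgebra ℂ A}
  (R : RokhlinLift α D)

theorem T_mul_star_toFun (F : C(G, D)) (f : C(G, ℂ)) :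
    R.T F * star (R.toFun f) = R.T (star f • F) := by
  have h := congrArg star (R.toFun_mul_T f (star F))
  rw [star_mul, T_star, star_star] at h
  rw [h, ← T_star]
  congr 1
  ext1 x
  change star (f x • star (F x)) = star (f x) • F x
  rw [star_smul, star_star]

/-- Equivariance of the lifts holds only against elements of `D`, so `F` is written as a translate
by `s` and the unshifted identity is transported. -/
theorem T_mul_map_star_toFun (F : C(G, D)) (f : C(G, ℂ)) (s : G) :
    R.T F * α.seqAlgMap s (star (R.toFun f)) =
      R.T (star (CStarAction.leftTranslate s f) • F) := by
  have h1 : R.translate s (R.translate s⁻¹ F) = F := by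
    ext h
    rw [translate_apply, translate_apply, ← α.mul_apply, mul_inv_cancel, α.one_apply, inv_inv,
      mul_inv_cancel_left]
  conv_lhs => rw [← h1, ← map_T, ← map_mul, T_mul_star_toFun, map_T]
  congr 1
  ext h
  rw [translate_apply]
  change α.toHom s (star (f (s⁻¹ * h)) • (R.translate s⁻¹ F (s⁻¹ * h) : A)) =
    star (f (s⁻¹ * h)) • (F h : A)
  rw [map_smul, translate_apply, ← α.mul_apply, mul_inv_cancel, α.one_apply, inv_inv,
    mul_inv_cancel_left]

/-- Since `Ψ d` is fixed, the action only translates the scalar function `f^* g`; averaging its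
translates yields a constant by unimodularity. -/
theorem integral_map_star_mul_mul_Ψ (f g : C(G, ℂ)) (d : D) :
    ∫ r, α.seqAlgMap r (star (R.toFun f) * (R.toFun g * R.Ψ d)) ∂(normHaar G) =
      (∫ x, star (f x) * g x ∂(normHaar G)) • R.Ψ d := by
  have key : ∀ r, α.seqAlgMap r (star (R.toFun f) * (R.toFun g * R.Ψ d)) =
      R.T (CStarAction.leftTranslate r (star f * g) • R.orbit d) := fun r => by
    rw [Ψ_apply, toFun_mul_T, star_toFun_mul_T, map_T]
    congr 1
    ext h
    rw [translate_apply]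
    change α.toHom r (star (f (r⁻¹ * h)) • g (r⁻¹ * h) • (R.orbit d (r⁻¹ * h) : A)) =
      (star (f (r⁻¹ * h)) * g (r⁻¹ * h)) • (R.orbit d h : A)
    rw [map_smul, map_smul, smul_smul, orbit_apply, orbit_apply, ← α.mul_apply,
      mul_inv_cancel_left]
  simp only [key]
  have hc : Continuous fun r => CStarAction.leftTranslate r (star f * g) :=
    ContinuousMap.continuous_of_continuous_uncurry _
      ((star f * g).continuous.comp (continuous_fst.inv.mul continuous_snd))
  let L₀ : C(G, ℂ) →ₗ[ℂ] C(G, D) :=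
    { toFun := fun k => k • R.orbit d
      map_add' := fun k l => add_smul k l _
      map_smul' := fun z k => ContinuousMap.ext fun h => smul_assoc z (k h) (R.orbit d h) }
  have hL₀ : Continuous L₀ := ContinuousMap.continuous_of_continuous_uncurry _
    (show Continuous fun p : C(G, ℂ) × G => p.1 p.2 • R.orbit d p.2 from
      Continuous.smul (f := fun p : C(G, ℂ) × G => p.1 p.2) (continuous_fst.eval continuous_snd)
        (g := fun p => R.orbit d p.2) ((R.orbit d).continuous.comp continuous_snd))
  let L : C(G, ℂ) →L[ℂ] SeqAlg A := R.T.comp ⟨L₀, hL₀⟩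
  have h1 := L.integral_comp_comm (ConvAlg.integrable_of_continuous hc)
  have h2 : ∫ r, CStarAction.leftTranslate r (star f * g) ∂(normHaar G) =
      (∫ x, star (f x) * g x ∂(normHaar G)) • (1 : C(G, ℂ)) := by
    ext h
    rw [ContinuousMap.integral_apply (ConvAlg.integrable_of_continuous hc)]
    change ∫ r, (star f * g) (r⁻¹ * h) ∂(normHaar G) = _ * (1 : ℂ)
    rw [integral_inv_mul_eq_integral (star f * g), mul_one]
    rfl
  change ∫ r, L (CStarAction.leftTranslate r (star f * g)) ∂(normHaar G) = _
  rw [h1, h2, map_smul, Ψ_apply]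
  have h3 : (1 : C(G, ℂ)) • R.orbit d = R.orbit d :=
    ContinuousMap.ext fun h => one_smul ℂ (R.orbit d h)
  exact congrArg (fun y => (∫ x, star (f x) * g x ∂(normHaar G)) • R.T y) h3

section Lift

/-- A lift of `x_f` to `ℓ^∞_α(ℕ, A)`. -/
def funLift (f : C(G, ℂ)) : α.contBddSeq := (α.exists_contMk_eq (R.mem_cont f)).choose

theorem contMk_funLift (f : C(G, ℂ)) : α.contMk (R.funLift f) = R.toFun f :=
  (α.exists_contMk_eq (R.mem_cont f)).choose_spec

/-- A lift of `Ψ(d)` to `ℓ^∞_α(ℕ, A)`. -/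
def ΨLift (d : D) : α.contBddSeq := (α.exists_contMk_eq (R.Ψ_mem d)).choose

theorem contMk_ΨLift (d : D) : α.contMk (R.ΨLift d) = R.Ψ d :=
  (α.exists_contMk_eq (R.Ψ_mem d)).choose_spec

/-- The lift of `s ↦ x_f Ψ(d) α_s(x_g)^*`. -/
def unitKernel (f : C(G, ℂ)) (d : D) (g : C(G, ℂ)) : ConvAlg α.seqAction :=
  ConvAlg.rankOne α.seqAction (R.funLift f * R.ΨLift d) (R.funLift g)

theorem contMk_unitKernel (f : C(G, ℂ)) (d : D) (g : C(G, ℂ)) (s : G) :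
    α.contMk (R.unitKernel f d g s) =
      R.toFun f * R.Ψ d * α.seqAlgMap s (star (R.toFun g)) := by
  rw [unitKernel, ConvAlg.rankOne_apply, map_mul, map_mul, contMk_funLift, contMk_ΨLift,
    α.contMk_seqAction, map_star, contMk_funLift]

/-- Exhibits the kernel as `T` of an explicit function of `h`, so that its distance to `F` can be
estimated in `C(G, D)`. -/
theorem contMk_unitKernel_eq_T (f : C(G, ℂ)) (d : D) (g : C(G, ℂ)) (s : G) :
    α.contMk (R.unitKernel f d g s) =
      R.T (star (CStarAction.leftTranslate s g) • (f • R.orbit d)) := by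
  rw [contMk_unitKernel, Ψ_apply, toFun_mul_T, T_mul_map_star_toFun]

theorem contMk_unitKernel_mul (f : C(G, ℂ)) (d : D) (g f' : C(G, ℂ)) (d' : D) (g' : C(G, ℂ))
    (s : G) : α.contMk ((R.unitKernel f d g * R.unitKernel f' d' g') s) =
      (∫ x, star (g x) * f' x ∂(normHaar G)) • α.contMk (R.unitKernel f (d * d') g' s) := by
  rw [unitKernel, unitKernel, ConvAlg.rankOne_mul_rankOne, ConvAlg.rankOne_apply, map_mul,
    map_mul, map_mul, contMk_funLift, contMk_ΨLift, α.contMk_average, map_mul, map_mul, map_star,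
    contMk_funLift, contMk_funLift, contMk_ΨLift, integral_map_star_mul_mul_Ψ, mul_smul_comm,
    smul_mul_assoc, α.contMk_seqAction, map_star, contMk_funLift, contMk_unitKernel, map_mul,
    mul_assoc (R.toFun f)]

theorem contMk_star_unitKernel (f : C(G, ℂ)) (d : D) (g : C(G, ℂ)) (s : G) :
    α.contMk (star (R.unitKernel f d g) s) = α.contMk (R.unitKernel g (star d) f s) := by
  rw [unitKernel, ConvAlg.star_rankOne, ConvAlg.rankOne_apply, map_mul, contMk_funLift,
    α.contMk_seqAction, map_star, map_mul, contMk_funLift, contMk_ΨLift, star_mul, map_mul,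
    ← map_star, R.map_Ψ, contMk_unitKernel, mul_assoc]

variable {n : ℕ} (ξ : Fin n → C(G, ℂ))

/-- The lift of `s ↦ ∑ x_i Ψ(M_ij) α_s(x_j)^*`. -/
def kernel (M : Matrix (Fin n) (Fin n) D) : ConvAlg α.seqAction :=
  ∑ i, ∑ j, R.unitKernel (ξ i) (M i j) (ξ j)

theorem contMk_sum_apply {ι : Type*} (t : Finset ι) (K : ι → ConvAlg α.seqAction) (s : G) :
    α.contMk ((∑ i ∈ t, K i) s) = ∑ i ∈ t, α.contMk (K i s) := by
  have : (∑ i ∈ t, K i) s = ∑ i ∈ t, K i s := map_sum (ConvAlg.evalHom s) K t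
  rw [this, map_sum]

theorem contMk_kernel (M : Matrix (Fin n) (Fin n) D) (s : G) :
    α.contMk (R.kernel ξ M s) = ∑ i, ∑ j, α.contMk (R.unitKernel (ξ i) (M i j) (ξ j) s) := by
  simp only [kernel, contMk_sum_apply]

theorem contMk_unitKernel_add (f : C(G, ℂ)) (d e : D) (g : C(G, ℂ)) (s : G) :
    α.contMk (R.unitKernel f (d + e) g s) =
      α.contMk (R.unitKernel f d g s) + α.contMk (R.unitKernel f e g s) := by
  simp only [contMk_unitKernel, map_add, mul_add, add_mul]

theorem contMk_unitKernel_zero (f : C(G, ℂ)) (g : C(G, ℂ)) (s : G) :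
    α.contMk (R.unitKernel f (0 : D) g s) = 0 := by
  simp only [contMk_unitKernel, map_zero, mul_zero, zero_mul]

theorem contMk_unitKernel_sum {ι : Type*} (t : Finset ι) (f : C(G, ℂ)) (d : ι → D) (g : C(G, ℂ))
    (s : G) : α.contMk (R.unitKernel f (∑ k ∈ t, d k) g s) =
      ∑ k ∈ t, α.contMk (R.unitKernel f (d k) g s) := by
  simp only [contMk_unitKernel, map_sum, Finset.mul_sum, Finset.sum_mul]

theorem contMk_kernel_add (M N : Matrix (Fin n) (Fin n) D) (s : G) :
    α.contMk (R.kernel ξ (M + N) s) =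
      α.contMk (R.kernel ξ M s) + α.contMk (R.kernel ξ N s) := by
  simp only [contMk_kernel, Matrix.add_apply, contMk_unitKernel_add, Finset.sum_add_distrib]

theorem contMk_kernel_zero (s : G) : α.contMk (R.kernel ξ 0 s) = 0 := by
  simp only [contMk_kernel, Matrix.zero_apply, contMk_unitKernel_zero, Finset.sum_const_zero]

theorem contMk_star_kernel (M : Matrix (Fin n) (Fin n) D) (s : G) :
    α.contMk (star (R.kernel ξ M) s) = α.contMk (R.kernel ξ M.conjTranspose s) := by
  rw [contMk_kernel, kernel]
  simp only [star_sum, contMk_sum_apply, contMk_star_unitKernel]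
  rw [Finset.sum_comm]
  rfl

variable {ξ}

/-- The inner products `⟨ξ_k, ξ_j⟩` collapse the fourfold sum to the matrix product. -/
theorem contMk_kernel_mul
    (hξ : ∀ i j, ∫ x, star (ξ i x) * ξ j x ∂(normHaar G) = if i = j then 1 else 0)
    (M N : Matrix (Fin n) (Fin n) D) (s : G) :
    α.contMk ((R.kernel ξ M * R.kernel ξ N) s) = α.contMk (R.kernel ξ (M * N) s) := by
  have h : R.kernel ξ M * R.kernel ξ N = ∑ i, ∑ k, ∑ j, ∑ l,
      R.unitKernel (ξ i) (M i k) (ξ k) * R.unitKernel (ξ j) (N j l) (ξ l) := by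
    rw [kernel, kernel, Finset.sum_mul]
    refine Finset.sum_congr rfl fun i _ => ?_
    rw [Finset.sum_mul]
    refine Finset.sum_congr rfl fun k _ => ?_
    rw [Finset.mul_sum]
    refine Finset.sum_congr rfl fun j _ => ?_
    rw [Finset.mul_sum]
  rw [h, contMk_kernel]
  simp only [contMk_sum_apply, Matrix.mul_apply, contMk_unitKernel_sum]
  refine Finset.sum_congr rfl fun i _ => ?_
  rw [Finset.sum_comm (s := Finset.univ) (t := Finset.univ)
    (f := fun l k => α.contMk (R.unitKernel (ξ i) (M i k * N k l) (ξ l) s))]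
  refine Finset.sum_congr rfl fun k _ => ?_
  rw [Finset.sum_comm]
  refine Finset.sum_congr rfl fun l _ => ?_
  simp only [contMk_unitKernel_mul, hξ, ite_smul, one_smul, zero_smul, Finset.sum_ite_eq,
    Finset.mem_univ, if_true]

/-- The kernels are close to a given function `F` if the corresponding matrices approximate
`α_h^{-1}(F(h t^{-1}))`. -/
theorem norm_contMk_kernel_sub_le (M : Matrix (Fin n) (Fin n) D) (F : ConvAlg α)
    (hF : ∀ s, F s ∈ D) {ε : ℝ} (hε : 0 ≤ ε)
    (h : ∀ x t, ‖α.toHom x⁻¹ (F (x * t⁻¹)) -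
      ∑ i, ∑ j, (ξ i x * star (ξ j t)) • (M i j : A)‖ ≤ ε) (s : G) :
    ‖α.contMk ((R.kernel ξ M - CStarAction.constConv F) s)‖ ≤ 6 * ε := by
  have e1 : α.contMk ((R.kernel ξ M - CStarAction.constConv F) s) =
      α.contMk (R.kernel ξ M s) - toSeqAlg (F s) := map_sub α.contMk _ _
  have e2 : toSeqAlg (F s) = R.T (ContinuousMap.const G ⟨F s, hF s⟩) := (R.T_const ⟨F s, hF s⟩).symm
  rw [e1, e2, contMk_kernel]
  simp only [contMk_unitKernel_eq_T, ← map_sum, ← map_sub]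
  refine (R.norm_T_le _).trans (mul_le_mul_of_nonneg_left ?_ (by norm_num))
  rw [ContinuousMap.norm_le _ hε]
  intro x
  -- With `t = s⁻¹ x` one has `x t⁻¹ = s`; applying the isometry `α_x` then compares `F s` with the
  -- value at `x` of the function under `T`.
  have h1 := h x (s⁻¹ * x)
  rw [norm_sub_rev, ← α.norm_apply x, map_sub, ← α.mul_apply, mul_inv_cancel, α.one_apply,
    mul_inv_rev, mul_inv_cancel_left, inv_inv] at h1
  refine le_trans (le_of_eq ?_) h1
  change ‖(((∑ i, ∑ j, star (CStarAction.leftTranslate s (ξ j)) •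
    (ξ i • R.orbit (M i j))) x : D) : A) - F s‖ = _
  congr 2
  simp only [ContinuousMap.sum_apply, AddSubmonoidClass.coe_finsetSum, map_sum, map_smul]
  refine Finset.sum_congr rfl fun i _ => Finset.sum_congr rfl fun j _ => ?_
  change star (ξ j (s⁻¹ * x)) • ξ i x • α.toHom x (M i j) = _
  rw [smul_smul, mul_comm]

end Lift

end Kernels

end RokhlinLift

/-! ### Scalar-matrix kernels: linearity, adjoints and bounds -/

section KernelSum

variable {G A : Type*} [TopologicalSpace G] [NonUnitalCStarAlgebra A] {n : ℕ}

/-- The integral kernel with matrix `a` with respect to the family `ξ`. -/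
def kernelSum (ξ : Fin n → C(G, ℂ)) (a : Matrix (Fin n) (Fin n) A) (h t : G) : A :=
  ∑ i, ∑ j, (ξ i h * star (ξ j t)) • a i j

theorem kernelSum_add (ξ : Fin n → C(G, ℂ)) (a b : Matrix (Fin n) (Fin n) A) (h t : G) :
    kernelSum ξ (a + b) h t = kernelSum ξ a h t + kernelSum ξ b h t := by
  simp only [kernelSum, Matrix.add_apply, smul_add, Finset.sum_add_distrib]

theorem kernelSum_sub (ξ : Fin n → C(G, ℂ)) (a b : Matrix (Fin n) (Fin n) A) (h t : G) :
    kernelSum ξ (a - b) h t = kernelSum ξ a h t - kernelSum ξ b h t := by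
  simp only [kernelSum, Matrix.sub_apply, smul_sub, Finset.sum_sub_distrib]

theorem kernelSum_smul (ξ : Fin n → C(G, ℂ)) (z : ℂ) (a : Matrix (Fin n) (Fin n) A) (h t : G) :
    kernelSum ξ (z • a) h t = z • kernelSum ξ a h t := by
  simp only [kernelSum, Matrix.smul_apply, Finset.smul_sum, smul_comm z]

theorem kernelSum_conjTranspose (ξ : Fin n → C(G, ℂ)) (a : Matrix (Fin n) (Fin n) A) (h t : G) :
    kernelSum ξ a.conjTranspose h t = star (kernelSum ξ a t h) := by
  simp only [kernelSum, star_sum, star_smul, star_mul', star_star, Matrix.conjTranspose_apply]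
  rw [Finset.sum_comm]
  simp only [mul_comm]

theorem norm_kernelSum_le [CompactSpace G] (ξ : Fin n → C(G, ℂ)) {a : Matrix (Fin n) (Fin n) A}
    {δ : ℝ} (ha : ∀ i j, ‖a i j‖ ≤ δ) (h t : G) :
    ‖kernelSum ξ a h t‖ ≤ (∑ i, ∑ j, ‖ξ i‖ * ‖ξ j‖) * δ := by
  rw [Finset.sum_mul]
  refine norm_sum_le_of_le _ fun i _ => ?_
  rw [Finset.sum_mul]
  refine norm_sum_le_of_le _ fun j _ => ?_
  rw [norm_smul, norm_mul, norm_star]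
  gcongr
  · exact (ξ i).norm_coe_le_norm h
  · exact (ξ j).norm_coe_le_norm t
  · exact ha i j

/-- A kernel with values in a hermitian-symmetric function may be approximated by hermitian
matrices. -/
theorem norm_sub_kernelSum_symm_le (ξ : Fin n → C(G, ℂ)) {a : Matrix (Fin n) (Fin n) A}
    {K : G → G → A} (hK : ∀ h t, star (K t h) = K h t) {ε : ℝ}
    (ha : ∀ h t, ‖K h t - kernelSum ξ a h t‖ ≤ ε) (h t : G) :
    ‖K h t - kernelSum ξ ((2⁻¹ : ℂ) • (a + a.conjTranspose)) h t‖ ≤ ε := by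
  have e : K h t - kernelSum ξ ((2⁻¹ : ℂ) • (a + a.conjTranspose)) h t =
      (2⁻¹ : ℂ) • ((K h t - kernelSum ξ a h t) + star (K t h - kernelSum ξ a t h)) := by
    rw [kernelSum_smul, kernelSum_add, kernelSum_conjTranspose, star_sub, hK]
    have h2 : K h t = (2⁻¹ : ℂ) • (K h t + K h t) := by
      rw [← two_smul ℂ (K h t), smul_smul]; norm_num
    conv_lhs => rw [h2]
    rw [← smul_sub]
    congr 1
    abel
  rw [e, norm_smul, norm_inv, Complex.norm_ofNat]
  have h1 := norm_add_le (K h t - kernelSum ξ a h t) (star (K t h - kernelSum ξ a t h))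
  rw [norm_star] at h1
  have h2 := ha h t
  have h3 := ha t h
  linarith

end KernelSum

/-! ### Density of quasiregular elements in the crossed product -/

section Crossed

variable {G A : Type*} [Group G] [TopologicalSpace G] [IsTopologicalGroup G] [CompactSpace G]
  [SecondCountableTopology G] [MeasurableSpace G] [BorelSpace G] [NonUnitalCStarAlgebra A]
  {α : CStarAction G A}

/-- Continuous functions are dense in the crossed product, compatibly with the involution. -/
theorem CrossedProduct.exists_of_near {sa : Prop} (x : CrossedProduct α)
    (hx : sa → IsSelfAdjoint x) {ε : ℝ} (hε : 0 < ε) :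
    ∃ F : ConvAlg α, (sa → star F = F) ∧ ‖of F - x‖ < ε := by
  obtain ⟨F, hF⟩ := Metric.denseRange_iff.1 denseRange_of x ε hε
  rw [dist_comm, dist_eq_norm] at hF
  by_cases hs : sa
  · refine ⟨(2⁻¹ : ℂ) • (F + star F), fun _ => ?_, ?_⟩
    · rw [star_smul, star_add, star_star, add_comm]
      congr 1
      simp
    · have e : of ((2⁻¹ : ℂ) • (F + star F)) - x =
          (2⁻¹ : ℂ) • ((of F - x) + star (of F - x)) := by
        rw [map_smul, map_add, of_star, star_sub, (hx hs).star_eq]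
        have h2 : x = (2⁻¹ : ℂ) • (x + x) := by
          rw [← two_smul ℂ x, smul_smul]; norm_num
        conv_lhs => rw [h2]
        rw [← smul_sub]
        congr 1
        abel
      rw [e, norm_smul, norm_inv, Complex.norm_ofNat]
      have h1 := norm_add_le (of F - x) (star (of F - x))
      rw [norm_star] at h1
      linarith
  · exact ⟨F, fun h => absurd h hs, hF⟩

/-- The integral kernel of a self-adjoint function is hermitian, so its matrix may be chosen
hermitian. -/
theorem CStarAction.star_apply_kernel {F : ConvAlg α} (hF : star F = F) (h t : G) :
    star (α.toHom t⁻¹ (F (t * h⁻¹))) = α.toHom h⁻¹ (F (h * t⁻¹)) := by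
  conv_rhs => rw [← hF]
  rw [ConvAlg.star_apply, ← α.mul_apply, inv_mul_cancel_left, mul_inv_rev, inv_inv, map_star]

/-- The kernel of a continuous function is close to the kernel of a quasiregular matrix. -/
theorem QuasiDense.exists_matrix_near [T2Space G] {sa : Prop} (hq : QuasiDense sa A) {F : ConvAlg α}
    (hF : sa → star F = F) {ε : ℝ} (hε : 0 < ε) :
    ∃ (n : ℕ) (ξ : Fin n → C(G, ℂ)) (b : Matrix (Fin n) (Fin n) A),
      (∀ i j, ∫ x, star (ξ i x) * ξ j x ∂(normHaar G) = if i = j then 1 else 0) ∧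
      (sa → b.IsHermitian) ∧ IsQuasiregular b ∧
      ∀ h t, ‖α.toHom h⁻¹ (F (h * t⁻¹)) - kernelSum ξ b h t‖ ≤ ε := by
  have hK : Continuous fun p : G × G => α.toHom p.1⁻¹ (F (p.1 * p.2⁻¹)) :=
    α.continuous_uncurry.comp (continuous_fst.inv.prodMk
      (F.continuous.comp (continuous_fst.mul continuous_snd.inv)))
  obtain ⟨n, ξ, a, hξ, ha⟩ := exists_kernel_approx ⟨_, hK⟩ (half_pos hε)
  obtain ⟨a', ha's, ha'⟩ : ∃ a' : Matrix (Fin n) (Fin n) A, (sa → a'.IsHermitian) ∧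
      ∀ h t, ‖α.toHom h⁻¹ (F (h * t⁻¹)) - kernelSum ξ a' h t‖ ≤ ε / 2 := by
    by_cases hs : sa
    · refine ⟨(2⁻¹ : ℂ) • (a + a.conjTranspose), fun _ => ?_,
        norm_sub_kernelSum_symm_le ξ (K := fun h t => α.toHom h⁻¹ (F (h * t⁻¹)))
          (fun h t => CStarAction.star_apply_kernel (hF hs) h t) ha⟩
      rw [Matrix.IsHermitian, Matrix.conjTranspose_smul, Matrix.conjTranspose_add,
        Matrix.conjTranspose_conjTranspose, add_comm]
      congr 1
      simp
    · exact ⟨a, fun h => absurd h hs, ha⟩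
  set B := ∑ i, ∑ j, ‖ξ i‖ * ‖ξ j‖
  have hB : 0 ≤ B := Finset.sum_nonneg fun i _ => Finset.sum_nonneg fun j _ => by positivity
  -- Entrywise errors are amplified by at most `B` in the kernel; `B + 1` avoids division by zero.
  have hδ : 0 < ε / 2 / (B + 1) := by positivity
  obtain ⟨b, hbs, hb, hbq⟩ := hq.matrix n a' ha's _ hδ
  refine ⟨n, ξ, b, hξ, hbs, hbq, fun h t => ?_⟩
  have h1 := norm_kernelSum_le ξ (a := a' - b) (fun i j => (hb i j).le) h t
  have h2 : B * (ε / 2 / (B + 1)) ≤ ε / 2 := by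
    rw [mul_div_left_comm]
    exact mul_le_of_le_one_right (half_pos hε).le ((div_le_one (by positivity)).2 (by linarith))
  rw [kernelSum_sub] at h1
  have h3 := norm_sub_le_norm_sub_add_norm_sub (α.toHom h⁻¹ (F (h * t⁻¹))) (kernelSum ξ a' h t)
    (kernelSum ξ b h t)
  linarith [ha' h t]

open CStarAction in
-- The quasiregular matrix and its quasi-inverse are sent to sequences of continuous functions,
-- asymptotically quasi-inverse in supremum norm and hence in `A ⋊ G`.
theorem QuasiDense.crossedProduct [T2Space G] {sa : Prop} (hq : QuasiDense sa A)
    (hA : IsSigmaUnital A) (hα : α.HasRokhlinProperty) : QuasiDense sa (CrossedProduct α) := by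
  intro x hx ε hε
  obtain ⟨F, hFs, hF⟩ := CrossedProduct.exists_of_near x hx (half_pos hε)
  -- `T` enlarges the error to `6ε/20`; `7ε/20` gives strict room, and `7ε/20 + ε/2 < ε`.
  have hη : 0 < ε / 20 := by positivity
  obtain ⟨n, ξ, b, hξ, hbs, hbq, hb⟩ := hq.exists_matrix_near hFs hη
  obtain ⟨c, hc1, hc2⟩ := isQuasiregular_iff_exists.1 hbq
  have hS : TopologicalSpace.IsSeparable (Set.range F ∪
      (Set.range (fun p : Fin n × Fin n => b p.1 p.2) ∪
        Set.range (fun p : Fin n × Fin n => c p.1 p.2))) :=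
    (isCompact_range F.continuous).isSeparable.union
      ((Set.finite_range _).isSeparable.union (Set.finite_range _).isSeparable)
  obtain ⟨D, hSD, ⟨R⟩⟩ := hα.exists_lift hA hS
  let bD : Matrix (Fin n) (Fin n) D :=
    fun i j => ⟨b i j, hSD (Or.inr (Or.inl ⟨(i, j), rfl⟩))⟩
  let cD : Matrix (Fin n) (Fin n) D :=
    fun i j => ⟨c i j, hSD (Or.inr (Or.inr ⟨(i, j), rfl⟩))⟩
  have coe_mul : ∀ (u v : Matrix (Fin n) (Fin n) D) i j,
      (((u * v) i j : D) : A) = ∑ k, (u i k : A) * (v k j : A) := fun u v i j => by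
    rw [Matrix.mul_apply, AddSubmonoidClass.coe_finsetSum]; rfl
  have hD1 : bD + cD + bD * cD = 0 := by
    ext i j
    change (b i j + c i j + ((bD * cD) i j : D) : A) = 0
    rw [coe_mul]
    exact congrFun (congrFun hc1 i) j
  have hD2 : bD + cD + cD * bD = 0 := by
    ext i j
    change (b i j + c i j + ((cD * bD) i j : D) : A) = 0
    rw [coe_mul]
    exact congrFun (congrFun hc2 i) j
  have hbn : ∀ᶠ m in atTop, ∀ s,
      ‖evalConv m (R.kernel ξ bD - constConv F) s‖ ≤ 7 * (ε / 20) :=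
    eventually_norm_evalConv_le fun s =>
      (R.norm_contMk_kernel_sub_le bD F (fun s => hSD (Or.inl ⟨s, rfl⟩)) hη.le hb s).trans_lt
        (by linarith)
  -- Applied with both orders of `bD` and `cD`, this gives the left and the right quasi-inverse
  -- relation modulo null sequences.
  have relation : ∀ u v : Matrix (Fin n) (Fin n) D, u + v + u * v = 0 → ∀ s,
      α.contMk ((R.kernel ξ u + R.kernel ξ v + R.kernel ξ u * R.kernel ξ v) s) = 0 := by
    intro u v h s
    rw [ConvAlg.add_apply, ConvAlg.add_apply, map_add, map_add, R.contMk_kernel_mul hξ,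
      ← R.contMk_kernel_add, ← R.contMk_kernel_add, h, R.contMk_kernel_zero]
  obtain ⟨K, hK⟩ := exists_norm_of_evalConv_le (R.kernel ξ cD)
  refine exists_isQuasiregular_near (ε := 7 * (ε / 20) + ε / 2)
    (b := fun m => CrossedProduct.of (evalConv m (R.kernel ξ bD)))
    (c := fun m => CrossedProduct.of (evalConv m (R.kernel ξ cD))) ?_ ?_ ?_ ?_ hK (by linarith)
  · filter_upwards [hbn] with m hm
    have h1 := ConvAlg.norm_of_le hm
    rw [evalConv_sub, evalConv_constConv, map_sub] at h1
    exact (norm_sub_le_norm_sub_add_norm_sub _ (CrossedProduct.of F) x).trans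
      (add_le_add h1 hF.le)
  · refine (tendsto_of_evalConv (relation bD cD hD1)).congr fun m => ?_
    rw [evalConv_add, evalConv_add, evalConv_mul, map_add, map_add, CrossedProduct.of_mul]
  · refine (tendsto_of_evalConv (relation cD bD (by rw [add_comm cD, hD2]))).congr fun m => ?_
    rw [evalConv_add, evalConv_add, evalConv_mul, map_add, map_add, CrossedProduct.of_mul,
      add_comm (CrossedProduct.of (evalConv m (R.kernel ξ cD)))]
  · intro hs
    have hbD : bD.conjTranspose = bD := by
      ext i j
      exact congrFun (congrFun (hbs hs) i) j
    have h0 : ∀ s, α.contMk ((R.kernel ξ bD - star (R.kernel ξ bD)) s) = 0 := fun s => by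
      change α.contMk (R.kernel ξ bD s - star (R.kernel ξ bD) s) = 0
      rw [map_sub, R.contMk_star_kernel, hbD, sub_self]
    refine (tendsto_of_evalConv h0).congr fun m => ?_
    rw [evalConv_sub, evalConv_star, map_sub, CrossedProduct.of_star]

end Crossed

/-- Permanence of real rank zero and of stable rank one under passage to fixed point algebras and
crossed products of actions with the Rokhlin property. -/
theorem mainTheorem10 {G A : Type*} [Group G] [TopologicalSpace G] [IsTopologicalGroup G]
    [CompactSpace G] [T2Space G] [SecondCountableTopology G] [MeasurableSpace G] [BorelSpace G]
    [NonUnitalCStarAlgebra A] (hA : IsSigmaUnital A)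
    (α : CStarAction G A) (hα : α.HasRokhlinProperty) :
    (RealRankZero A → RealRankZero α.fixedPoints ∧ RealRankZero (CrossedProduct α)) ∧
    (StableRankOne A → StableRankOne α.fixedPoints ∧ StableRankOne (CrossedProduct α)) := by
  simp only [realRankZero_iff, stableRankOne_iff]
  exact ⟨fun h => ⟨h.fixedPoints hA hα, h.crossedProduct hA hα⟩,
    fun h => ⟨h.fixedPoints hA hα, h.crossedProduct hA hα⟩⟩

end
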